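/- Let $M$ be a smooth manifold (Hausdorff, second countable, without boundary), and let $A\to M$ be a Lie algebroid of finite rank with anchor $\rho$ and bracket $[\;,\;]$ on $\Gamma(A)$. Let $d_A$ be the differential on the forms $\Gamma(\wedge^\bullet A^*)$, let $i_X$ be the insertion of $X\in\Gamma(A)$ as the first argument of a form, put $i_{X_1\wedge\dots\wedge X_p}=i_{X_1}\circ\dots\circ i_{X_p}$, and let $\mathcal L_X=[i_X,d_A]=i_Xd_A+d_Ai_X$. The Gerstenhaber bracket of multivectors on $\Gamma(\wedge^\bullet A)$ is also denoted by $[\;,\;]$. Let $(\pi,\psi)$ be a twisted Poisson structure on $A$, that is, $\pi\in\Gamma(\wedge^2A)$ and $\psi\in\Gamma(\wedge^3A^*)$ satisfy $$d_A\psi=0,\qquad \tfrac12[\pi,\pi]=(\wedge^3\pi^\sharp)\psi ,$$ where $\pi^\sharp:A^*\to A$ is defined by $\langle\beta,\pi^\sharp\alpha\rangle=\pi(\alpha,\beta)$ and $\wedge^3\pi^\sharp$ maps $\alpha\wedge\beta\wedge\gamma$ to $\pi^\sharp\alpha\wedge\pi^\sharp\beta\wedge\pi^\sharp\gamma$. Let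 $\psi^{(2)}$ be the section of $A^*\otimes\wedge^2A$ with $\psi^{(2)}(\alpha,\beta)=\psi(\pi^\sharp\alpha,\pi^\sharp\beta,\cdot\,)$ for $\alpha,\beta\in\Gamma(A^*)$, and define * $\partial_\pi=[d_A,i_\pi]=d_A\,i_\pi-i_\pi\,d_A$; * $\underline\partial_{\pi,\psi}=i_{\psi^{(2)}}$, the interior product by $\psi^{(2)}$, where $i_{\xi\otimes P}\lambda=\xi\wedge i_P\lambda$ for $\xi\in\Gamma(A^*)$, $P\in\Gamma(\wedge^2A)$; * $Y_{\pi,\psi}=\pi^\sharp(\psi(\pi,\cdot\,))\in\Gamma(A)$, where $\psi(X\wedge Y,\cdot\,)=\psi(X,Y,\cdot\,)$. Equivalently, $\langle\alpha,Y_{\pi,\psi}\rangle=\tfrac12\operatorname{Tr}\bigl(\beta\mapsto\psi^{(2)}(\alpha,\beta)\bigr)$ for every $\alpha\in\Gamma(A^*)$. **Theorem.** There is exactly one Gerstenhaber bracket $[\;,\;]_{\pi,\psi}$ on the graded commutative algebra $(\Gamma(\wedge^\bullet A^*),\wedge)$ such that, for all $\alpha,\beta\in\Gamma(A^*)$ and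 $f\in C^\infty(M)$, $$[\alpha,f]_{\pi,\psi}=\rho(\pi^\sharp\alpha)f,\qquad [\alpha,\beta]_{\pi,\psi}=\mathcal L_{\pi^\sharp\alpha}\beta-\mathcal L_{\pi^\sharp\beta}\alpha-d_A(\pi(\alpha,\beta))+\psi^{(2)}(\alpha,\beta).$$ The operator $u=\partial_\pi+\underline\partial_{\pi,\psi}+i_{Y_{\pi,\psi}}$ is a generator of square zero of this Gerstenhaber algebra: for all $a$ homogeneous of degree $|a|$ and all $b$, $$[a,b]_{\pi,\psi}=(-1)^{|a|}\bigl(u(a\wedge b)-u(a)\wedge b-(-1)^{|a|}a\wedge u(b)\bigr),\qquad u^2=0 .$$ Consequently $(\Gamma(\wedge^\bullet A^*),\wedge,[\;,\;]_{\pi,\psi},u)$ is a Batalin–Vilkovisky algebra. -/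

import Mathlib

open scoped Manifold ContDiff TensorProduct DirectSum

noncomputable section

namespace TwistedPoisson

/-! ### Lie-Rinehart pairs: the algebra of functions and the module of sections -/

/-- The algebraic structure carried by the functions `R` and the sections `L` of a Lie
algebroid: an `ℝ`-Lie bracket on `L` and an `R`-linear anchor into the derivations of `R`,
compatible with the bracket, such that the Leibniz rule holds. -/
structure LieRinehart (R L : Type*) [CommRing R] [Algebra ℝ R] [AddCommGroup L] [Module ℝ L]
    [Module R L] [IsScalarTower ℝ R L] where
  bracket : L →ₗ[ℝ] L →ₗ[ℝ] L
  anchor : L →ₗ[R] Derivation ℝ R R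
  bracket_self : ∀ a, bracket a a = 0
  jacobi : ∀ a b c, bracket a (bracket b c) = bracket (bracket a b) c + bracket b (bracket a c)
  leibniz : ∀ a b (f : R), bracket a (f • b) = f • bracket a b + anchor a f • b
  anchor_bracket : ∀ a b (f : R),
    anchor (bracket a b) f = anchor a (anchor b f) - anchor b (anchor a f)

/-! ### Graded derivations of an exterior algebra -/

section GradedDerivation

variable {R L : Type*} [CommRing R] [AddCommGroup L] [Module R L]

/-- Pairs `(a, m)` standing for the triangular matrices with diagonal `(σ a, a)` and upper right
entry `m`. A `σ`-derivation `D` is the same as a ring homomorphism `a ↦ (a, D a)`. -/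
@[ext]
structure Tri {B : Type*} [Ring B] (σ : B →+* B) where
  fst : B
  snd : B

namespace Tri

variable {B : Type*} [Ring B] {σ : B →+* B}

instance : Zero (Tri σ) := ⟨⟨0, 0⟩⟩
instance : One (Tri σ) := ⟨⟨1, 0⟩⟩
instance : Add (Tri σ) := ⟨fun x y => ⟨x.fst + y.fst, x.snd + y.snd⟩⟩
instance : Neg (Tri σ) := ⟨fun x => ⟨-x.fst, -x.snd⟩⟩
instance : Mul (Tri σ) := ⟨fun x y => ⟨x.fst * y.fst, σ x.fst * y.snd + x.snd * y.fst⟩⟩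

@[simp] theorem fst_zero : (0 : Tri σ).fst = 0 := rfl
@[simp] theorem snd_zero : (0 : Tri σ).snd = 0 := rfl
@[simp] theorem fst_one : (1 : Tri σ).fst = 1 := rfl
@[simp] theorem snd_one : (1 : Tri σ).snd = 0 := rfl
@[simp] theorem fst_add (x y : Tri σ) : (x + y).fst = x.fst + y.fst := rfl
@[simp] theorem snd_add (x y : Tri σ) : (x + y).snd = x.snd + y.snd := rfl
@[simp] theorem fst_neg (x : Tri σ) : (-x).fst = -x.fst := rfl
@[simp] theorem snd_neg (x : Tri σ) : (-x).snd = -x.snd := rfl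
@[simp] theorem fst_mul (x y : Tri σ) : (x * y).fst = x.fst * y.fst := rfl
@[simp] theorem snd_mul (x y : Tri σ) :
    (x * y).snd = σ x.fst * y.snd + x.snd * y.fst := rfl

instance : Ring (Tri σ) where
  add_assoc x y z := by ext <;> simp [add_assoc]
  zero_add x := by ext <;> simp
  add_zero x := by ext <;> simp
  add_comm x y := by ext <;> simp [add_comm]
  neg_add_cancel x := by ext <;> simp
  mul_assoc x y z := by ext <;> simp [mul_add, add_mul, mul_assoc, add_assoc]
  one_mul x := by ext <;> simp
  mul_one x := by ext <;> simp
  left_distrib x y z := by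
    ext
    · simp [mul_add]
    · simp only [snd_mul, snd_add, fst_add, mul_add]; abel
  right_distrib x y z := by
    ext
    · simp [add_mul]
    · simp only [snd_mul, snd_add, fst_add, add_mul, map_add]; abel
  zero_mul x := by ext <;> simp
  mul_zero x := by ext <;> simp
  nsmul := nsmulRec
  zsmul := zsmulRec

end Tri

/-- Prescribed values, on functions and on sections, of a derivation of the exterior algebra
that is twisted by an algebra endomorphism `σ` (a power of the grade involution). -/
structure DerivationData (R L : Type*) [CommRing R] [AddCommGroup L] [Module R L]
    (σ : ExteriorAlgebra R L →ₐ[R] ExteriorAlgebra R L) where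
  D₀ : R →+ ExteriorAlgebra R L
  D₁ : L →+ ExteriorAlgebra R L
  D₀_mul : ∀ f g, D₀ (f * g) = f • D₀ g + g • D₀ f
  D₀_comm : ∀ f b, D₀ f * b = σ b * D₀ f
  D₁_smul : ∀ (f : R) v, D₁ (f • v) = f • D₁ v + D₀ f * ExteriorAlgebra.ι R v
  D₁_sq : ∀ v, σ (ExteriorAlgebra.ι R v) * D₁ v + D₁ v * ExteriorAlgebra.ι R v = 0

namespace DerivationData

variable {σ : ExteriorAlgebra R L →ₐ[R] ExteriorAlgebra R L} (D : DerivationData R L σ)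

theorem D₀_one : D.D₀ 1 = 0 := by
  have h := D.D₀_mul 1 1
  simpa using h

/-- The ring homomorphism `f ↦ (f, D₀ f)`. -/
def baseHom : R →+* Tri (σ : ExteriorAlgebra R L →+* ExteriorAlgebra R L) where
  toFun f := ⟨algebraMap R _ f, D.D₀ f⟩
  map_one' := by ext <;> simp [D₀_one]
  map_zero' := by ext <;> simp
  map_add' f g := by ext <;> simp
  map_mul' f g := by
    ext
    · simp
    · simp [D.D₀_mul, Algebra.smul_def, Algebra.commutes]

theorem baseHom_comm (f : R) (x : Tri (σ : ExteriorAlgebra R L →+* ExteriorAlgebra R L)) :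
    D.baseHom f * x = x * D.baseHom f := by
  ext
  · simp [baseHom, Algebra.commutes]
  · simp [baseHom, Algebra.commutes, D.D₀_comm, add_comm]

/-- The `R`-algebra structure given by `f ↦ (f, D₀ f)`. -/
@[reducible] def algebra :
    Algebra R (Tri (σ : ExteriorAlgebra R L →+* ExteriorAlgebra R L)) :=
  D.baseHom.toAlgebra' D.baseHom_comm

/-- The algebra homomorphism `a ↦ (a, D a)`. -/
def hom : ExteriorAlgebra R L →+* Tri (σ : ExteriorAlgebra R L →+* ExteriorAlgebra R L) :=
  letI := D.algebra
  (ExteriorAlgebra.lift R (A := Tri (σ : ExteriorAlgebra R L →+* ExteriorAlgebra R L))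
    ⟨{ toFun := fun v => ⟨ExteriorAlgebra.ι R v, D.D₁ v⟩
       map_add' := fun v w => by ext <;> simp
       map_smul' := fun f v => by
        rw [Algebra.smul_def]
        change _ = D.baseHom f * _
        ext
        · simp [baseHom, Algebra.smul_def]
        · simp [baseHom, D.D₁_smul, Algebra.smul_def] },
      fun v => by
        ext
        · simp
        · simpa using D.D₁_sq v⟩ : _ →ₐ[R] _).toRingHom

@[simp] theorem hom_algebraMap (f : R) : D.hom (algebraMap R _ f) = ⟨algebraMap R _ f, D.D₀ f⟩ := by
  let := D.algebra
  exact AlgHom.commutes _ f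

@[simp] theorem hom_ι (v : L) :
    D.hom (ExteriorAlgebra.ι R v) = ⟨ExteriorAlgebra.ι R v, D.D₁ v⟩ := by
  let := D.algebra
  exact ExteriorAlgebra.lift_ι_apply R _ _ v

theorem fst_hom (a : ExteriorAlgebra R L) : (D.hom a).fst = a := by
  induction a using ExteriorAlgebra.induction with
  | algebraMap r => simp
  | ι x => simp
  | mul a b ha hb => simp [ha, hb]
  | add a b ha hb => simp [ha, hb]

/-- The twisted derivation with the prescribed values. -/
def derivation : ExteriorAlgebra R L →+ ExteriorAlgebra R L where
  toFun a := (D.hom a).snd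
  map_zero' := by simp
  map_add' a b := by simp

@[simp] theorem derivation_algebraMap (f : R) : D.derivation (algebraMap R _ f) = D.D₀ f := by
  simp [derivation]

@[simp] theorem derivation_ι (v : L) : D.derivation (ExteriorAlgebra.ι R v) = D.D₁ v := by
  simp [derivation]

theorem derivation_mul (a b : ExteriorAlgebra R L) :
    D.derivation (a * b) = D.derivation a * b + σ a * D.derivation b := by
  simp [derivation, fst_hom, add_comm]

end DerivationData

/-- The `k`-th power of the grade involution: multiplication by `(-1) ^ (k * p)` in degree `p`. -/
def signHom (R L : Type*) [CommRing R] [AddCommGroup L] [Module R L] (k : ℕ) :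
    ExteriorAlgebra R L →ₐ[R] ExteriorAlgebra R L :=
  CliffordAlgebra.involute ^ k

@[simp] theorem signHom_ι (k : ℕ) (v : L) :
    signHom R L k (ExteriorAlgebra.ι R v) = (-1 : R) ^ k • ExteriorAlgebra.ι R v := by
  induction k with
  | zero => simp [signHom]
  | succ k ih =>
    have h : signHom R L (k + 1) (ExteriorAlgebra.ι R v)
        = signHom R L k (CliffordAlgebra.involute (ExteriorAlgebra.ι R v)) := by
      simp [signHom, pow_succ]
    rw [h, show CliffordAlgebra.involute (ExteriorAlgebra.ι R v) = -ExteriorAlgebra.ι R v from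
      CliffordAlgebra.involute_ι v, map_neg, ih, pow_succ]
    simp

theorem signHom_add (j k : ℕ) (a : ExteriorAlgebra R L) :
    signHom R L (j + k) a = signHom R L j (signHom R L k a) := by
  simp [signHom, pow_add]

theorem signHom_add_two (k : ℕ) : signHom R L (k + 2) = signHom R L k := by
  have h : (CliffordAlgebra.involute : ExteriorAlgebra R L →ₐ[R] ExteriorAlgebra R L) ^ 2 = 1 := by
    ext v
    simp [pow_two]
  simp [signHom, pow_add, h]

/-- The elements that commute with everything like an element of degree `k`. -/
def gradedCenter (R L : Type*) [CommRing R] [AddCommGroup L] [Module R L] (k : ℕ) :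
    Submodule R (ExteriorAlgebra R L) where
  carrier := {a | ∀ b, a * b = signHom R L k b * a}
  add_mem' ha hb c := by rw [add_mul, mul_add, ha c, hb c]
  zero_mem' c := by simp
  smul_mem' r a ha c := by rw [smul_mul_assoc, ha c, mul_smul_comm]

theorem gradedCenter_add_two (k : ℕ) : gradedCenter R L (k + 2) = gradedCenter R L k := by
  ext a
  change (∀ b, a * b = signHom R L (k + 2) b * a) ↔ (∀ b, a * b = signHom R L k b * a)
  rw [signHom_add_two]

theorem mul_mem_gradedCenter {j k : ℕ} {a b : ExteriorAlgebra R L}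
    (ha : a ∈ gradedCenter R L j) (hb : b ∈ gradedCenter R L k) :
    a * b ∈ gradedCenter R L (j + k) := by
  intro c
  rw [mul_assoc, hb c, ← mul_assoc, ha, signHom_add, mul_assoc]

theorem algebraMap_mem_gradedCenter (f : R) : algebraMap R _ f ∈ gradedCenter R L 0 := by
  intro b
  simp [signHom, Algebra.commutes]

theorem ι_mem_gradedCenter (v : L) : ExteriorAlgebra.ι R v ∈ gradedCenter R L 1 := by
  intro b
  induction b using ExteriorAlgebra.induction with
  | algebraMap r => simp [Algebra.commutes]
  | ι w =>
    have h := ExteriorAlgebra.ι_add_mul_swap (R := R) v w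
    simp only [signHom_ι, pow_one, neg_smul, one_smul, neg_mul]
    exact eq_neg_of_add_eq_zero_left h
  | mul a b ha hb => rw [← mul_assoc, ha, mul_assoc, hb, ← mul_assoc, map_mul]
  | add a b ha hb => rw [mul_add, ha, hb, map_add, add_mul]

theorem exteriorPower_induction
    {C : ℕ → ExteriorAlgebra R L → Prop}
    (h0 : ∀ f, C 0 (algebraMap R _ f))
    (hadd : ∀ p x y, C p x → C p y → C p (x + y))
    (hmul : ∀ p v x, x ∈ ⋀[R]^p L → C p x → C (p + 1) (ExteriorAlgebra.ι R v * x))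
    (p : ℕ) (x : ExteriorAlgebra R L) (hx : x ∈ ⋀[R]^p L) : C p x := by
  induction p generalizing x with
  | zero =>
    replace hx : x ∈ (LinearMap.range (ExteriorAlgebra.ι R : L →ₗ[R] _)) ^ 0 := hx
    rw [pow_zero, Submodule.mem_one] at hx
    obtain ⟨f, rfl⟩ := hx
    exact h0 f
  | succ p ih =>
    replace hx : x ∈ (LinearMap.range (ExteriorAlgebra.ι R : L →ₗ[R] _)) ^ (p + 1) := hx
    rw [pow_succ'] at hx
    induction hx using Submodule.mul_induction_on' with
    | mem_mul_mem m hm n hn =>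
      obtain ⟨v, rfl⟩ := hm
      exact hmul p v n hn (ih n hn)
    | add x _ y _ hx hy => exact hadd _ _ _ hx hy

theorem exteriorPower_le_gradedCenter (p : ℕ) (x : ExteriorAlgebra R L)
    (hx : x ∈ ⋀[R]^p L) : x ∈ gradedCenter R L p := by
  refine exteriorPower_induction (C := fun p x => x ∈ gradedCenter R L p)
    algebraMap_mem_gradedCenter (fun p x y => Submodule.add_mem _) ?_ p x hx
  intro p v x _ h
  rw [add_comm]
  exact mul_mem_gradedCenter (ι_mem_gradedCenter v) h

end GradedDerivation

/-! ### The Gerstenhaber bracket of multivectors -/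

namespace LieRinehart

variable {R L : Type*} [CommRing R] [Algebra ℝ R] [AddCommGroup L] [Module ℝ L]
    [Module R L] [IsScalarTower ℝ R L] (A : LieRinehart R L)

/-- The differential of a function, as a linear form on sections: `⟨df, v⟩ = ρ(v) f`. -/
def df : R →+ Module.Dual R L where
  toFun f :=
    { toFun := fun v => A.anchor v f
      map_add' := fun v w => by simp
      map_smul' := fun r v => by simp }
  map_zero' := by ext; simp
  map_add' f g := by ext; simp

@[simp] theorem df_apply (f : R) (v : L) : A.df f v = A.anchor v f := rfl

theorem df_mul (f g : R) : A.df (f * g) = f • A.df g + g • A.df f := by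
  ext v; simp

theorem bracket_skew (a b : L) : A.bracket a b = -A.bracket b a := by
  have h := A.bracket_self (a + b)
  simp only [map_add, LinearMap.add_apply, A.bracket_self, zero_add, add_zero] at h
  exact eq_neg_of_add_eq_zero_right h

theorem leibniz_left (f : R) (a b : L) :
    A.bracket (f • a) b = f • A.bracket a b - A.anchor b f • a := by
  rw [bracket_skew, A.leibniz, A.bracket_skew b a]
  simp only [smul_neg]; abel

/-- Contraction of multivectors by the differential of a function. -/
def contr (f : R) : ExteriorAlgebra R L →ₗ[R] ExteriorAlgebra R L :=
  CliffordAlgebra.contractLeft (A.df f)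

theorem contr_algebraMap (f g : R) : A.contr f (algebraMap R _ g) = 0 :=
  CliffordAlgebra.contractLeft_algebraMap _ _ _

theorem contr_ι_mul (f : R) (v : L) (x : ExteriorAlgebra R L) :
    A.contr f (ExteriorAlgebra.ι R v * x)
      = A.anchor v f • x - ExteriorAlgebra.ι R v * A.contr f x :=
  CliffordAlgebra.contractLeft_ι_mul _ _ _

/-- The data of the Lie derivative `[v, ·]` on multivectors. -/
def lieData (v : L) : DerivationData R L (signHom R L 0) where
  D₀ := (algebraMap R (ExteriorAlgebra R L) : R →+ _).comp
    ((A.anchor v : R →ₗ[ℝ] R) : R →+ R)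
  D₁ := (ExteriorAlgebra.ι R : L →ₗ[R] _).toAddMonoidHom.comp (A.bracket v).toAddMonoidHom
  D₀_mul f g := by simp [Algebra.smul_def]
  D₀_comm f b := by simp [signHom, Algebra.commutes]
  D₁_smul f w := by simp [A.leibniz, Algebra.smul_def]
  D₁_sq w := by
    simp [ExteriorAlgebra.ι_add_mul_swap]

/-- The Lie derivative `[v, ·]` of multivectors by a section `v`. -/
def lieDer (v : L) : ExteriorAlgebra R L →+ ExteriorAlgebra R L := (A.lieData v).derivation

theorem lieDer_algebraMap (v : L) (f : R) :
    A.lieDer v (algebraMap R _ f) = algebraMap R _ (A.anchor v f) := by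
  simp [lieDer, lieData]

theorem lieDer_ι (v w : L) :
    A.lieDer v (ExteriorAlgebra.ι R w) = ExteriorAlgebra.ι R (A.bracket v w) := by
  simp [lieDer, lieData]

theorem lieDer_mul (v : L) (a b : ExteriorAlgebra R L) :
    A.lieDer v (a * b) = A.lieDer v a * b + a * A.lieDer v b := by
  have h := (A.lieData v).derivation_mul a b
  rwa [show signHom R L 0 a = a by simp [signHom]] at h

theorem contr_mem (f : R) (p : ℕ) (x : ExteriorAlgebra R L) (hx : x ∈ ⋀[R]^p L) :
    A.contr f x ∈ gradedCenter R L (p + 1) := by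
  refine exteriorPower_induction (C := fun p x => A.contr f x ∈ gradedCenter R L (p + 1))
    ?_ (fun p x y hx hy => ?_) ?_ p x hx
  · intro g; rw [contr_algebraMap]; exact Submodule.zero_mem _
  · rw [map_add]; exact Submodule.add_mem _ hx hy
  · intro p v x hx h
    rw [contr_ι_mul]
    refine Submodule.sub_mem _ (Submodule.smul_mem _ _ ?_) ?_
    · rw [gradedCenter_add_two]; exact exteriorPower_le_gradedCenter p x hx
    · rw [add_comm (p + 1) 1]
      exact mul_mem_gradedCenter (ι_mem_gradedCenter v) h

theorem lieDer_mem (v : L) (p : ℕ) (x : ExteriorAlgebra R L) (hx : x ∈ ⋀[R]^p L) :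
    A.lieDer v x ∈ gradedCenter R L p := by
  refine exteriorPower_induction (C := fun p x => A.lieDer v x ∈ gradedCenter R L p)
    ?_ (fun p x y hx hy => ?_) ?_ p x hx
  · intro g; rw [lieDer_algebraMap]; exact algebraMap_mem_gradedCenter _
  · rw [map_add]; exact Submodule.add_mem _ hx hy
  · intro p w x hx h
    rw [lieDer_mul, lieDer_ι, add_comm p 1]
    exact Submodule.add_mem _
      (mul_mem_gradedCenter (ι_mem_gradedCenter _) (exteriorPower_le_gradedCenter p x hx))
      (mul_mem_gradedCenter (ι_mem_gradedCenter _) h)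

theorem lieDer_smul (f : R) (v : L) (p : ℕ) (x : ExteriorAlgebra R L) (hx : x ∈ ⋀[R]^p L) :
    A.lieDer (f • v) x
      = f • A.lieDer v x + (-1 : R) ^ p • (A.contr f x * ExteriorAlgebra.ι R v) := by
  refine exteriorPower_induction (C := fun p x => A.lieDer (f • v) x
      = f • A.lieDer v x + (-1 : R) ^ p • (A.contr f x * ExteriorAlgebra.ι R v))
    ?_ (fun p x y hx hy => ?_) ?_ p x hx
  · intro g
    simp [lieDer_algebraMap, contr_algebraMap, Algebra.smul_def]
  · simp only [map_add, hx, hy, add_mul, smul_add]; abel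
  · intro p w x hx h
    have hc : x * ExteriorAlgebra.ι R v = (-1 : R) ^ p • (ExteriorAlgebra.ι R v * x) := by
      rw [exteriorPower_le_gradedCenter p x hx, signHom_ι, smul_mul_assoc]
    have hs : (-1 : R) ^ p * (-1 : R) ^ p = 1 := by rw [← mul_pow]; simp
    rw [lieDer_mul, lieDer_mul, lieDer_ι, lieDer_ι, h, contr_ι_mul, A.leibniz_left]
    simp only [sub_mul, smul_mul_assoc, hc, map_sub, map_smul, mul_add, mul_smul_comm, smul_add,
      smul_sub, mul_assoc, smul_smul, pow_succ]
    rw [show (-1 : R) ^ p * (-1 * (A.anchor w f * (-1 : R) ^ p)) = -(A.anchor w f) by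
      linear_combination (-(A.anchor w f)) * hs]
    simp only [mul_neg_one, neg_smul]
    abel

theorem lieDer_add (v w : L) (x : ExteriorAlgebra R L) :
    A.lieDer (v + w) x = A.lieDer v x + A.lieDer w x := by
  induction x using ExteriorAlgebra.induction with
  | algebraMap r => simp [lieDer_algebraMap]
  | ι x => simp [lieDer_ι]
  | mul a b ha hb => rw [lieDer_mul, lieDer_mul, lieDer_mul, ha, hb, add_mul, mul_add]; abel
  | add a b ha hb => rw [map_add, map_add, map_add, ha, hb]; abel

/-- The data of `[P, ·]` for a `p`-vector `P`: it is a derivation of degree `p - 1`, with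
`[P, f] = (-1) ^ (p - 1) i_{df} P` on functions and `[P, v] = -[v, P]` on sections. -/
def schoutenData {p : ℕ} (P : ⋀[R]^p L) : DerivationData R L (signHom R L (p + 1)) where
  D₀ :=
    { toFun := fun f => (-1 : R) ^ (p + 1) • A.contr f P
      map_zero' := by simp [contr]
      map_add' := fun f g => by simp [contr] }
  D₁ :=
    { toFun := fun v => -A.lieDer v P
      map_zero' := by
        have h := A.lieDer_add 0 0 P
        simpa using h
      map_add' := fun v w => by rw [lieDer_add]; abel }
  D₀_mul f g := by
    simp only [AddMonoidHom.coe_mk, ZeroHom.coe_mk, contr, df_mul, map_add, map_smul,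
      LinearMap.add_apply, LinearMap.smul_apply, smul_add]
    rw [smul_comm, smul_comm ((-1 : R) ^ (p + 1)) g]
  D₀_comm f b := by
    change ((-1 : R) ^ (p + 1) • A.contr f P) * b = _ * ((-1 : R) ^ (p + 1) • A.contr f P)
    rw [smul_mul_assoc, A.contr_mem f p P P.2, mul_smul_comm]
  D₁_smul f v := by
    change -A.lieDer (f • v) P = f • -A.lieDer v P + ((-1 : R) ^ (p + 1) • A.contr f P) * _
    rw [A.lieDer_smul f v p P P.2, pow_succ, smul_mul_assoc]
    simp only [mul_neg_one, neg_smul, smul_neg]; abel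
  D₁_sq v := by
    change signHom R L (p + 1) (ExteriorAlgebra.ι R v) * -A.lieDer v P
      + -A.lieDer v P * ExteriorAlgebra.ι R v = 0
    rw [neg_mul, A.lieDer_mem v p P P.2, signHom_ι, signHom_ι, pow_succ]
    simp

/-- The Gerstenhaber bracket `[P, Q]` of a `p`-vector `P` and a multivector `Q`. -/
def schouten {p : ℕ} (P : ⋀[R]^p L) : ExteriorAlgebra R L →+ ExteriorAlgebra R L :=
  (A.schoutenData P).derivation

theorem schouten_algebraMap {p : ℕ} (P : ⋀[R]^p L) (f : R) :
    A.schouten P (algebraMap R _ f) = (-1 : R) ^ (p + 1) • A.contr f P :=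
  (A.schoutenData P).derivation_algebraMap f

theorem schouten_ι {p : ℕ} (P : ⋀[R]^p L) (v : L) :
    A.schouten P (ExteriorAlgebra.ι R v) = -A.lieDer v P := by
  simp [schouten, schoutenData]

theorem schouten_mul {p : ℕ} (P : ⋀[R]^p L) (a b : ExteriorAlgebra R L) :
    A.schouten P (a * b)
      = A.schouten P a * b + signHom R L (p + 1) a * A.schouten P b :=
  (A.schoutenData P).derivation_mul a b

end LieRinehart


/-! ### Forms -/

section Forms

variable (R L : Type*) [CommRing R] [AddCommGroup L] [Module R L]

/-- Forms of degree `q`: alternating `R`-multilinear maps `L × ⋯ × L → R`. -/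
abbrev AltForm (q : ℕ) : Type _ := L [⋀^Fin q]→ₗ[R] R

/-- The module of all forms, the direct sum over all degrees. -/
abbrev Form : Type _ := ⨁ q : ℕ, AltForm R L q

/-- The additive group of forms, with its additive monoid in the form in which it appears in
`Form`. -/
instance formAddCommGroup : AddCommGroup (Form R L) :=
  letI g : AddCommGroup (Form R L) := inferInstance
  { (inferInstance : AddCommMonoid (Form R L)) with
    neg := g.neg
    sub := g.sub
    sub_eq_add_neg := g.sub_eq_add_neg
    zsmul := g.zsmul
    zsmul_zero' := g.zsmul_zero'
    zsmul_succ' := g.zsmul_succ'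
    zsmul_neg' := g.zsmul_neg'
    neg_add_cancel := g.neg_add_cancel }

variable {R L}

/-- A form of degree `q` as an element of the module of all forms. -/
def ofDeg (q : ℕ) : AltForm R L q →ₗ[R] Form R L := DirectSum.lof R ℕ (AltForm R L) q

/-- A function as a form of degree `0`. -/
def ofFun : R →ₗ[R] Form R L :=
  ofDeg 0 ∘ₗ (AlternatingMap.constLinearEquivOfIsEmpty : R ≃ₗ[R] AltForm R L 0).toLinearMap

/-- A linear form on sections as a form of degree `1`. -/
def ofDual : Module.Dual R L →ₗ[R] Form R L :=
  ofDeg 1 ∘ₗ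
    { toFun := fun α => AlternatingMap.ofSubsingleton R L R (0 : Fin 1) α
      map_add' := fun _ _ => rfl
      map_smul' := fun _ _ => rfl }

/-- The linear form underlying the component of degree `1` of a form. -/
def toDual (η : Form R L) : Module.Dual R L :=
  (AlternatingMap.ofSubsingleton R L R (0 : Fin 1)).symm (η 1)

/-- The exterior product of forms of degrees `p` and `q`, as a sum over shuffles. -/
def wedgeDeg (p q : ℕ) : AltForm R L p →ₗ[R] AltForm R L q →ₗ[R] AltForm R L (p + q) :=
  LinearMap.mk₂ R
    (fun a b => ((LinearMap.mul' R R).compAlternatingMap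
      (AlternatingMap.domCoprod a b)).domDomCongr finSumFinEquiv)
    (fun a a' b => by
      simp only [← AlternatingMap.domCoprod'_apply, TensorProduct.add_tmul, map_add]; ext; simp)
    (fun c a b => by
      simp only [← AlternatingMap.domCoprod'_apply, ← TensorProduct.smul_tmul', map_smul]
      ext; simp)
    (fun a b b' => by
      simp only [← AlternatingMap.domCoprod'_apply, TensorProduct.tmul_add, map_add]; ext; simp)
    (fun c a b => by
      simp only [← AlternatingMap.domCoprod'_apply, TensorProduct.tmul_smul, map_smul]
      ext; simp)

/-- The exterior product of forms. -/
def wedge : Form R L →ₗ[R] Form R L →ₗ[R] Form R L :=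
  DirectSum.toModule R ℕ _ fun p =>
    LinearMap.flip <| DirectSum.toModule R ℕ _ fun q =>
      LinearMap.flip ((wedgeDeg p q).compr₂ (ofDeg (p + q)))

/-- The interior product `i_X` of forms by a section `X`: insertion of `X` in the first place. -/
def contract : L →ₗ[R] Module.End R (Form R L) :=
  LinearMap.flip <| DirectSum.toModule R ℕ _ fun q =>
    match q with
    | 0 => 0
    | q + 1 =>
      { toFun := fun η => ofDeg q ∘ₗ η.curryLeft
        map_add' := fun η θ => by rw [AlternatingMap.curryLeft_add, LinearMap.comp_add]
        map_smul' := fun c η => by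
          rw [AlternatingMap.curryLeft_smul, LinearMap.comp_smul]; rfl }

@[simp] theorem contract_zero_deg (X : L) (η : AltForm R L 0) : contract X (ofDeg 0 η) = 0 := by
  simp [contract, ofDeg]

@[simp] theorem contract_succ_deg (X : L) (q : ℕ) (η : AltForm R L (q + 1)) :
    contract X (ofDeg (q + 1) η) = ofDeg q (η.curryLeft X) := by
  simp [contract, ofDeg]

theorem contract_contract (X : L) : contract (R := R) X * contract X = 0 := by
  refine DirectSum.linearMap_ext R fun q => LinearMap.ext fun η => ?_
  change contract X (contract X (ofDeg q η)) = 0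
  rcases q with _ | _ | q
  · simp
  · simp
  · simp [AlternatingMap.curryLeft_same]

/-- The interior product `i_P` of forms by a multivector `P`, normalized by
`i_{X ∧ Y} = i_X ∘ i_Y`. -/
def intProd : ExteriorAlgebra R L →ₐ[R] Module.End R (Form R L) :=
  ExteriorAlgebra.lift R ⟨contract, contract_contract⟩

/-- The interior product of forms by a multivector valued in linear forms:
`i_{ξ ⊗ P} η = ξ ∧ i_P η`. -/
def intProdDual :
    Module.Dual R L ⊗[R] ExteriorAlgebra R L →ₗ[R] Module.End R (Form R L) :=
  TensorProduct.lift <| LinearMap.mk₂ R (fun ξ P => wedge (ofDual ξ) ∘ₗ intProd P)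
    (fun ξ ξ' P => by ext; simp) (fun c ξ P => by ext; simp)
    (fun ξ P P' => by rw [map_add, LinearMap.comp_add])
    (fun c ξ P => by rw [map_smul, LinearMap.comp_smul])

/-! ### Bivectors and 3-forms -/

/-- The skew-symmetric contravariant 2-tensor of a bivector: `X ∧ Y ↦ X ⊗ Y - Y ⊗ X`. -/
def toTensor : ⋀[R]^2 L →ₗ[R] L ⊗[R] L :=
  exteriorPower.alternatingMapLinearEquiv
    { toFun := fun v => v 0 ⊗ₜ v 1 - v 1 ⊗ₜ v 0
      map_update_add' := fun v i x y => by
        fin_cases i <;> simp [TensorProduct.add_tmul, TensorProduct.tmul_add] <;> abel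
      map_update_smul' := fun v i c x => by
        fin_cases i <;> simp [TensorProduct.smul_tmul', smul_sub]
      map_eq_zero_of_eq' := fun v i j h hij => by
        fin_cases i <;> fin_cases j <;> simp_all }

theorem toTensor_wedge (X Y : L) :
    toTensor (exteriorPower.ιMulti R 2 ![X, Y]) = X ⊗ₜ Y - Y ⊗ₜ X := by
  simp [toTensor]

/-- The map `π♯`, defined by `⟨β, π♯ α⟩ = π(α, β)`. -/
def sharp (π : ⋀[R]^2 L) : Module.Dual R L →ₗ[R] L where
  toFun α := TensorProduct.lid R L (LinearMap.rTensor L α (toTensor π))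
  map_add' α β := by simp [LinearMap.rTensor_add]
  map_smul' c α := by simp [LinearMap.rTensor_smul]

/-- The linear form `ψ(X, Y, ·)` of a 3-form `ψ`. -/
def form3 (ψ : AltForm R L 3) : L →ₗ[R] L →ₗ[R] Module.Dual R L :=
  LinearMap.mk₂ R
    (fun X Y => (AlternatingMap.ofSubsingleton R L R (0 : Fin 1)).symm
      ((ψ.curryLeft X).curryLeft Y))
    (fun X X' Y => by ext; simp) (fun c X Y => by ext; simp)
    (fun X Y Y' => by ext; simp) (fun c X Y => by ext; simp)

theorem form3_apply (ψ : AltForm R L 3) (X Y Z : L) : form3 ψ X Y Z = ψ ![X, Y, Z] := by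
  change ψ (Matrix.vecCons X (Matrix.vecCons Y fun _ => Z)) = _
  congr 1
  ext i; fin_cases i <;> rfl

end Forms

section BivectorForm

variable {R L : Type*} [CommRing R] [Algebra ℝ R] [AddCommGroup L] [Module R L]

/-- The linear form `ψ(π, ·)`, equal to `ψ(X, Y, ·)` when `π = X ∧ Y`. It is the opposite of
`intProd π ψ`, because `i_{X ∧ Y} ψ = i_X (i_Y ψ) = ψ(Y, X, ·)`. -/
def pairBivector (π : ⋀[R]^2 L) (ψ : AltForm R L 3) : Module.Dual R L :=
  algebraMap ℝ R (1 / 2) • TensorProduct.lift (form3 ψ) (toTensor π)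

/-- The section `Y_{π,ψ} = π♯(ψ(π, ·))`, for which `⟨α, Y_{π,ψ}⟩` is half the trace of the
endomorphism `β ↦ ψ⁽²⁾(α, β)`. -/
def sectionY (π : ⋀[R]^2 L) (ψ : AltForm R L 3) : L := sharp π (pairBivector π ψ)

/-- The tensor `ψ⁽²⁾`, in components `1/2 π^{kp} π^{lq} ψ_{pqm} ε^m ⊗ e_k ∧ e_l`. -/
def psiTwo (π : ⋀[R]^2 L) (ψ : AltForm R L 3) :
    Module.Dual R L ⊗[R] ExteriorAlgebra R L :=
  algebraMap ℝ R (1 / 2) • TensorProduct.comm R _ _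
    (TensorProduct.map
      (LinearMap.mul' R (ExteriorAlgebra R L) ∘ₗ
        TensorProduct.map (ExteriorAlgebra.ι R) (ExteriorAlgebra.ι R))
      (TensorProduct.lift (form3 ψ))
      (TensorProduct.tensorTensorTensorComm R L L L L (toTensor π ⊗ₜ toTensor π)))

/-- The value `ψ⁽²⁾(α, β) = ψ(π♯ α, π♯ β, ·)` on two linear forms. -/
def psiTwoEval (π : ⋀[R]^2 L) (ψ : AltForm R L 3) (α β : Module.Dual R L) : Module.Dual R L :=
  form3 ψ (sharp π α) (sharp π β)

/-- The trivector `(∧³ π♯) ψ`, in components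
`1/6 ψ_{klm} π♯(ε^k) ∧ π♯(ε^l) ∧ π♯(ε^m)` with `π♯(ε^k) = π^{kp} e_p`. -/
def sharpThree (π : ⋀[R]^2 L) (ψ : AltForm R L 3) : ExteriorAlgebra R L :=
  algebraMap ℝ R (1 / 6) • TensorProduct.lid R _
    (TensorProduct.map
      (TensorProduct.lift (TensorProduct.uncurry (.id R) L L R ∘ₗ form3 ψ))
      (LinearMap.mul' R (ExteriorAlgebra R L) ∘ₗ
        TensorProduct.map (ExteriorAlgebra.ι R)
          (LinearMap.mul' R (ExteriorAlgebra R L) ∘ₗ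
            TensorProduct.map (ExteriorAlgebra.ι R) (ExteriorAlgebra.ι R)))
      (TensorProduct.tensorTensorTensorComm R L L (L ⊗[R] L) (L ⊗[R] L)
        (toTensor π ⊗ₜ TensorProduct.tensorTensorTensorComm R L L L L
          (toTensor π ⊗ₜ toTensor π))))

instance (q : ℕ) : IsScalarTower ℝ R (AltForm R L q) where
  smul_assoc c f η := by ext; simp

instance : IsScalarTower ℝ R (Form R L) where
  smul_assoc c f η := by
    refine DFinsupp.ext fun q => ?_
    exact smul_assoc c f (η q)

/-- The operator `∂̲_{π,ψ}`: the interior product by `ψ⁽²⁾`. -/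
def underlinePartial (π : ⋀[R]^2 L) (ψ : AltForm R L 3) : Module.End ℝ (Form R L) :=
  (intProdDual (psiTwo π ψ)).restrictScalars ℝ

end BivectorForm

/-! ### The differential -/

theorem removeNth_update_zero {T : Type*} {n : ℕ} (p : Fin (n + 2)) (hp : p ≠ 0) (v : Fin (n + 2) → T)
    (x : T) :
    p.removeNth (Function.update v 0 x) = Function.update (p.removeNth v) 0 x := by
  conv_lhs => rw [← Fin.succAbove_ne_zero_zero hp]
  exact Fin.removeNth_update_succAbove p 0 x v

theorem removeNth_zero_update {T : Type*} {n : ℕ} (v : Fin (n + 1) → T) (x : T) :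
    (0 : Fin (n + 1)).removeNth (Function.update v 0 x) = (0 : Fin (n + 1)).removeNth v := by
  ext i
  simp [Fin.removeNth]

namespace LieRinehart

variable {R L : Type*} [CommRing R] [Algebra ℝ R] [AddCommGroup L] [Module ℝ L]
    [Module R L] [IsScalarTower ℝ R L] (A : LieRinehart R L)

section Differential

open Fin

/-- A form viewed as an `ℝ`-multilinear alternating map. -/
def realForm {q : ℕ} (η : AltForm R L q) : L [⋀^Fin q]→ₗ[ℝ] R :=
  { η.toMultilinearMap.restrictScalars ℝ with
    map_eq_zero_of_eq' := η.map_eq_zero_of_eq' }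

@[simp] theorem realForm_apply {q : ℕ} (η : AltForm R L q) (v : Fin q → L) :
    realForm η v = η v := rfl

/-- The first sum in the formula for the differential. -/
def dFst {q : ℕ} (η : AltForm R L q) : L [⋀^Fin (q + 1)]→ₗ[ℝ] R :=
  AlternatingMap.alternatizeUncurryFin
    { toFun := fun X => ((A.anchor X : Derivation ℝ R R) : R →ₗ[ℝ] R).compAlternatingMap
        (realForm η)
      map_add' := fun X Y => by ext; simp
      map_smul' := fun c X => by
        ext v
        rw [← algebraMap_smul R c X, map_smul]
        simp [Algebra.smul_def] }

theorem dFst_apply {q : ℕ} (η : AltForm R L q) (v : Fin (q + 1) → L) :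
    A.dFst η v = ∑ i : Fin (q + 1), (-1 : R) ^ (i : ℕ) * A.anchor (v i) (η (i.removeNth v)) := by
  rw [dFst, AlternatingMap.alternatizeUncurryFin_apply]
  refine Finset.sum_congr rfl fun i _ => ?_
  simp [zsmul_eq_mul]

/-- The second sum in the formula for the differential, up to sign. -/
def dSnd {q : ℕ} (η : AltForm R L (q + 1)) : L [⋀^Fin (q + 2)]→ₗ[ℝ] R :=
  (1 / 2 : ℝ) • AlternatingMap.alternatizeUncurryFin
    (AlternatingMap.alternatizeUncurryFinLM ∘ₗ
      LinearMap.mk₂ ℝ (fun X Y => (realForm η).curryLeft (A.bracket X Y))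
        (fun X X' Y => by simp) (fun c X Y => by simp)
        (fun X Y Y' => by simp) (fun c X Y => by simp))

theorem dSnd_apply {q : ℕ} (η : AltForm R L (q + 1)) (v : Fin (q + 2) → L) :
    A.dSnd η v = ∑ i : Fin (q + 1), ∑ j ≥ i, (-1 : R) ^ (i + j : ℕ) *
      η (Matrix.vecCons (A.bracket (v i.castSucc) (v j.succ))
        (j.removeNth (i.castSucc.removeNth v))) := by
  rw [dSnd, AlternatingMap.smul_apply,
    AlternatingMap.alternatizeUncurryFin_alternatizeUncurryFinLM_comp_apply, Finset.smul_sum]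
  refine Finset.sum_congr rfl fun i _ => ?_
  rw [Finset.smul_sum]
  refine Finset.sum_congr rfl fun j _ => ?_
  have h : realForm η (Matrix.vecCons (A.bracket (v j.succ) (v i.castSucc))
        (j.removeNth (i.castSucc.removeNth v))) =
      - realForm η (Matrix.vecCons (A.bracket (v i.castSucc) (v j.succ))
        (j.removeNth (i.castSucc.removeNth v))) := by
    rw [A.bracket_skew]
    have := (realForm η).map_update_neg (Matrix.vecCons (A.bracket (v i.castSucc) (v j.succ))
        (j.removeNth (i.castSucc.removeNth v))) 0 (A.bracket (v i.castSucc) (v j.succ))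
    simpa [Matrix.vecCons, Fin.update_cons_zero] using this
  simp only [LinearMap.mk₂_apply, AlternatingMap.curryLeft_apply_apply, h, sub_neg_eq_add,
    realForm_apply]
  rw [← two_smul ℝ, smul_comm (1 / 2 : ℝ), smul_smul]
  norm_num [zsmul_eq_mul]

/-- The sum over `k < l` of `(-1) ^ (k + l) η([v_k, v_l], v_0, …, v̂_k, …, v̂_l, …, v_q)` in the
formula for the differential of a `q`-form. The pairs `k < l` are written as `k = i.castSucc`,
`l = j.succ` with `i ≤ j`. -/
def bracketSum : (q : ℕ) → AltForm R L q → (Fin (q + 1) → L) → R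
  | 0, _, _ => 0
  | q + 1, η, v =>
    ∑ i : Fin (q + 1), ∑ j ≥ i, (-1 : R) ^ (i + (j + 1) : ℕ) *
      η (Matrix.vecCons (A.bracket (v i.castSucc) (v j.succ))
        (j.removeNth (i.castSucc.removeNth v)))

/-- The value of the differential of a `q`-form on `q + 1` sections. -/
def dVal (q : ℕ) (η : AltForm R L q) (v : Fin (q + 1) → L) : R :=
  ∑ i : Fin (q + 1), (-1 : R) ^ (i : ℕ) * A.anchor (v i) (η (i.removeNth v))
    + A.bracketSum q η v

/-- The differential of a form, as an `ℝ`-multilinear alternating map. -/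
def dReal : (q : ℕ) → AltForm R L q → L [⋀^Fin (q + 1)]→ₗ[ℝ] R
  | 0, η => A.dFst η
  | _ + 1, η => A.dFst η - A.dSnd η

theorem dReal_apply (q : ℕ) (η : AltForm R L q) (v : Fin (q + 1) → L) :
    A.dReal q η v = A.dVal q η v := by
  cases q with
  | zero => simp [dReal, dVal, bracketSum, dFst_apply]
  | succ q =>
    change A.dFst η v - A.dSnd η v = _
    rw [dFst_apply, dSnd_apply, dVal, sub_eq_add_neg, ← Finset.sum_neg_distrib]
    congr 1
    refine Finset.sum_congr rfl fun i _ => ?_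
    rw [← Finset.sum_neg_distrib]
    refine Finset.sum_congr rfl fun j _ => ?_
    rw [← add_assoc, pow_succ]
    ring

theorem dVal_update_zero (q : ℕ) (η : AltForm R L q) (v : Fin (q + 1) → L) (f : R) (x : L) :
    A.dVal q η (Function.update v 0 (f • x)) = f * A.dVal q η (Function.update v 0 x) := by
  cases q with
  | zero =>
    simp only [dVal, bracketSum]
    simp
  | succ q =>
    have hη : ∀ (k : Fin (q + 1)) (y : L),
        η (k.succ.removeNth (Function.update v 0 y))
          = η (Function.update (k.succ.removeNth v) 0 y) := fun k y => by
      rw [removeNth_update_zero _ (Fin.succ_ne_zero k)]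
    have hc : ∀ (k : Fin (q + 1)), Function.update (k.succ.removeNth v) 0 x
        = Matrix.vecCons x (k.removeNth ((0 : Fin (q + 2)).removeNth v)) := fun k => by
      ext i
      refine Fin.cases ?_ (fun i => ?_) i <;> simp [Fin.removeNth, Matrix.vecCons, Fin.tail]
    have h1 : ∑ i : Fin (q + 2), (-1 : R) ^ (i : ℕ) *
          A.anchor (Function.update v 0 (f • x) i)
            (η (i.removeNth (Function.update v 0 (f • x))))
        = f * ∑ i : Fin (q + 2), (-1 : R) ^ (i : ℕ) *
            A.anchor (Function.update v 0 x i) (η (i.removeNth (Function.update v 0 x)))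
          + ∑ k : Fin (q + 1), (-1 : R) ^ (k + 1 : ℕ) *
            (η (Matrix.vecCons x (k.removeNth ((0 : Fin (q + 2)).removeNth v)))
              * A.anchor (v k.succ) f) := by
      rw [Fin.sum_univ_succ, Fin.sum_univ_succ (n := q + 1) (f := fun i => (-1 : R) ^ (i : ℕ) *
            A.anchor (Function.update v 0 x i) (η (i.removeNth (Function.update v 0 x))))]
      simp only [removeNth_zero_update, hη, mul_add, add_assoc, Finset.mul_sum,
        ← Finset.sum_add_distrib]
      congr 1
      · simp
      · refine Finset.sum_congr rfl fun k _ => ?_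
        rw [AlternatingMap.map_update_smul, hc]
        simp
        ring
    have h2 : A.bracketSum (q + 1) η (Function.update v 0 (f • x))
        = f * A.bracketSum (q + 1) η (Function.update v 0 x)
          - ∑ k : Fin (q + 1), (-1 : R) ^ (k + 1 : ℕ) *
            (η (Matrix.vecCons x (k.removeNth ((0 : Fin (q + 2)).removeNth v)))
              * A.anchor (v k.succ) f) := by
      simp only [bracketSum]
      rw [Fin.sum_univ_succ, Fin.sum_univ_succ (n := q)]
      have e0 : ∀ y : L, ∑ j ≥ (0 : Fin (q + 1)), (-1 : R) ^ ((0 : Fin (q + 1)) + (j + 1) : ℕ) *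
          η (Matrix.vecCons (A.bracket (Function.update v 0 y (Fin.castSucc 0))
            (Function.update v 0 y j.succ))
          (j.removeNth ((Fin.castSucc 0).removeNth (Function.update v 0 y))))
          = ∑ j : Fin (q + 1), (-1 : R) ^ (j + 1 : ℕ) *
            η (Matrix.vecCons (A.bracket y (v j.succ))
              (j.removeNth ((0 : Fin (q + 2)).removeNth v))) := by
        intro y
        rw [show (Finset.Ici (0 : Fin (q + 1))) = Finset.univ by ext; simp]
        refine Finset.sum_congr rfl fun j _ => ?_
        rw [Fin.castSucc_zero, removeNth_zero_update]
        simp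
      rw [e0, e0, mul_add, add_sub_right_comm]
      congr 1
      · rw [Finset.mul_sum, ← Finset.sum_sub_distrib]
        refine Finset.sum_congr rfl fun j _ => ?_
        rw [A.leibniz_left]
        have hl : ∀ (a b : L) (r : R) (w : Fin q → L),
            η (Matrix.vecCons (f • a - r • b) w)
              = f * η (Matrix.vecCons a w) - r * η (Matrix.vecCons b w) := by
          intro a b r w
          have := congrArg (fun g : AltForm R L q => g w)
            (map_sub η.curryLeft (f • a) (r • b))
          rw [map_smul, map_smul] at this
          exact this
        rw [hl]; ring
      · rw [Finset.mul_sum]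
        refine Finset.sum_congr rfl fun i _ => ?_
        rw [Finset.mul_sum]
        refine Finset.sum_congr rfl fun j hj => ?_
        obtain ⟨m, rfl⟩ : ∃ m, q = m + 1 := ⟨q - 1, by have := i.pos; omega⟩
        have hj0 : j ≠ 0 := by
          rintro rfl
          simp at hj
        have hi0 : i.succ.castSucc ≠ 0 := by exact fun h => Fin.succ_ne_zero i (Fin.castSucc_injective _ h)
        have key : ∀ y : L, j.removeNth (i.succ.castSucc.removeNth (Function.update v 0 y))
            = Function.update (j.removeNth (i.succ.castSucc.removeNth v)) 0 y := fun y => by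
          rw [removeNth_update_zero _ hi0, removeNth_update_zero _ hj0]
        have hu : ∀ (a y : L) (w : Fin (m + 1) → L),
            Matrix.vecCons a (Function.update w 0 y)
              = Function.update (Matrix.vecCons a w) (Fin.succ 0) y := fun a y w =>
          Fin.cons_update (α := fun _ => L) a w 0 y
        rw [key, key, hu, hu, AlternatingMap.map_update_smul, Function.update_of_ne hi0,
          Function.update_of_ne hi0, Function.update_of_ne (Fin.succ_ne_zero j),
          Function.update_of_ne (Fin.succ_ne_zero j), smul_eq_mul]
        ring
    simp only [dVal]
    rw [h1, h2]
    ring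

theorem dVal_update (q : ℕ) (η : AltForm R L q) (v : Fin (q + 1) → L) (i : Fin (q + 1)) (f : R)
    (x : L) :
    A.dVal q η (Function.update v i (f • x)) = f * A.dVal q η (Function.update v i x) := by
  have hs : ∀ y, A.dVal q η (Function.update v i y)
      = (Equiv.Perm.sign (Equiv.swap 0 i) : ℤ) •
        A.dVal q η (Function.update (v ∘ Equiv.swap 0 i) 0 y) := fun y => by
    have h : Function.update (v ∘ Equiv.swap 0 i) 0 y
        = Function.update v i y ∘ Equiv.swap 0 i := by
      rw [Function.update_comp_equiv]
      simp
    rw [h, ← dReal_apply, ← dReal_apply, AlternatingMap.map_perm, Units.smul_def, smul_smul,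
      ← Units.val_mul, Int.units_mul_self, Units.val_one, one_smul]
  rw [hs, hs, dVal_update_zero, mul_smul_comm]

/-- The differential of a `q`-form. -/
def dDeg (q : ℕ) (η : AltForm R L q) : AltForm R L (q + 1) where
  toFun := A.dVal q η
  map_update_add' v i x y := by
    rename_i inst
    cases Subsingleton.elim inst (instDecidableEqFin _)
    simp only [← dReal_apply, AlternatingMap.map_update_add]
  map_update_smul' v i f x := by
    rename_i inst
    cases Subsingleton.elim inst (instDecidableEqFin _)
    exact A.dVal_update q η v i f x
  map_eq_zero_of_eq' v i j h hij := by
    rw [← dReal_apply]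
    exact (A.dReal q η).map_eq_zero_of_eq v h hij

theorem dDeg_apply (q : ℕ) (η : AltForm R L q) (v : Fin (q + 1) → L) :
    A.dDeg q η v = A.dVal q η v := rfl

theorem dDeg_add (q : ℕ) (η θ : AltForm R L q) :
    A.dDeg q (η + θ) = A.dDeg q η + A.dDeg q θ := by
  ext v
  cases q <;>
    simp [dDeg_apply, dVal, bracketSum, mul_add, Finset.sum_add_distrib] <;> abel

theorem dDeg_smul (q : ℕ) (c : ℝ) (η : AltForm R L q) :
    A.dDeg q (c • η) = c • A.dDeg q η := by
  ext v
  cases q <;> simp [dDeg_apply, dVal, bracketSum, Finset.smul_sum]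

/-- The differential `d_A` on forms. -/
def d : Module.End ℝ (Form R L) :=
  DirectSum.toModule ℝ ℕ _ fun q =>
    { toFun := fun η => ofDeg (q + 1) (A.dDeg q η)
      map_add' := fun η θ => by rw [dDeg_add, map_add]
      map_smul' := fun c η => by
        rw [dDeg_smul, LinearMap.map_smul_of_tower]; rfl }

@[simp] theorem d_ofDeg (q : ℕ) (η : AltForm R L q) :
    A.d (ofDeg q η) = ofDeg (q + 1) (A.dDeg q η) :=
  DirectSum.toModule_lof ℝ q η

end Differential

end LieRinehart

/-! ### Gerstenhaber and Batalin-Vilkovisky algebras -/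

/-- A Gerstenhaber algebra: a graded commutative associative algebra `⨁ 𝒲 p` with a bracket of
degree `-1` that is skew-symmetric, satisfies the Jacobi identity, and is a biderivation, in the
graded sense. -/
structure IsGerstenhaberAlgebra {W : Type*} [AddCommGroup W] [Module ℝ W]
    (𝒲 : ℕ → Submodule ℝ W) (mul : W →ₗ[ℝ] W →ₗ[ℝ] W) (one : W)
    (br : W →ₗ[ℝ] W →ₗ[ℝ] W) : Prop where
  isInternal : DirectSum.IsInternal 𝒲
  one_mem : one ∈ 𝒲 0
  one_mul : ∀ a, mul one a = a
  mul_mem : ∀ p q, ∀ a ∈ 𝒲 p, ∀ b ∈ 𝒲 q, mul a b ∈ 𝒲 (p + q)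
  mul_assoc : ∀ a b c, mul (mul a b) c = mul a (mul b c)
  mul_comm : ∀ p q, ∀ a ∈ 𝒲 p, ∀ b ∈ 𝒲 q, mul a b = (-1 : ℝ) ^ (p * q) • mul b a
  br_mem : ∀ p q m, p + q = m + 1 → ∀ a ∈ 𝒲 p, ∀ b ∈ 𝒲 q, br a b ∈ 𝒲 m
  br_zero : ∀ a ∈ 𝒲 0, ∀ b ∈ 𝒲 0, br a b = 0
  br_skew : ∀ p q, ∀ a ∈ 𝒲 p, ∀ b ∈ 𝒲 q, br a b = -((-1 : ℝ) ^ ((p + 1) * (q + 1)) • br b a)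
  br_mul : ∀ p q, ∀ a ∈ 𝒲 p, ∀ b ∈ 𝒲 q, ∀ c,
    br a (mul b c) = mul (br a b) c + (-1 : ℝ) ^ ((p + 1) * q) • mul b (br a c)
  br_jacobi : ∀ p q, ∀ a ∈ 𝒲 p, ∀ b ∈ 𝒲 q, ∀ c,
    br a (br b c) = br (br a b) c + (-1 : ℝ) ^ ((p + 1) * (q + 1)) • br b (br a c)

/-- An operator `u` generates the bracket if
`[a, b] = (-1) ^ |a| (u (a b) - u (a) b - (-1) ^ |a| a u (b))`. -/
def IsGenerator {W : Type*} [AddCommGroup W] [Module ℝ W]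
    (𝒲 : ℕ → Submodule ℝ W) (mul br : W →ₗ[ℝ] W →ₗ[ℝ] W) (u : Module.End ℝ W) : Prop :=
  ∀ p, ∀ a ∈ 𝒲 p, ∀ b,
    br a b = (-1 : ℝ) ^ p • (u (mul a b) - mul (u a) b - (-1 : ℝ) ^ p • mul a (u b))

/-- A Batalin-Vilkovisky algebra: a Gerstenhaber algebra with a generator of square zero. -/
structure IsBVAlgebra {W : Type*} [AddCommGroup W] [Module ℝ W]
    (𝒲 : ℕ → Submodule ℝ W) (mul : W →ₗ[ℝ] W →ₗ[ℝ] W) (one : W)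
    (br : W →ₗ[ℝ] W →ₗ[ℝ] W) (u : Module.End ℝ W) : Prop where
  gerstenhaber : IsGerstenhaberAlgebra 𝒲 mul one br
  generator : IsGenerator 𝒲 mul br u
  square_zero : u * u = 0

/-! ### Twisted Poisson structures -/

section FormAlgebra

variable (R L : Type*) [CommRing R] [Algebra ℝ R] [AddCommGroup L] [Module R L]

/-- The forms of degree `q`, as a subspace of the space of all forms. -/
def formDeg (q : ℕ) : Submodule ℝ (Form R L) :=
  LinearMap.range ((ofDeg q : AltForm R L q →ₗ[R] Form R L).restrictScalars ℝ)

/-- The exterior product as an `ℝ`-bilinear map. -/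
def wedgeReal : Form R L →ₗ[ℝ] Form R L →ₗ[ℝ] Form R L :=
  LinearMap.restrictScalars₁₂ ℝ ℝ wedge

variable {R L}

/-- The interior product `i_P` as an `ℝ`-linear operator on forms. -/
def intProdReal (P : ExteriorAlgebra R L) : Module.End ℝ (Form R L) :=
  (intProd P).restrictScalars ℝ

end FormAlgebra

namespace LieRinehart

variable {R L : Type*} [CommRing R] [Algebra ℝ R] [AddCommGroup L] [Module ℝ L]
    [Module R L] [IsScalarTower ℝ R L] (A : LieRinehart R L)

/-- The Lie derivation of forms `ℒ_X = [i_X, d] = i_X d + d i_X`. -/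
def lieForm (X : L) : Module.End ℝ (Form R L) :=
  intProdReal (ExteriorAlgebra.ι R X) * A.d + A.d * intProdReal (ExteriorAlgebra.ι R X)

/-- The operator `∂_π = [d, i_π] = d i_π - i_π d`. -/
def partialPi (π : ⋀[R]^2 L) : Module.End ℝ (Form R L) :=
  A.d * intProdReal (π : ExteriorAlgebra R L) - intProdReal (π : ExteriorAlgebra R L) * A.d

/-- `π` and `ψ` form a twisted Poisson structure: `ψ` is closed and `1/2 [π, π] = (∧³ π♯) ψ`. -/
structure IsTwistedPoisson (π : ⋀[R]^2 L) (ψ : AltForm R L 3) : Prop where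
  closed : A.d (ofDeg 3 ψ) = 0
  half_schouten : algebraMap ℝ R (1 / 2) • A.schouten π (π : ExteriorAlgebra R L) = sharpThree π ψ

/-- The bracket of 1-forms
`[α, β]_{π,ψ} = ℒ_{π♯ α} β - ℒ_{π♯ β} α - d (π(α, β)) + ψ⁽²⁾(α, β)`. -/
def dualBracket (π : ⋀[R]^2 L) (ψ : AltForm R L 3) (α β : Module.Dual R L) : Form R L :=
  A.lieForm (sharp π α) (ofDual β) - A.lieForm (sharp π β) (ofDual α)
    - A.d (ofFun (β (sharp π α))) + ofDual (psiTwoEval π ψ α β)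

/-- `br` is the Gerstenhaber bracket `[ , ]_{π,ψ}` on forms: the extension to a Gerstenhaber
bracket of the bracket of 1-forms and of the action of 1-forms on functions through the anchor
`ρ ∘ π♯`. -/
structure IsDualGerstenhaberBracket (π : ⋀[R]^2 L) (ψ : AltForm R L 3)
    (br : Form R L →ₗ[ℝ] Form R L →ₗ[ℝ] Form R L) : Prop where
  gerstenhaber : IsGerstenhaberAlgebra (formDeg R L) (wedgeReal R L) (ofFun (1 : R)) br
  br_ofFun : ∀ (α : Module.Dual R L) (f : R),
    br (ofDual α) (ofFun f) = ofFun (A.anchor (sharp π α) f)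
  br_ofDual : ∀ α β : Module.Dual R L, br (ofDual α) (ofDual β) = A.dualBracket π ψ α β

/-- The operator `∂_π + ∂̲_{π,ψ} + i_{Y_{π,ψ}}`. -/
def generator (π : ⋀[R]^2 L) (ψ : AltForm R L 3) : Module.End ℝ (Form R L) :=
  A.partialPi π + underlinePartial π ψ + intProdReal (ExteriorAlgebra.ι R (sectionY π ψ))

end LieRinehart

/-! ### Lie algebroids -/

section Geometry

variable {E : Type*} [NormedAddCommGroup E] [NormedSpace ℝ E] {H : Type*} [TopologicalSpace H]
  (I : ModelWithCorners ℝ E H) (M : Type*) [TopologicalSpace M] [ChartedSpace H M]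
  (F : Type*) [NormedAddCommGroup F] [NormedSpace ℝ F]
  (V : M → Type*) [TopologicalSpace (Bundle.TotalSpace F V)] [∀ x, AddCommGroup (V x)]
  [∀ x, Module ℝ (V x)] [∀ x, TopologicalSpace (V x)] [FiberBundle F V] [VectorBundle ℝ F V]

/-- The multiplication of smooth sections by smooth functions. -/
instance sectionModule : Module C^∞⟮I, M; ℝ⟯ Cₛ^∞⟮I; F, V⟯ where
  smul f s := ⟨fun x => f x • s x, f.contMDiff.smul_section s.contMDiff⟩
  one_smul s := by ext x; exact one_smul ℝ (s x)
  mul_smul f g s := by ext x; exact mul_smul (f x) (g x) (s x)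
  smul_zero f := by ext x; exact smul_zero (f x)
  smul_add f s t := by ext x; exact smul_add (f x) (s x) (t x)
  add_smul f g s := by ext x; exact add_smul (f x) (g x) (s x)
  zero_smul s := by ext x; exact zero_smul ℝ (s x)

@[simp] theorem section_smul_apply (f : C^∞⟮I, M; ℝ⟯) (s : Cₛ^∞⟮I; F, V⟯) (x : M) :
    (f • s) x = f x • s x := rfl

instance : IsScalarTower ℝ C^∞⟮I, M; ℝ⟯ Cₛ^∞⟮I; F, V⟯ where
  smul_assoc c f s := by ext x; exact smul_assoc c (f x) (s x)

variable [IsManifold I ∞ M]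

/-- A morphism of vector bundles, over the identity, from `V` to the tangent bundle. -/
structure Anchor where
  toFun : ∀ x, V x →ₗ[ℝ] TangentSpace I x
  contMDiff_toFun : ContMDiff (I.prod 𝓘(ℝ, F)) I.tangent ∞
    (fun p : Bundle.TotalSpace F V => (⟨p.1, toFun p.1 p.2⟩ : TangentBundle I M))

variable {I M F V}

namespace Anchor

variable (ρ : Anchor I M F V)

/-- The derivative `ρ(a) · f` of a function `f` along the image of a section `a`. -/
def deriv (a : Cₛ^∞⟮I; F, V⟯) (f : C^∞⟮I, M; ℝ⟯) : C^∞⟮I, M; ℝ⟯ :=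
  ⟨fun x => mfderiv I 𝓘(ℝ, ℝ) f x (ρ.toFun x (a x)), by
    have h1 : ContMDiff I I.tangent ∞
        (fun x => (⟨x, ρ.toFun x (a x)⟩ : TangentBundle I M)) :=
      ρ.contMDiff_toFun.comp a.contMDiff
    have h2 : ContMDiff I.tangent 𝓘(ℝ, ℝ).tangent ∞ (tangentMap I 𝓘(ℝ, ℝ) f) :=
      f.contMDiff.contMDiff_tangentMap (by simp)
    exact (contMDiff_snd_tangentBundle_modelSpace ℝ 𝓘(ℝ, ℝ)).comp (h2.comp h1)⟩

theorem deriv_apply (a : Cₛ^∞⟮I; F, V⟯) (f : C^∞⟮I, M; ℝ⟯) (x : M) :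
    ρ.deriv a f x = mfderiv I 𝓘(ℝ, ℝ) f x (ρ.toFun x (a x)) := rfl

/-- The anchor as a map from sections to derivations of the algebra of smooth functions. -/
def toDerivation :
    Cₛ^∞⟮I; F, V⟯ →ₗ[C^∞⟮I, M; ℝ⟯] Derivation ℝ C^∞⟮I, M; ℝ⟯ C^∞⟮I, M; ℝ⟯ where
  toFun a := Derivation.mk'
    { toFun := ρ.deriv a
      map_add' := fun f g => by
        ext x
        have hf := f.contMDiff.mdifferentiableAt (x := x) (by simp)
        have hg := g.contMDiff.mdifferentiableAt (x := x) (by simp)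
        change mfderiv I 𝓘(ℝ, ℝ) (f + g : M → ℝ) x _ = _
        rw [mfderiv_add hf hg]
        rfl
      map_smul' := fun c f => by
        ext x
        have hf := f.contMDiff.mdifferentiableAt (x := x) (by simp)
        change mfderiv I 𝓘(ℝ, ℝ) (c • f : M → ℝ) x _ = _
        rw [const_smul_mfderiv hf]
        rfl }
    (fun f g => by
      ext x
      have hf := f.contMDiff.mdifferentiableAt (x := x) (by simp)
      have hg := g.contMDiff.mdifferentiableAt (x := x) (by simp)
      change mfderiv I 𝓘(ℝ, ℝ) (f * g : M → ℝ) x _ = _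
      rw [(hf.hasMFDerivAt.mul hg.hasMFDerivAt).mfderiv]
      rfl)
  map_add' a b := by
    ext f x
    change mfderiv I 𝓘(ℝ, ℝ) f x (ρ.toFun x (a x + b x)) = _
    rw [map_add, map_add]
    rfl
  map_smul' f a := by
    ext g x
    change mfderiv I 𝓘(ℝ, ℝ) g x (ρ.toFun x (f x • a x)) = _
    rw [map_smul, map_smul]
    rfl

end Anchor

variable (I M F V)

/-- A Lie algebroid structure on the vector bundle `V`: an `ℝ`-Lie algebra structure on the space
of smooth sections and an anchor, which is a morphism of Lie algebras on sections and satisfies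
the Leibniz rule. -/
structure LieAlgebroid where
  anchor : Anchor I M F V
  bracket : Cₛ^∞⟮I; F, V⟯ →ₗ[ℝ] Cₛ^∞⟮I; F, V⟯ →ₗ[ℝ] Cₛ^∞⟮I; F, V⟯
  bracket_self : ∀ a, bracket a a = 0
  jacobi : ∀ a b c, bracket a (bracket b c) = bracket (bracket a b) c + bracket b (bracket a c)
  leibniz : ∀ a b (f : C^∞⟮I, M; ℝ⟯),
    bracket a (f • b) = f • bracket a b + anchor.deriv a f • b
  anchor_bracket : ∀ a b (f : C^∞⟮I, M; ℝ⟯),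
    anchor.deriv (bracket a b) f
      = anchor.deriv a (anchor.deriv b f) - anchor.deriv b (anchor.deriv a f)

variable {I M F V}

/-- The structure on functions and sections defined by a Lie algebroid. -/
def LieAlgebroid.toLieRinehart (A : LieAlgebroid I M F V) :
    LieRinehart C^∞⟮I, M; ℝ⟯ Cₛ^∞⟮I; F, V⟯ where
  bracket := A.bracket
  anchor := A.anchor.toDerivation
  bracket_self := A.bracket_self
  jacobi := A.jacobi
  leibniz := A.leibniz
  anchor_bracket := A.anchor_bracket

end Geometry

end TwistedPoisson

end

open TwistedPoisson

/-! Write p for i_π and [T, p] = T p - p T. Since ψ is closed and of odd degree, d_A + ψ∧ has square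
zero, and so does its conjugate exp(-p) (d_A + ψ∧) exp(p), a finite sum of iterated commutators with
p. As p lowers degrees by 2, this conjugate has components of degrees 3, 1, -1 and -3. The component
of degree -1 is [d_A, p] + 1/2 [[ψ∧, p], p]. Computing the double commutator from the single rule
[ξ∧, i_π] = i_{π♯ξ} shows that this is u, the section Y included (`adPi_adPi_wedge_three`,
`generator_eq`). The component of degree -3 is 1/2 [[d_A, p], p] + 1/6 [[[ψ∧, p], p], p] = -1/2
i_{[π,π]} + i_{(∧³π♯)ψ} (`intProd_schouten`, `adPi_adPi_adPi_wedge_three`), and the twisted Poisson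
condition makes it vanish. What remains of the square in degree -2 is then u², so u² = 0.
`sq_eq_zero_of_commutators` carries this out in an arbitrary algebra, without exponentials.

The bracket is defined as the one generated by u. Up to derivations, u is a sum of products of an
even and an odd derivation, hence of order two, and the bracket is a biderivation
(`IsEvenDerivation.isSecondOrder_mul`). Graded commutativity gives skew-symmetry, and u² = 0 with
the Leibniz rule gives the Jacobi identity (`isBVAlgebra_generatedBracket`). The prescribed values
on functions and 1-forms are then computed.

Uniqueness holds because a graded derivation of forms is determined by its values in degrees 0 and 1
(`eq_zero_of_derivation`). This uses frames cut off by bump functions (`exists_frame_at`).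

The exterior and Cartan calculus rests on one device: a form is determined by its function part and
its insertions (`form_ext_contract`), so an identity follows by induction once its behaviour under
insertions is known. Computations with π use a finite sum S of pure tensors equal to `toTensor π`,
in place of a basis. -/

namespace TwistedPoisson

/-! ### Evaluation of forms and the exterior product -/

section FormCalculus

variable {R L : Type*} [CommRing R] [AddCommGroup L] [Module R L]

/-- Permutations are sorted by the position k that receives x: each is the cycle `Fin.cycleRange k`,
of sign (-1)^k, followed by a permutation fixing 0. This prepares the insertion of a vector into an
exterior product. -/
theorem sum_perm_succ {T N : Type*} [AddCommGroup N] {m : ℕ} (F : (Fin (m + 1) → T) → N)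
    (x : T) (w : Fin m → T) :
    ∑ σ : Equiv.Perm (Fin (m + 1)), Equiv.Perm.sign σ • F (Matrix.vecCons x w ∘ σ)
      = ∑ k : Fin (m + 1), ∑ τ : Equiv.Perm (Fin m),
        ((-1 : ℤˣ) ^ (k : ℕ) * Equiv.Perm.sign τ) • F (k.insertNth x (w ∘ τ)) := by
  let e : Fin (m + 1) × Equiv.Perm (Fin m) → Equiv.Perm (Fin (m + 1)) := fun x =>
    Equiv.Perm.decomposeFin.symm (0, x.2) * Fin.cycleRange x.1
  have he : Function.Bijective e := by
    rw [Fintype.bijective_iff_injective_and_card]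
    refine ⟨?_, by simp [Fintype.card_perm, Nat.factorial_succ]⟩
    rintro ⟨k, τ⟩ ⟨k', τ'⟩ h
    -- The permutation built from (k, τ) sends k to 0, so k can be read off from it.
    have h1 : k = k' := by
      have h2 : e (k, τ) k = e (k', τ') k := by rw [h]
      have h3 : e (k', τ') k = e (k', τ') k' := by rw [← h2]; simp [e]
      exact (e (k', τ')).injective h3
    subst h1
    have h2 := mul_right_cancel h
    rw [EmbeddingLike.apply_eq_iff_eq] at h2
    simpa using h2
  rw [← Fintype.sum_prod_type', ← he.sum_comp]
  refine Finset.sum_congr rfl fun y _ => ?_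
  obtain ⟨k, τ⟩ := y
  have hs : Equiv.Perm.sign (e (k, τ)) = (-1 : ℤˣ) ^ (k : ℕ) * Equiv.Perm.sign τ := by
    simp [e, Equiv.Perm.decomposeFin.symm_sign, mul_comm]
  have hv : Matrix.vecCons x w ∘ e (k, τ) = k.insertNth x (w ∘ τ) := by
    rw [← Fin.cons_comp_cycleRange]
    have : Matrix.vecCons x w ∘ (Equiv.Perm.decomposeFin.symm (0, τ))
        = Fin.cons x (w ∘ τ) := by
      ext i
      refine Fin.cases ?_ (fun i => ?_) i <;> simp [Matrix.vecCons]
    rw [← this]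
    rfl
  rw [hs, hv]

/-- Every shuffle class contains p! q! permutations with equal contributions. After multiplication
by this number the sum runs over a plain permutation group instead of a quotient. -/
theorem factorial_smul_wedgeDeg {p q : ℕ} (a : AltForm R L p) (b : AltForm R L q)
    (v : Fin (p + q) → L) :
    (p.factorial * q.factorial) • wedgeDeg p q a b v
      = ∑ σ : Equiv.Perm (Fin (p + q)), Equiv.Perm.sign σ •
        (a ((v ∘ σ) ∘ Fin.castAdd q) * b ((v ∘ σ) ∘ Fin.natAdd p)) := by
  have h := MultilinearMap.domCoprod_alternization_eq a b
  have h2 := congrArg (fun f => LinearMap.mul' R R (f (v ∘ finSumFinEquiv))) h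
  simp only [Fintype.card_fin, AlternatingMap.smul_apply, map_nsmul] at h2
  refine Eq.trans h2.symm ?_
  rw [MultilinearMap.alternatization_apply, map_sum]
  refine Fintype.sum_equiv (Equiv.permCongr finSumFinEquiv) _ _ fun σ => ?_
  rw [Units.smul_def, Units.smul_def, map_zsmul, Equiv.Perm.sign_permCongr]
  congr 1
  simp only [MultilinearMap.domDomCongr_apply, MultilinearMap.domCoprod_apply,
    LinearMap.mul'_apply]
  refine congrArg₂ (· * ·) (congrArg a ?_) (congrArg b ?_) <;> ext i <;>
    simp [Equiv.permCongr_apply]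

/-- The value of the component of degree `n` of a form. -/
def formEval (n : ℕ) (η : Form R L) (v : Fin n → L) : R := η n v

theorem form_ext_eval {η θ : Form R L} (h : ∀ n v, formEval n η v = formEval n θ v) : η = θ :=
  DFinsupp.ext fun n => AlternatingMap.ext (h n)

@[simp] theorem formEval_add (n : ℕ) (η θ : Form R L) (v : Fin n → L) :
    formEval n (η + θ) v = formEval n η v + formEval n θ v := rfl

@[simp] theorem formEval_smul (n : ℕ) (c : R) (η : Form R L) (v : Fin n → L) :
    formEval n (c • η) v = c * formEval n η v := rfl

theorem formEval_ofDeg (n q : ℕ) (b : AltForm R L q) (v : Fin n → L) :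
    formEval n (ofDeg q b) v = if h : q = n then b (v ∘ Fin.cast h) else 0 := by
  split_ifs with h
  · subst h
    simp [formEval, ofDeg, DirectSum.lof_eq_of]
  · simp only [formEval, ofDeg, DirectSum.lof_eq_of]
    rw [DirectSum.of_eq_of_ne _ _ _ (Ne.symm h)]
    rfl

theorem formEval_ofDeg_self (q : ℕ) (b : AltForm R L q) (v : Fin q → L) :
    formEval q (ofDeg q b) v = b v := by
  simp [formEval_ofDeg]

theorem form_induction {P : Form R L → Prop} (h0 : P 0)
    (h1 : ∀ q (η : AltForm R L q), P (ofDeg q η)) (h2 : ∀ η θ, P η → P θ → P (η + θ))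
    (η : Form R L) : P η :=
  DirectSum.induction_on η h0 h1 h2

theorem formEval_contract (n : ℕ) (X : L) (η : Form R L) (v : Fin n → L) :
    formEval n (contract X η) v = formEval (n + 1) η (Matrix.vecCons X v) := by
  induction η using form_induction with
  | h0 => rw [map_zero]; rfl
  | h2 η θ hη hθ => rw [map_add, formEval_add, formEval_add, hη, hθ]
  | h1 q η =>
    cases q with
    | zero => rw [contract_zero_deg, formEval_ofDeg, dif_neg (by omega)]; rfl
    | succ q =>
      rw [contract_succ_deg, formEval_ofDeg, formEval_ofDeg]
      by_cases h : q = n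
      · subst h; simp
      · rw [dif_neg h, dif_neg (by omega)]

theorem wedge_ofDeg (p q : ℕ) (a : AltForm R L p) (b : AltForm R L q) :
    wedge (ofDeg p a) (ofDeg q b) = ofDeg (p + q) (wedgeDeg p q a b) := by
  simp [wedge, ofDeg]

/-- A form is determined by its component of degree `0` and its contractions. -/
theorem form_ext_contract {η θ : Form R L} (h0 : formEval 0 η ![] = formEval 0 θ ![])
    (h : ∀ X, contract X η = contract X θ) : η = θ := by
  refine form_ext_eval fun n v => ?_
  cases n with
  | zero => rwa [Subsingleton.elim v ![]]
  | succ n =>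
    have := congrArg (fun ζ => formEval n ζ (Matrix.vecTail v)) (h (v 0))
    rw [formEval_contract, formEval_contract] at this
    rwa [show Matrix.vecCons (v 0) (Matrix.vecTail v) = v from Matrix.cons_head_tail v] at this

theorem factorial_smul_formEval_wedge {p q n : ℕ} (a : AltForm R L p) (b : AltForm R L q)
    (h : p + q = n) (v : Fin n → L) :
    (p.factorial * q.factorial) • formEval n (wedge (ofDeg p a) (ofDeg q b)) v
      = ∑ σ : Equiv.Perm (Fin n), Equiv.Perm.sign σ •
        (a ((v ∘ σ) ∘ Fin.cast h ∘ Fin.castAdd q) * b ((v ∘ σ) ∘ Fin.cast h ∘ Fin.natAdd p)) := by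
  subst h
  rw [wedge_ofDeg, formEval_ofDeg_self, factorial_smul_wedgeDeg]
  rfl

theorem formEval_wedge_ne {p q n : ℕ} (a : AltForm R L p) (b : AltForm R L q)
    (h : p + q ≠ n) (v : Fin n → L) :
    formEval n (wedge (ofDeg p a) (ofDeg q b)) v = 0 := by
  rw [wedge_ofDeg, formEval_ofDeg, dif_neg h]

/-! ### Inserting an argument into the first or the second block of p + q places -/

theorem insertNth_comp_castAdd {T : Type*} {p q n : ℕ} (h : p + 1 + q = n + 1)
    (h' : p + q = n) (k : Fin (p + 1)) (x : T) (w : Fin n → T) :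
    (Fin.cast h (Fin.castAdd q k)).insertNth x w ∘ Fin.cast h ∘ Fin.castAdd q
      = k.insertNth (α := fun _ => T) x (w ∘ Fin.cast h' ∘ Fin.castAdd q) := by
  ext i
  refine Fin.succAboveCases k ?_ (fun i => ?_) i
  · simp
  · simp only [Function.comp_apply, Fin.insertNth_apply_succAbove]
    rw [show Fin.cast h (Fin.castAdd q (k.succAbove i))
      = (Fin.cast h (Fin.castAdd q k)).succAbove (Fin.cast h' (Fin.castAdd q i)) by
        ext; simp [Fin.succAbove, Fin.lt_def]; split_ifs <;> rfl,
      Fin.insertNth_apply_succAbove]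

theorem insertNth_castAdd_comp_natAdd {T : Type*} {p q n : ℕ} (h : p + 1 + q = n + 1)
    (h' : p + q = n) (k : Fin (p + 1)) (x : T) (w : Fin n → T) :
    (Fin.cast h (Fin.castAdd q k)).insertNth (α := fun _ => T) x w ∘ Fin.cast h ∘ Fin.natAdd (p + 1)
      = w ∘ Fin.cast h' ∘ Fin.natAdd p := by
  ext i
  simp only [Function.comp_apply]
  rw [show Fin.cast h (Fin.natAdd (p + 1) i)
      = (Fin.cast h (Fin.castAdd q k)).succAbove (Fin.cast h' (Fin.natAdd p i)) by
        ext; simp [Fin.succAbove, Fin.lt_def]; split_ifs <;> (simp; try omega),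
      Fin.insertNth_apply_succAbove]

theorem insertNth_natAdd_comp_castAdd {T : Type*} {p q n : ℕ} (h : p + (q + 1) = n + 1)
    (h' : p + q = n) (k : Fin (q + 1)) (x : T) (w : Fin n → T) :
    (Fin.cast h (Fin.natAdd p k)).insertNth (α := fun _ => T) x w
        ∘ Fin.cast h ∘ Fin.castAdd (q + 1)
      = w ∘ Fin.cast h' ∘ Fin.castAdd q := by
  ext i
  simp only [Function.comp_apply]
  rw [show Fin.cast h (Fin.castAdd (q + 1) i)
      = (Fin.cast h (Fin.natAdd p k)).succAbove (Fin.cast h' (Fin.castAdd q i)) by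
        ext; simp [Fin.succAbove, Fin.lt_def]; split_ifs <;> (simp; try omega),
      Fin.insertNth_apply_succAbove]

theorem insertNth_comp_natAdd {T : Type*} {p q n : ℕ} (h : p + (q + 1) = n + 1)
    (h' : p + q = n) (k : Fin (q + 1)) (x : T) (w : Fin n → T) :
    (Fin.cast h (Fin.natAdd p k)).insertNth (α := fun _ => T) x w ∘ Fin.cast h ∘ Fin.natAdd p
      = k.insertNth (α := fun _ => T) x (w ∘ Fin.cast h' ∘ Fin.natAdd p) := by
  ext i
  refine Fin.succAboveCases k ?_ (fun i => ?_) i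
  · simp
  · simp only [Function.comp_apply, Fin.insertNth_apply_succAbove]
    rw [show Fin.cast h (Fin.natAdd p (k.succAbove i))
      = (Fin.cast h (Fin.natAdd p k)).succAbove (Fin.cast h' (Fin.natAdd p i)) by
        ext; simp [Fin.succAbove, Fin.lt_def]; split_ifs <;> (simp; try omega),
      Fin.insertNth_apply_succAbove]

/-- These are the terms of `sum_perm_succ` in which X lands among the arguments of `a`. Moving X to
the front there costs (-1)^k, which cancels the sign already present; the p positions contribute
equally and turn (p - 1)! into p!. -/
theorem sum_insertNth_left {p q n : ℕ} (a : AltForm R L p) (b : AltForm R L q)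
    (h : p + q = n + 1) (X : L) (w : Fin n → L) :
    ∑ k : Fin p, ∑ τ : Equiv.Perm (Fin n),
        ((-1 : ℤˣ) ^ (Fin.cast h (Fin.castAdd q k) : ℕ) * Equiv.Perm.sign τ) •
          (a ((Fin.cast h (Fin.castAdd q k)).insertNth (α := fun _ => L) X (w ∘ τ)
              ∘ Fin.cast h ∘ Fin.castAdd q)
            * b ((Fin.cast h (Fin.castAdd q k)).insertNth (α := fun _ => L) X (w ∘ τ)
              ∘ Fin.cast h ∘ Fin.natAdd p))
      = (p.factorial * q.factorial) •
        formEval n (wedge (contract X (ofDeg p a)) (ofDeg q b)) w := by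
  cases p with
  | zero => rw [contract_zero_deg, map_zero, LinearMap.zero_apply]; simp [formEval]
  | succ p =>
    have h' : p + q = n := by omega
    rw [contract_succ_deg, Nat.factorial_succ, mul_assoc, mul_smul,
      factorial_smul_formEval_wedge _ _ h']
    have hc : ∀ z : R, (p + 1) • z = ∑ _k : Fin (p + 1), z := fun z => by simp
    rw [hc]
    refine Finset.sum_congr rfl fun k _ => Finset.sum_congr rfl fun τ _ => ?_
    rw [insertNth_comp_castAdd h h', insertNth_castAdd_comp_natAdd h h',
      AlternatingMap.map_insertNth, AlternatingMap.curryLeft_apply_apply]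
    simp only [Units.smul_def, zsmul_eq_mul, Fin.val_cast, Fin.val_castAdd]
    push_cast
    have hk : ((-1 : R) ^ (k : ℕ)) * (-1) ^ (k : ℕ) = 1 := by rw [← mul_pow]; simp
    linear_combination (((Equiv.Perm.sign τ : ℤ) : R)
      * a (Matrix.vecCons X ((w ∘ τ) ∘ Fin.cast h' ∘ Fin.castAdd q))
      * b ((w ∘ τ) ∘ Fin.cast h' ∘ Fin.natAdd p)) * hk

/-- The companion sum, with X among the arguments of `b`: its position is now p + k while only k
transpositions are needed, so the sign (-1)^p survives. -/
theorem sum_insertNth_right {p q n : ℕ} (a : AltForm R L p) (b : AltForm R L q)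
    (h : p + q = n + 1) (X : L) (w : Fin n → L) :
    ∑ k : Fin q, ∑ τ : Equiv.Perm (Fin n),
        ((-1 : ℤˣ) ^ (Fin.cast h (Fin.natAdd p k) : ℕ) * Equiv.Perm.sign τ) •
          (a ((Fin.cast h (Fin.natAdd p k)).insertNth (α := fun _ => L) X (w ∘ τ)
              ∘ Fin.cast h ∘ Fin.castAdd q)
            * b ((Fin.cast h (Fin.natAdd p k)).insertNth (α := fun _ => L) X (w ∘ τ)
              ∘ Fin.cast h ∘ Fin.natAdd p))
      = (p.factorial * q.factorial) •
        formEval n ((-1 : R) ^ p • wedge (ofDeg p a) (contract X (ofDeg q b))) w := by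
  cases q with
  | zero => rw [contract_zero_deg, map_zero, smul_zero]; simp [formEval]
  | succ q =>
    have h' : p + q = n := by omega
    rw [contract_succ_deg, Nat.factorial_succ, mul_left_comm, mul_smul, formEval_smul,
      ← mul_smul_comm, factorial_smul_formEval_wedge _ _ h']
    have hc : ∀ z : R, (q + 1) • z = ∑ _k : Fin (q + 1), z := fun z => by simp
    rw [hc]
    refine Finset.sum_congr rfl fun k _ => ?_
    rw [Finset.mul_sum]
    refine Finset.sum_congr rfl fun τ _ => ?_
    rw [insertNth_comp_natAdd h h', insertNth_natAdd_comp_castAdd h h',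
      AlternatingMap.map_insertNth, AlternatingMap.curryLeft_apply_apply]
    simp only [Units.smul_def, zsmul_eq_mul, Fin.val_cast, Fin.val_natAdd]
    push_cast
    have hk : ((-1 : R) ^ (k : ℕ)) * (-1) ^ (k : ℕ) = 1 := by rw [← mul_pow]; simp
    rw [pow_add]
    linear_combination ((-1 : R) ^ p * ((Equiv.Perm.sign τ : ℤ) : R)
      * a ((w ∘ τ) ∘ Fin.cast h' ∘ Fin.castAdd q)
      * b (Matrix.vecCons X ((w ∘ τ) ∘ Fin.cast h' ∘ Fin.natAdd p))) * hk

/-- The sign involution of forms: multiplication by `(-1) ^ q` in degree `q`. -/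
def formSign : Form R L →ₗ[R] Form R L :=
  DirectSum.toModule R ℕ _ fun q => (-1 : R) ^ q • ofDeg q

theorem formSign_ofDeg (q : ℕ) (η : AltForm R L q) :
    formSign (ofDeg q η) = (-1 : R) ^ q • ofDeg q η := by
  simp [formSign, ofDeg]

theorem formSign_formSign (η : Form R L) : formSign (formSign η) = η := by
  induction η using form_induction with
  | h0 => simp
  | h2 η θ hη hθ => rw [map_add, map_add, hη, hθ]
  | h1 q η => rw [formSign_ofDeg, map_smul, formSign_ofDeg, smul_smul, ← mul_pow]; simp

theorem contract_formSign (X : L) (η : Form R L) :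
    contract X (formSign η) = -formSign (contract X η) := by
  induction η using form_induction with
  | h0 => simp
  | h2 η θ hη hθ => simp only [map_add, hη, hθ, neg_add]
  | h1 q η =>
    cases q with
    | zero => simp [formSign_ofDeg]
    | succ q => simp [formSign_ofDeg, pow_succ]

theorem formSign_wedge (a b : Form R L) :
    formSign (wedge a b) = wedge (formSign a) (formSign b) := by
  induction a using form_induction with
  | h0 => simp
  | h2 a a' ha ha' => simp only [map_add, LinearMap.add_apply, ha, ha']
  | h1 p a =>
    induction b using form_induction with
    | h0 => simp
    | h2 b b' hb hb' => simp only [map_add, hb, hb']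
    | h1 q b => simp [wedge_ofDeg, formSign_ofDeg, smul_smul, pow_add, mul_comm]

variable [Algebra ℝ R]

theorem nsmul_cancel_of_real {c : ℕ} (hc : c ≠ 0) {x y : R} (h : c • x = c • y) : x = y := by
  have hu : (algebraMap ℝ R (1 / c)) * (c : R) = 1 := by
    rw [← map_natCast (algebraMap ℝ R) c, ← map_mul]
    have : (c : ℝ) ≠ 0 := by exact_mod_cast hc
    rw [one_div, inv_mul_cancel₀ this, map_one]
  simp only [nsmul_eq_mul] at h
  linear_combination (algebraMap ℝ R (1 / c)) * h + (y - x) * hu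

/-- The insertion of a section is an odd derivation of the exterior product. -/
theorem contract_wedge (X : L) (a b : Form R L) :
    contract X (wedge a b) = wedge (contract X a) b + wedge (formSign a) (contract X b) := by
  induction a using form_induction with
  | h0 => simp
  | h2 a a' ha ha' => simp only [map_add, LinearMap.add_apply, ha, ha']; abel
  | h1 p a =>
    induction b using form_induction with
    | h0 => simp
    | h2 b b' hb hb' => simp only [map_add, hb, hb']; abel
    | h1 q b =>
      rw [formSign_ofDeg, map_smul, LinearMap.smul_apply]
      refine form_ext_eval fun n w => ?_
      rw [formEval_contract, formEval_add]
      by_cases h : p + q = n + 1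
      -- The factor p! q!, invertible over ℝ, trades shuffles for permutations. The place of X then
      -- lies in the block of p or in the block of q arguments, one for each term of the Leibniz
      -- rule.
      · refine nsmul_cancel_of_real (c := p.factorial * q.factorial)
          (Nat.mul_ne_zero (Nat.factorial_ne_zero _) (Nat.factorial_ne_zero _)) ?_
        rw [smul_add, factorial_smul_formEval_wedge _ _ h, ← sum_insertNth_left a b h,
          ← sum_insertNth_right a b h, sum_perm_succ (fun v => a (v ∘ Fin.cast h ∘ Fin.castAdd q)
            * b (v ∘ Fin.cast h ∘ Fin.natAdd p)) X w, ← (finCongr h).sum_comp,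
          Fin.sum_univ_add]
        rfl
      · rw [formEval_wedge_ne _ _ h]
        have h1 : formEval n (wedge (contract X (ofDeg p a)) (ofDeg q b)) w = 0 := by
          cases p with
          | zero => simp [formEval]
          | succ p => rw [contract_succ_deg]; exact formEval_wedge_ne _ _ (by omega) _
        have h2 : formEval n (wedge (ofDeg p a) (contract X (ofDeg q b))) w = 0 := by
          cases q with
          | zero => simp [formEval]
          | succ q => rw [contract_succ_deg]; exact formEval_wedge_ne _ _ (by omega) _
        rw [formEval_smul, h1, h2]; simp

end FormCalculus

/-! ### Induction along contractions -/

section FormCalculus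

variable {R L : Type*} [CommRing R] [AddCommGroup L] [Module R L]

theorem formEval_zero_right (n : ℕ) (v : Fin n → L) : formEval n (0 : Form R L) v = 0 := rfl

theorem formEval_formSign (n : ℕ) (η : Form R L) (v : Fin n → L) :
    formEval n (formSign η) v = (-1 : R) ^ n * formEval n η v := by
  induction η using form_induction with
  | h0 => simp [formEval_zero_right]
  | h2 η θ hη hθ => simp only [map_add, formEval_add, hη, hθ, mul_add]
  | h1 q η =>
    rw [formSign_ofDeg, formEval_smul, formEval_ofDeg]
    split_ifs with h
    · subst h; rfl
    · simp

/-- The form has no components in degrees `n` and higher. -/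
def VanishesFrom (n : ℕ) (η : Form R L) : Prop := ∀ k, n ≤ k → ∀ v, formEval k η v = 0

theorem VanishesFrom.contract {n : ℕ} {η : Form R L} (h : VanishesFrom (n + 1) η) (X : L) :
    VanishesFrom n (contract X η) := fun k hk v => by
  rw [formEval_contract]; exact h _ (by omega) _

theorem VanishesFrom.formSign {n : ℕ} {η : Form R L} (h : VanishesFrom n η) :
    VanishesFrom n (formSign η) := fun k hk v => by
  rw [formEval_formSign, h k hk, mul_zero]

theorem VanishesFrom.eq_zero {η : Form R L} (h : VanishesFrom 0 η) : η = 0 :=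
  form_ext_eval fun n v => h n (Nat.zero_le n) v

theorem exists_vanishesFrom (η : Form R L) : ∃ n, VanishesFrom n η := by
  induction η using form_induction with
  | h0 => exact ⟨0, fun _ _ _ => rfl⟩
  | h1 q η => exact ⟨q + 1, fun k hk v => by rw [formEval_ofDeg, dif_neg (by omega)]⟩
  | h2 η θ hη hθ =>
    obtain ⟨m, hm⟩ := hη
    obtain ⟨n, hn⟩ := hθ
    refine ⟨max m n, fun k hk v => ?_⟩
    rw [formEval_add, hm k (le_trans (le_max_left _ _) hk), hn k (le_trans (le_max_right _ _) hk),
      add_zero]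

/-- Forms have bounded degree and each insertion lowers the bound by one, so the descent ends at the
zero form. -/
theorem contract_induction {P : Form R L → Prop} (h0 : P 0)
    (h : ∀ η, (∀ X, P (contract X η)) → P η) (η : Form R L) : P η := by
  obtain ⟨n, hn⟩ := exists_vanishesFrom η
  induction n generalizing η with
  | zero => rwa [hn.eq_zero]
  | succ n ih => exact h η fun X => ih _ (hn.contract X)

/-- An insertion that passes over a factor leaves `formSign` on it. The induction hypotheses carry
these signs so that they match the terms of the Leibniz rule as they stand; `formSign` does not
affect the degree bound. -/
theorem contract_induction₃ {P : Form R L → Form R L → Form R L → Prop}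
    (ha : ∀ b c, P 0 b c) (hb : ∀ a c, P a 0 c) (hc : ∀ a b, P a b 0)
    (h : ∀ a b c, (∀ X, P (contract X a) b c) → (∀ X, P (formSign a) (contract X b) c) →
      (∀ X, P (formSign a) (formSign b) (contract X c)) → P a b c) (a b c : Form R L) :
    P a b c := by
  obtain ⟨p, hp⟩ := exists_vanishesFrom a
  obtain ⟨q, hq⟩ := exists_vanishesFrom b
  obtain ⟨r, hr⟩ := exists_vanishesFrom c
  induction hn : p + q + r using Nat.strong_induction_on generalizing p q r a b c with
  | _ n ih =>
    rcases p with _ | p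
    · rw [hp.eq_zero]; exact ha _ _
    rcases q with _ | q
    · rw [hq.eq_zero]; exact hb _ _
    rcases r with _ | r
    · rw [hr.eq_zero]; exact hc _ _
    exact h a b c
      (fun X => ih (p + (q + 1) + (r + 1)) (by omega) _ _ _ _ (hp.contract X) _ hq _ hr rfl)
      (fun X => ih (p + 1 + q + (r + 1)) (by omega) _ _ _ _ hp.formSign _ (hq.contract X) _ hr rfl)
      (fun X => ih (p + 1 + (q + 1) + r) (by omega) _ _ _ _ hp.formSign _ hq.formSign _
        (hr.contract X) rfl)

theorem contract_induction₂ {P : Form R L → Form R L → Prop}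
    (ha : ∀ b, P 0 b) (hb : ∀ a, P a 0)
    (h : ∀ a b, (∀ X, P (contract X a) b) → (∀ X, P (formSign a) (contract X b)) → P a b)
    (a b : Form R L) : P a b := by
  obtain ⟨p, hp⟩ := exists_vanishesFrom a
  obtain ⟨q, hq⟩ := exists_vanishesFrom b
  induction hn : p + q using Nat.strong_induction_on generalizing p q a b with
  | _ n ih =>
    rcases p with _ | p
    · rw [hp.eq_zero]; exact ha _
    rcases q with _ | q
    · rw [hq.eq_zero]; exact hb _
    exact h a b
      (fun X => ih (p + (q + 1)) (by omega) _ _ _ (hp.contract X) _ hq rfl)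
      (fun X => ih (p + 1 + q) (by omega) _ _ _ hp.formSign _ (hq.contract X) rfl)

/-! ### The algebra of forms -/

theorem formEval_ofFun (f : R) : formEval 0 (ofFun f : Form R L) ![] = f := by
  simp [ofFun, formEval_ofDeg_self]

theorem contract_ofFun (X : L) (f : R) : contract X (ofFun f) = 0 :=
  contract_zero_deg X _

theorem contract_ofDual (X : L) (α : Module.Dual R L) : contract X (ofDual α) = ofFun (α X) := by
  refine (contract_succ_deg X 0 _).trans ?_
  refine congrArg (ofDeg 0) ?_
  ext v
  rfl

theorem formSign_ofFun (f : R) : formSign (ofFun f : Form R L) = ofFun f := by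
  simp [ofFun, formSign_ofDeg]

theorem formSign_ofDual (α : Module.Dual R L) : formSign (ofDual α) = -ofDual α := by
  simp [ofDual, formSign_ofDeg]

theorem formEval_zero_ofDual (α : Module.Dual R L) : formEval 0 (ofDual α) ![] = 0 := by
  simp [ofDual, formEval_ofDeg]

theorem exists_ofFun_of_deg_zero (η : AltForm R L 0) : ofDeg 0 η = ofFun (η ![]) := by
  refine congrArg (ofDeg 0) ?_
  ext v
  rw [Subsingleton.elim v ![]]
  rfl

/-- Polarization of i_X i_X = 0. -/
theorem contract_anticomm (X Y : L) (η : Form R L) :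
    contract X (contract Y η) = -contract Y (contract X η) := by
  have h := LinearMap.congr_fun (contract_contract (R := R) (X + Y)) η
  have hX := LinearMap.congr_fun (contract_contract (R := R) X) η
  have hY := LinearMap.congr_fun (contract_contract (R := R) Y) η
  simp only [map_add, Module.End.mul_apply, LinearMap.add_apply, LinearMap.zero_apply] at h hX hY
  rw [hX, hY, zero_add, add_zero, add_comm] at h
  exact eq_neg_of_add_eq_zero_left h

variable [Algebra ℝ R]

theorem formEval_zero_wedge (a b : Form R L) :
    formEval 0 (wedge a b) ![] = formEval 0 a ![] * formEval 0 b ![] := by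
  induction a using form_induction with
  | h0 => simp [formEval_zero_right]
  | h2 a a' ha ha' => simp only [map_add, LinearMap.add_apply, formEval_add, ha, ha', add_mul]
  | h1 p a =>
    induction b using form_induction with
    | h0 => simp [formEval_zero_right]
    | h2 b b' hb hb' => simp only [map_add, formEval_add, hb, hb', mul_add]
    | h1 q b =>
      by_cases h : p + q = 0
      · obtain ⟨rfl, rfl⟩ : p = 0 ∧ q = 0 := by omega
        have := factorial_smul_formEval_wedge a b rfl ![]
        simp only [Nat.factorial_zero, mul_one, one_smul] at this
        rw [formEval_ofDeg_self, formEval_ofDeg_self]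
        refine Eq.trans this ?_
        have : Subsingleton (Equiv.Perm (Fin (0 + 0))) :=
          inferInstanceAs (Subsingleton (Equiv.Perm (Fin 0)))
        rw [Fintype.sum_subsingleton _ 1, Equiv.Perm.sign_one, one_smul]
        exact congrArg₂ (· * ·) (congrArg a (Subsingleton.elim _ _))
          (congrArg b (Subsingleton.elim _ _))
      · rw [formEval_wedge_ne _ _ h]
        rcases Nat.eq_zero_or_pos p with hp | hp
        · rw [formEval_ofDeg 0 q, dif_neg (by omega), mul_zero]
        · rw [formEval_ofDeg 0 p, dif_neg (by omega), zero_mul]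

/-- Insertions obey the same Leibniz rule on both sides, so induction along them replaces any
handling of shuffles of three blocks. -/
theorem wedge_assoc (a b c : Form R L) : wedge (wedge a b) c = wedge a (wedge b c) := by
  induction a, b, c using contract_induction₃ with
  | ha b c => simp
  | hb a c => simp
  | hc a b => simp
  | h a b c ha hb hc =>
    refine form_ext_contract (by simp only [formEval_zero_wedge, mul_assoc]) fun X => ?_
    simp only [contract_wedge, map_add, LinearMap.add_apply, ha, hb, hc, formSign_wedge, add_assoc]

theorem wedge_ofFun (f : R) (η : Form R L) : wedge (ofFun f) η = f • η := by
  induction η using contract_induction with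
  | h0 => simp
  | h η ih =>
    refine form_ext_contract ?_ fun X => ?_
    · rw [formEval_zero_wedge, formEval_ofFun, formEval_smul]
    · rw [contract_wedge, contract_ofFun, formSign_ofFun, ih]; simp

/-- Insertion exchanges the roles of the two Leibniz terms, and the sign (-1)^(pq) is reassembled
from lower degree: (p - 1)q + q = pq, and likewise in q. -/
theorem wedge_comm (p q : ℕ) (a : AltForm R L p) (b : AltForm R L q) :
    wedge (ofDeg p a) (ofDeg q b) = (-1 : R) ^ (p * q) • wedge (ofDeg q b) (ofDeg p a) := by
  induction hn : p + q using Nat.strong_induction_on generalizing p q with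
  | _ n ih =>
    refine form_ext_contract ?_ fun X => ?_
    · rw [formEval_smul, formEval_zero_wedge, formEval_zero_wedge]
      rcases p with _ | p
      · simp [mul_comm]
      · rw [formEval_ofDeg 0 (p + 1), dif_neg (by omega)]; simp
    · rw [map_smul, contract_wedge, contract_wedge, formSign_ofDeg, formSign_ofDeg,
        map_smul, map_smul, LinearMap.smul_apply, LinearMap.smul_apply, smul_add, add_comm]
      congr 1
      · cases q with
        | zero => simp
        | succ q =>
          rw [contract_succ_deg, ih (p + q) (by omega) p q _ _ rfl, smul_smul, mul_add, pow_add,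
            mul_one, mul_comm]
      · cases p with
        | zero => simp
        | succ p =>
          rw [contract_succ_deg, ih (p + q) (by omega) p q _ _ rfl, smul_smul, add_mul, pow_add,
            one_mul, mul_assoc, ← mul_pow]
          simp

/-- The operator `Σ ε^i ∧ i_{e_i}` is `q` times `h` in degree `q`, if `Σ ε^i ⊗ e_i` is `h` times
the identity. -/
theorem sum_wedge_contract {ι : Type*} (s : Finset ι) (ε : ι → Module.Dual R L) (e : ι → L) (h : R)
    (hh : ∀ v, ∑ i ∈ s, ε i v • e i = h • v) (q : ℕ) (η : AltForm R L q) :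
    ∑ i ∈ s, wedge (ofDual (ε i)) (contract (e i) (ofDeg q η)) = ((q : R) * h) • ofDeg q η := by
  induction q with
  | zero => simp
  | succ q ih =>
    refine form_ext_contract ?_ fun X => ?_
    · rw [formEval_smul, formEval_ofDeg 0 (q + 1), dif_neg (by omega), mul_zero]
      have : ∀ t : Finset ι, formEval 0 (∑ i ∈ t, wedge (ofDual (ε i))
          (contract (e i) (ofDeg (q + 1) η))) ![] = 0 := fun t => by
        classical
        induction t using Finset.induction_on with
        | empty => rfl
        | insert i t hi iht =>
          rw [Finset.sum_insert hi, formEval_add, iht, formEval_zero_wedge, formEval_zero_ofDual]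
          simp
      exact this s
    -- Inserting X into ε^i produces Σ ε^i(X) e_i = h X, which accounts for one extra h. In the
    -- other term i_X anticommutes past both factors and leaves the same operator on i_X η, of
    -- degree one less.
    · have h1 : ∀ i, contract X (wedge (ofDual (ε i)) (contract (e i) (ofDeg (q + 1) η)))
          = contract (ε i X • e i) (ofDeg (q + 1) η)
            + wedge (ofDual (ε i)) (contract (e i) (contract X (ofDeg (q + 1) η))) := fun i => by
        rw [contract_wedge, contract_ofDual, wedge_ofFun, formSign_ofDual, contract_anticomm X,
          map_smul]
        simp
      rw [map_sum]
      simp only [h1]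
      rw [Finset.sum_add_distrib, ← LinearMap.sum_apply, ← map_sum, hh, contract_succ_deg X, ih,
        ← contract_succ_deg X, map_smul, map_smul, LinearMap.smul_apply, ← add_smul]
      congr 1
      push_cast; ring

end FormCalculus

theorem map_vecCons_swap {R L : Type*} [CommRing R] [AddCommGroup L] [Module R L]
    {q : ℕ} (η : AltForm R L (q + 2)) (X Y : L) (u : Fin q → L) :
    η (Matrix.vecCons X (Matrix.vecCons Y u)) = -η (Matrix.vecCons Y (Matrix.vecCons X u)) := by
  have h := AlternatingMap.congr_fun (AlternatingMap.curryLeft_same η (X + Y)) u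
  have hX := AlternatingMap.congr_fun (AlternatingMap.curryLeft_same η X) u
  have hY := AlternatingMap.congr_fun (AlternatingMap.curryLeft_same η Y) u
  simp only [map_add, AlternatingMap.curryLeft_add, LinearMap.add_apply, AlternatingMap.add_apply,
    AlternatingMap.curryLeft_apply_apply, AlternatingMap.zero_apply] at h hX hY
  linear_combination h - hX - hY

theorem removeNth_succ_vecCons {T : Type*} {n : ℕ} (k : Fin (n + 1)) (x : T) (v : Fin (n + 1) → T) :
    k.succ.removeNth (α := fun _ => T) (Matrix.vecCons x v)
      = Matrix.vecCons x (k.removeNth (α := fun _ => T) v) := by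
  ext i
  refine Fin.cases ?_ (fun i => ?_) i <;> simp [Fin.removeNth]

/-! ### The Cartan calculus -/

namespace LieRinehart

variable {R L : Type*} [CommRing R] [Algebra ℝ R] [AddCommGroup L] [Module ℝ L]
    [Module R L] [IsScalarTower ℝ R L] (A : LieRinehart R L)

/-- The pairs k < l with k = 0 give the brackets of X with the v_j. In all other pairs X stays among
the arguments just behind the bracket, and moving it in front gives the minus sign. -/
theorem bracketSum_vecCons (q : ℕ) (η : AltForm R L (q + 1)) (X : L) (v : Fin (q + 1) → L) :
    A.bracketSum (q + 1) η (Matrix.vecCons X v)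
      = -A.bracketSum q (η.curryLeft X) v
        - ∑ j, η (Function.update v j (A.bracket X (v j))) := by
  have h0 : ∀ j : Fin (q + 1), (-1 : R) ^ ((0 : Fin (q + 1)) + (j + 1) : ℕ) *
      η (Matrix.vecCons (A.bracket X (v j)) (j.removeNth (α := fun _ => L) v))
        = -η (Function.update v j (A.bracket X (v j))) := fun j => by
    rw [← Fin.insertNth_removeNth, AlternatingMap.map_insertNth, zsmul_eq_mul]
    push_cast
    simp [pow_succ]
  rw [bracketSum, Fin.sum_univ_succ]
  have hI : Finset.Ici (0 : Fin (q + 1)) = Finset.univ := by ext; simp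
  have h1 : (∑ j ≥ (0 : Fin (q + 1)), (-1 : R) ^ ((0 : Fin (q + 1)) + (j + 1) : ℕ) *
      η (Matrix.vecCons (A.bracket (Matrix.vecCons X v (Fin.castSucc 0))
        (Matrix.vecCons X v j.succ)) (j.removeNth (α := fun _ => L)
          ((Fin.castSucc 0).removeNth (α := fun _ => L) (Matrix.vecCons X v)))))
        = - ∑ j, η (Function.update v j (A.bracket X (v j))) := by
    rw [hI, ← Finset.sum_neg_distrib]
    refine Finset.sum_congr rfl fun j _ => ?_
    rw [← h0]
    rfl
  rw [h1, add_comm, sub_eq_add_neg]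
  congr 1
  cases q with
  | zero => simp [bracketSum]
  | succ q =>
    rw [bracketSum, ← Finset.sum_neg_distrib]
    refine Finset.sum_congr rfl fun i _ => ?_
    rw [← Fin.map_succEmb_Ici, Finset.sum_map, ← Finset.sum_neg_distrib]
    refine Finset.sum_congr rfl fun j _ => ?_
    rw [Fin.coe_succEmb, ← Fin.succ_castSucc, removeNth_succ_vecCons, removeNth_succ_vecCons,
      Matrix.cons_val_succ, Matrix.cons_val_succ, map_vecCons_swap,
      AlternatingMap.curryLeft_apply_apply, Fin.val_succ, Fin.val_succ]
    ring

/-- Cartan's formula on values: each term of dη that keeps X as an argument of η cancels against a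
term of d i_X η, and only those where X acts through the anchor or the bracket survive. -/
theorem dVal_vecCons (q : ℕ) (η : AltForm R L (q + 1)) (X : L) (v : Fin (q + 1) → L) :
    A.dVal (q + 1) η (Matrix.vecCons X v) + A.dVal q (η.curryLeft X) v
      = A.anchor X (η v) - ∑ j, η (Function.update v j (A.bracket X (v j))) := by
  rw [dVal, dVal, bracketSum_vecCons, Fin.sum_univ_succ]
  have h1 : ∀ k : Fin (q + 1), (-1 : R) ^ (k.succ : ℕ) * A.anchor (Matrix.vecCons X v k.succ)
      (η (k.succ.removeNth (α := fun _ => L) (Matrix.vecCons X v)))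
      = - ((-1 : R) ^ (k : ℕ) * A.anchor (v k) (η.curryLeft X (k.removeNth (α := fun _ => L) v))) :=
    fun k => by
      rw [removeNth_succ_vecCons, Fin.val_succ, pow_succ, AlternatingMap.curryLeft_apply_apply,
        Matrix.cons_val_succ]
      ring
  rw [Finset.sum_congr rfl fun k _ => h1 k, Finset.sum_neg_distrib]
  have h2 : (0 : Fin (q + 2)).removeNth (α := fun _ => L) (Matrix.vecCons X v) = v := by
    ext i; simp [Fin.removeNth]
  rw [h2, Fin.val_zero, pow_zero, one_mul, Matrix.cons_val_zero]
  ring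

theorem lieForm_apply (X : L) (η : Form R L) :
    A.lieForm X η = contract X (A.d η) + A.d (contract X η) := by
  simp [lieForm, intProdReal, intProd]

/-- This is the last use of the explicit formula for the differential in positive degree: it yields
the commutator of ℒ_X with insertions, and the other Cartan relations then follow by induction. -/
theorem formEval_lieForm (n : ℕ) (X : L) (η : Form R L) (v : Fin n → L) :
    formEval n (A.lieForm X η) v
      = A.anchor X (formEval n η v)
        - ∑ j, formEval n η (Function.update v j (A.bracket X (v j))) := by
  induction η using form_induction with
  | h0 => simp [formEval_zero_right]
  | h2 η θ hη hθ =>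
    simp only [map_add, formEval_add, hη, hθ, Finset.sum_add_distrib]
    ring
  | h1 q η =>
    by_cases h : q = n
    · subst h
      simp only [formEval_ofDeg_self]
      rw [lieForm_apply, formEval_add, d_ofDeg, contract_succ_deg, formEval_ofDeg_self,
        AlternatingMap.curryLeft_apply_apply, dDeg_apply]
      cases q with
      | zero =>
        rw [contract_zero_deg, map_zero, formEval_zero_right, dVal, bracketSum]
        simp [Subsingleton.elim _ v]
      | succ q =>
        rw [contract_succ_deg, d_ofDeg, formEval_ofDeg_self, dDeg_apply, dVal_vecCons]
    · rw [lieForm_apply, formEval_add, d_ofDeg, contract_succ_deg]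
      simp only [formEval_ofDeg, dif_neg h]
      cases q with
      | zero => simp [formEval_zero_right]
      | succ q => rw [contract_succ_deg, d_ofDeg, formEval_ofDeg, dif_neg h]; simp

theorem contract_d (X : L) (η : Form R L) :
    contract X (A.d η) = A.lieForm X η - A.d (contract X η) := by
  rw [lieForm_apply, add_sub_cancel_right]

theorem formEval_zero_d (η : Form R L) : formEval 0 (A.d η) ![] = 0 := by
  induction η using form_induction with
  | h0 => simp [formEval_zero_right]
  | h2 η θ hη hθ => rw [map_add, formEval_add, hη, hθ, add_zero]
  | h1 q η => rw [d_ofDeg, formEval_ofDeg, dif_neg (by omega)]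

theorem formEval_zero_lieForm (X : L) (η : Form R L) :
    formEval 0 (A.lieForm X η) ![] = A.anchor X (formEval 0 η ![]) := by
  simp [formEval_lieForm]

theorem contract_lieForm (X Y : L) (η : Form R L) :
    contract Y (A.lieForm X η) = A.lieForm X (contract Y η) - contract (A.bracket X Y) η := by
  refine form_ext_eval fun n v => ?_
  rw [sub_eq_add_neg, formEval_add, ← neg_one_smul R, formEval_smul]
  simp only [formEval_contract, formEval_lieForm]
  -- The summand of index 0 brackets X with Y and is the term i_{[X,Y]} η.
  rw [Fin.sum_univ_succ]
  simp only [Matrix.cons_val_succ, Matrix.cons_val_zero]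
  have h1 : ∀ y, Function.update (Matrix.vecCons Y v) 0 y = Matrix.vecCons y v := fun y =>
    Fin.update_cons_zero (α := fun _ => L) Y v y
  have h2 : ∀ j y, Function.update (Matrix.vecCons Y v) (Fin.succ j) y
      = Matrix.vecCons Y (Function.update v j y) := fun j y =>
    (Fin.cons_update (α := fun _ => L) Y v j y).symm
  simp only [h1, h2]
  ring

theorem lieForm_formSign (X : L) (η : Form R L) :
    A.lieForm X (formSign η) = formSign (A.lieForm X η) := by
  refine form_ext_eval fun n v => ?_
  have h : ∀ x : R, A.anchor X ((-1 : R) ^ n * x) = (-1 : R) ^ n * A.anchor X x := fun x => by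
    rcases neg_one_pow_eq_or R n with h | h <;> simp [h]
  simp only [formEval_lieForm, formEval_formSign, h, ← Finset.mul_sum]
  ring

theorem lieForm_wedge (X : L) (a b : Form R L) :
    A.lieForm X (wedge a b) = wedge (A.lieForm X a) b + wedge a (A.lieForm X b) := by
  induction a, b using contract_induction₂ with
  | ha b => simp
  | hb a => simp
  | h a b ha hb =>
    refine form_ext_contract ?_ fun Y => ?_
    · simp only [formEval_add, formEval_zero_lieForm, formEval_zero_wedge, Derivation.leibniz,
        smul_eq_mul]
      ring
    · simp only [contract_lieForm, contract_wedge, map_add, ha, hb, map_sub, LinearMap.sub_apply,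
        lieForm_formSign]
      abel

theorem d_formSign (η : Form R L) : A.d (formSign η) = -formSign (A.d η) := by
  induction η using form_induction with
  | h0 => simp
  | h2 η θ hη hθ => simp only [map_add, hη, hθ, neg_add]
  | h1 q η =>
    have h : ∀ ζ : Form R L, A.d ((-1 : R) ^ q • ζ) = (-1 : R) ^ q • A.d ζ := fun ζ => by
      rcases neg_one_pow_eq_or R q with h | h <;> simp [h]
    rw [formSign_ofDeg, h, d_ofDeg, formSign_ofDeg, pow_succ]
    simp

/-- Insertion trades d for ℒ_X, already known to be a derivation, and for d on products of lower
degree. -/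
theorem d_wedge (a b : Form R L) :
    A.d (wedge a b) = wedge (A.d a) b + wedge (formSign a) (A.d b) := by
  induction a, b using contract_induction₂ with
  | ha b => simp
  | hb a => simp
  | h a b ha hb =>
    refine form_ext_contract ?_ fun X => ?_
    · simp only [formEval_add, formEval_zero_wedge, formEval_zero_d]
      ring
    · simp only [contract_d, contract_wedge, map_add, ha, hb, map_sub, LinearMap.sub_apply,
        lieForm_wedge, formSign_formSign, contract_formSign, d_formSign, map_neg,
        LinearMap.neg_apply]
      abel

/-- On functions this is the compatibility of the anchor with brackets; under an insertion i_Z the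
defect is the Jacobi identity for X, Y, Z. -/
theorem lieForm_lieForm (X Y : L) (η : Form R L) :
    A.lieForm X (A.lieForm Y η)
      = A.lieForm Y (A.lieForm X η) + A.lieForm (A.bracket X Y) η := by
  induction η using contract_induction with
  | h0 => simp
  | h η ih =>
    refine form_ext_contract ?_ fun Z => ?_
    · simp only [formEval_add, formEval_zero_lieForm, A.anchor_bracket]
      ring
    · simp only [contract_lieForm, map_add, map_sub, ih, A.jacobi X Y Z, LinearMap.add_apply]
      abel

theorem lieForm_d (X : L) (η : Form R L) : A.lieForm X (A.d η) = A.d (A.lieForm X η) := by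
  induction η using contract_induction with
  | h0 => simp
  | h η ih =>
    refine form_ext_contract ?_ fun Y => ?_
    · simp only [formEval_zero_lieForm, formEval_zero_d, map_zero]
    · simp only [contract_lieForm, contract_d, map_sub, ih, lieForm_lieForm A X Y]
      abel

/-- Since ℒ_X commutes with d, one gets i_X d d = d d i_X, and the degree drops to where nothing is
left. -/
theorem d_d (η : Form R L) : A.d (A.d η) = 0 := by
  induction η using contract_induction with
  | h0 => simp
  | h η ih =>
    refine form_ext_contract (A.formEval_zero_d _) fun X => ?_
    simp only [contract_d, map_sub, ih, lieForm_d, sub_zero, sub_self, map_zero]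

end LieRinehart

/-! ### Bivectors as skew-symmetric tensors -/

section Bivector

variable {R L : Type*} [CommRing R] [AddCommGroup L] [Module R L]

instance : HasDistribNeg (Module.End R (Form R L)) where
  neg T := -T
  neg_neg T := neg_neg T
  neg_mul T T' := LinearMap.neg_comp T' T
  mul_neg T T' := LinearMap.comp_neg T' T


theorem comm_toTensor (π : ⋀[R]^2 L) : TensorProduct.comm R L L (toTensor π) = -toTensor π := by
  have h : (TensorProduct.comm R L L).toLinearMap ∘ₗ toTensor = -toTensor (R := R) (L := L) := by
    refine exteriorPower.linearMap_ext (AlternatingMap.ext fun v => ?_)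
    simp [toTensor]
  exact LinearMap.congr_fun h π

/-- `toTensor` antisymmetrizes without a factor 1/2, so multiplying its legs counts the bivector
twice. The factors 2 in the formulas for i_π, ∂_π and ψ⁽²⁾ begin here. -/
theorem mul_toTensor (π : ⋀[R]^2 L) :
    (LinearMap.mul' R (ExteriorAlgebra R L) ∘ₗ
      TensorProduct.map (ExteriorAlgebra.ι R) (ExteriorAlgebra.ι R)) (toTensor π)
      = (2 : R) • (π : ExteriorAlgebra R L) := by
  have h : (LinearMap.mul' R (ExteriorAlgebra R L) ∘ₗ
      TensorProduct.map (ExteriorAlgebra.ι R) (ExteriorAlgebra.ι R)) ∘ₗ toTensor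
      = (2 : R) • (⋀[R]^2 L).subtype := by
    refine exteriorPower.linearMap_ext (AlternatingMap.ext fun v => ?_)
    have h2 := ExteriorAlgebra.ι_add_mul_swap (R := R) (v 0) (v 1)
    simp only [toTensor, LinearMap.compAlternatingMap_apply, LinearMap.comp_apply,
      exteriorPower.alternatingMapLinearEquiv_apply_ιMulti, AlternatingMap.coe_mk,
      MultilinearMap.coe_mk, map_sub, TensorProduct.map_tmul, LinearMap.mul'_apply,
      LinearMap.smul_apply, Submodule.subtype_apply, exteriorPower.ιMulti_apply_coe,
      ExteriorAlgebra.ιMulti_apply]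
    rw [eq_neg_of_add_eq_zero_right h2, two_smul, sub_neg_eq_add]
    simp [List.ofFn_succ]
  exact LinearMap.congr_fun h π

theorem exists_toTensor_eq (π : ⋀[R]^2 L) :
    ∃ S : Finset (L × L), toTensor π = ∑ a ∈ S, a.1 ⊗ₜ[R] a.2 :=
  TensorProduct.exists_finset _

variable {π : ⋀[R]^2 L} {S : Finset (L × L)}

/-- The pairs in S need not be skew one by one; only the whole sum is. Any bilinear expression
summed over S therefore changes sign when the legs are exchanged. -/
theorem sum_skew (hS : toTensor π = ∑ a ∈ S, a.1 ⊗ₜ[R] a.2) {N : Type*} [AddCommGroup N]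
    [Module R N] (B : L →ₗ[R] L →ₗ[R] N) :
    ∑ a ∈ S, B a.2 a.1 = -∑ a ∈ S, B a.1 a.2 := by
  have h := congrArg (TensorProduct.lift B) (comm_toTensor π)
  rw [hS] at h
  simpa using h

theorem sum_skew_of_bilinear (hS : toTensor π = ∑ a ∈ S, a.1 ⊗ₜ[R] a.2) {N : Type*}
    [AddCommGroup N] [Module R N] (B : L → L → N)
    (h1 : ∀ X X' Y, B (X + X') Y = B X Y + B X' Y) (h2 : ∀ (c : R) X Y, B (c • X) Y = c • B X Y)
    (h3 : ∀ X Y Y', B X (Y + Y') = B X Y + B X Y') (h4 : ∀ (c : R) X Y, B X (c • Y) = c • B X Y) :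
    ∑ a ∈ S, B a.2 a.1 = -∑ a ∈ S, B a.1 a.2 :=
  sum_skew hS (LinearMap.mk₂ R B h1 h2 h3 h4)

theorem sharp_eq_sum (hS : toTensor π = ∑ a ∈ S, a.1 ⊗ₜ[R] a.2) (ξ : Module.Dual R L) :
    sharp π ξ = ∑ a ∈ S, ξ a.1 • a.2 := by
  change TensorProduct.lid R L (LinearMap.rTensor L ξ (toTensor π)) = _
  rw [hS]
  simp

theorem two_smul_bivector (hS : toTensor π = ∑ a ∈ S, a.1 ⊗ₜ[R] a.2) :
    (2 : R) • (π : ExteriorAlgebra R L)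
      = ∑ a ∈ S, ExteriorAlgebra.ι R a.1 * ExteriorAlgebra.ι R a.2 := by
  rw [← mul_toTensor, hS]
  simp

theorem intProd_ι (X : L) : intProd (ExteriorAlgebra.ι R X) = contract X :=
  ExteriorAlgebra.lift_ι_apply R _ _ X

theorem two_smul_intProd (hS : toTensor π = ∑ a ∈ S, a.1 ⊗ₜ[R] a.2) :
    (2 : R) • intProd (π : ExteriorAlgebra R L) = ∑ a ∈ S, contract a.1 * contract a.2 := by
  rw [← map_smul, two_smul_bivector hS]
  simp [intProd_ι]

theorem contract_mul_anticomm (X Y : L) :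
    contract (R := R) X * contract Y = -(contract Y * contract X) :=
  LinearMap.ext fun η => contract_anticomm X Y η

variable [Algebra ℝ R]

theorem real_smul_cancel {c : ℝ} (hc : c ≠ 0) {N : Type*} [AddCommGroup N] [Module R N]
    {x y : N} (h : algebraMap ℝ R c • x = algebraMap ℝ R c • y) : x = y := by
  have := congrArg (fun z => algebraMap ℝ R c⁻¹ • z) h
  simpa [smul_smul, ← map_mul, inv_mul_cancel₀ hc] using this

theorem two_smul_cancel {N : Type*} [AddCommGroup N] [Module R N]
    {x y : N} (h : (2 : R) • x = (2 : R) • y) : x = y :=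
  real_smul_cancel (R := R) (c := 2) two_ne_zero (by rwa [map_ofNat])

theorem half_add_half : algebraMap ℝ R (1 / 2) * 2 = 1 := by
  rw [← map_ofNat (algebraMap ℝ R) 2, ← map_mul]
  norm_num

theorem two_mul_half : 2 * algebraMap ℝ R (1 / 2) = 1 := by rw [mul_comm, half_add_half]

theorem involute_bivector (π : ⋀[R]^2 L) :
    CliffordAlgebra.involute (π : ExteriorAlgebra R L) = (π : ExteriorAlgebra R L) := by
  obtain ⟨S, hS⟩ := exists_toTensor_eq π
  have hι : ∀ v : L, CliffordAlgebra.involute (ExteriorAlgebra.ι R v) = -ExteriorAlgebra.ι R v :=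
    fun v => CliffordAlgebra.involute_ι v
  refine two_smul_cancel (R := R) ?_
  rw [← map_smul, two_smul_bivector hS, map_sum]
  simp [hι]

/-! ### Commutators with the interior product by a bivector -/

theorem wedge_real_smul (c : R) (ζ : Form R L) : wedge (c • ζ) = c • wedge ζ := map_smul _ _ _

theorem contract_mul_wedge (X : L) (ζ : Form R L) :
    contract X * wedge ζ = wedge (contract X ζ) + wedge (formSign ζ) * contract X :=
  LinearMap.ext fun η => contract_wedge X ζ η

theorem contract_mul_contract_mul_wedge (X Y : L) (ζ : Form R L) :
    contract X * contract Y * wedge ζ = wedge (contract X (contract Y ζ))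
      + wedge (formSign (contract Y ζ)) * contract X
      - wedge (formSign (contract X ζ)) * contract Y + wedge ζ * (contract X * contract Y) := by
  rw [mul_assoc, contract_mul_wedge, mul_add, ← mul_assoc, contract_mul_wedge, contract_mul_wedge,
    formSign_formSign, contract_formSign, map_neg, add_mul, neg_mul, mul_assoc]
  abel

/-- The commutator `[T, i_π]`. -/
def adPi (π : ⋀[R]^2 L) (T : Module.End R (Form R L)) : Module.End R (Form R L) :=
  T * intProd (π : ExteriorAlgebra R L) - intProd (π : ExteriorAlgebra R L) * T

/-- i_π is an operator of order two, so its commutator with a multiplication is a multiplication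
plus a first-order term. The two cross terms of i_X i_Y agree by skew-symmetry, which removes the
factor 1/2 from the sum. -/
theorem adPi_wedge (hS : toTensor π = ∑ a ∈ S, a.1 ⊗ₜ[R] a.2) (ζ : Form R L) :
    adPi π (wedge ζ) = -wedge (intProd (π : ExteriorAlgebra R L) ζ)
      + ∑ a ∈ S, wedge (formSign (contract a.1 ζ)) * contract a.2 := by
  have hB := sum_skew_of_bilinear hS (fun X Y => wedge (formSign (contract X ζ)) * contract Y)
    (fun X X' Y => by simp [add_mul]) (fun c X Y => by simp)
    (fun X Y Y' => by simp [mul_add]) (fun c X Y => by simp)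
  refine two_smul_cancel (R := R) ?_
  rw [adPi, smul_sub, ← mul_smul_comm, ← smul_mul_assoc, two_smul_intProd hS, smul_add, smul_neg,
    ← wedge_real_smul, ← LinearMap.smul_apply, two_smul_intProd hS, Finset.sum_mul]
  simp only [contract_mul_contract_mul_wedge, Finset.sum_add_distrib, Finset.sum_sub_distrib,
    hB, Finset.mul_sum, LinearMap.sum_apply, map_sum, Module.End.mul_apply, two_smul]
  abel

theorem intProd_ofDual (π : ⋀[R]^2 L) (ξ : Module.Dual R L) :
    intProd (π : ExteriorAlgebra R L) (ofDual ξ) = 0 := by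
  obtain ⟨S, hS⟩ := exists_toTensor_eq π
  refine two_smul_cancel (R := R) ?_
  rw [← LinearMap.smul_apply, two_smul_intProd hS]
  simp [contract_ofDual, contract_ofFun]

theorem wedge_ofFun_mul (f : R) (T : Module.End R (Form R L)) : wedge (ofFun f) * T = f • T :=
  LinearMap.ext fun η => wedge_ofFun f (T η)

/-- i_π annihilates a linear form, so only the first-order term Σ ξ(a₁) i_{a₂} remains. Repeated use
of this rule replaces factors ξ∧ by insertions of π♯ξ. -/
theorem adPi_wedge_ofDual (π : ⋀[R]^2 L) (ξ : Module.Dual R L) :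
    adPi π (wedge (ofDual ξ)) = contract (sharp π ξ) := by
  obtain ⟨S, hS⟩ := exists_toTensor_eq π
  rw [adPi_wedge hS, intProd_ofDual, map_zero, neg_zero, zero_add, sharp_eq_sum hS, map_sum]
  refine Finset.sum_congr rfl fun a _ => ?_
  rw [contract_ofDual, formSign_ofFun, wedge_ofFun_mul, map_smul]

theorem intProd_mul_contract (π : ⋀[R]^2 L) (X : L) :
    intProd (π : ExteriorAlgebra R L) * contract X = contract X * intProd (π : ExteriorAlgebra R L)
    := by
  obtain ⟨S, hS⟩ := exists_toTensor_eq π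
  refine two_smul_cancel (R := R) ?_
  rw [← smul_mul_assoc, ← mul_smul_comm, two_smul_intProd hS, Finset.sum_mul, Finset.mul_sum]
  refine Finset.sum_congr rfl fun a _ => ?_
  rw [mul_assoc, contract_mul_anticomm a.2 X, mul_neg, ← mul_assoc, contract_mul_anticomm a.1 X,
    neg_mul, neg_neg, mul_assoc]

/-- Insertions commute with i_π, so in the iterated commutators only the exterior factor on the left
changes. -/
theorem adPi_mul_contract (π : ⋀[R]^2 L) (T : Module.End R (Form R L)) (X : L) :
    adPi π (T * contract X) = adPi π T * contract X := by
  rw [adPi, adPi, sub_mul, mul_assoc, ← intProd_mul_contract, mul_assoc, mul_assoc]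

theorem adPi_contract (π : ⋀[R]^2 L) (X : L) : adPi π (contract X) = 0 := by
  rw [adPi, intProd_mul_contract, sub_self]

theorem adPi_add (π : ⋀[R]^2 L) (T T' : Module.End R (Form R L)) :
    adPi π (T + T') = adPi π T + adPi π T' := by
  simp only [adPi, add_mul, mul_add]; abel

theorem adPi_sum (π : ⋀[R]^2 L) {ι : Type*} (s : Finset ι) (T : ι → Module.End R (Form R L)) :
    adPi π (∑ i ∈ s, T i) = ∑ i ∈ s, adPi π (T i) := by
  simp only [adPi, Finset.sum_mul, Finset.mul_sum, Finset.sum_sub_distrib]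

/-! ### Iterated commutators of ψ∧ with i_π -/

theorem contract_contract_ofDeg_three (ψ : AltForm R L 3) (X Y : L) :
    contract Y (contract X (ofDeg 3 ψ)) = ofDual (form3 ψ X Y) := by
  rw [contract_succ_deg, contract_succ_deg]
  exact congrArg (ofDeg 1) ((AlternatingMap.ofSubsingleton R L R (0 : Fin 1)).apply_symm_apply _).symm

theorem pairBivector_eq_sum (hS : toTensor π = ∑ a ∈ S, a.1 ⊗ₜ[R] a.2) (ψ : AltForm R L 3) :
    pairBivector π ψ = algebraMap ℝ R (1 / 2) • ∑ a ∈ S, form3 ψ a.1 a.2 := by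
  rw [pairBivector, hS]
  simp

theorem intProd_ofDeg_three (π : ⋀[R]^2 L) (ψ : AltForm R L 3) :
    intProd (π : ExteriorAlgebra R L) (ofDeg 3 ψ) = -ofDual (pairBivector π ψ) := by
  obtain ⟨S, hS⟩ := exists_toTensor_eq π
  refine two_smul_cancel (R := R) ?_
  rw [← LinearMap.smul_apply, two_smul_intProd hS, pairBivector_eq_sum hS, map_smul, smul_neg,
    smul_smul, two_mul_half, one_smul, map_sum, ← neg_eq_iff_eq_neg, LinearMap.sum_apply,
    ← Finset.sum_neg_distrib]
  refine Finset.sum_congr rfl fun a _ => ?_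
  rw [Module.End.mul_apply, contract_anticomm, contract_contract_ofDeg_three, neg_neg]

theorem intProd_contract_ofDeg_three (π : ⋀[R]^2 L) (ψ : AltForm R L 3) (X : L) :
    intProd (π : ExteriorAlgebra R L) (contract X (ofDeg 3 ψ)) = -ofFun (pairBivector π ψ X) := by
  have h := LinearMap.congr_fun (intProd_mul_contract π X) (ofDeg 3 ψ)
  rw [Module.End.mul_apply, Module.End.mul_apply] at h
  rw [h, intProd_ofDeg_three, map_neg, contract_ofDual]

theorem formSign_contract_ofDeg_three (ψ : AltForm R L 3) (X : L) :
    formSign (contract X (ofDeg 3 ψ)) = contract X (ofDeg 3 ψ) := by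
  rw [contract_succ_deg, formSign_ofDeg]
  simp

theorem adPi_wedge_three (hS : toTensor π = ∑ a ∈ S, a.1 ⊗ₜ[R] a.2) (ψ : AltForm R L 3) :
    adPi π (wedge (ofDeg 3 ψ)) = wedge (ofDual (pairBivector π ψ))
      + ∑ a ∈ S, wedge (contract a.1 (ofDeg 3 ψ)) * contract a.2 := by
  rw [adPi_wedge hS, intProd_ofDeg_three, map_neg, neg_neg]
  simp only [formSign_contract_ofDeg_three]

theorem adPi_wedge_contract_three (hS : toTensor π = ∑ a ∈ S, a.1 ⊗ₜ[R] a.2) (ψ : AltForm R L 3)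
    (X : L) :
    adPi π (wedge (contract X (ofDeg 3 ψ))) = wedge (ofFun (pairBivector π ψ X))
      - ∑ a ∈ S, wedge (ofDual (form3 ψ X a.1)) * contract a.2 := by
  rw [adPi_wedge hS, intProd_contract_ofDeg_three, map_neg, neg_neg, sub_eq_add_neg,
    ← Finset.sum_neg_distrib]
  simp only [contract_contract_ofDeg_three, formSign_ofDual, map_neg, neg_mul]

/-- `psiTwo` feeds the second legs of the two copies of π to ψ and multiplies the first legs.
Exchanging the legs in both copies costs two signs, which cancel, and gives the shape that the
double commutator produces. -/
theorem two_smul_intProdDual_psiTwo (hS : toTensor π = ∑ a ∈ S, a.1 ⊗ₜ[R] a.2)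
    (ψ : AltForm R L 3) :
    (2 : R) • intProdDual (psiTwo π ψ) = ∑ a ∈ S, ∑ b ∈ S,
      wedge (ofDual (form3 ψ a.1 b.1)) * (contract a.2 * contract b.2) := by
  rw [psiTwo, map_smul, smul_smul, two_mul_half, one_smul, hS]
  simp only [TensorProduct.sum_tmul]
  simp only [TensorProduct.tmul_sum, map_sum, TensorProduct.tensorTensorTensorComm_tmul, TensorProduct.map_tmul, TensorProduct.comm_tmul,
    LinearMap.comp_apply, LinearMap.mul'_apply, TensorProduct.lift.tmul, intProdDual,
    LinearMap.mk₂_apply, map_mul, intProd_ι]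
  have h1 := fun b : L × L => sum_skew_of_bilinear hS
    (fun X Y => wedge (ofDual (form3 ψ X b.2)) * (contract Y * contract b.1))
    (fun X X' Y => by simp only [map_add, LinearMap.add_apply, add_mul])
    (fun c X Y => by simp only [map_smul, LinearMap.smul_apply, smul_mul_assoc])
    (fun X Y Y' => by simp only [map_add, mul_add, add_mul])
    (fun c X Y => by simp only [map_smul, smul_mul_assoc, mul_smul_comm])
  have h2 := fun a : L × L => sum_skew_of_bilinear hS
    (fun X Y => wedge (ofDual (form3 ψ a.1 X)) * (contract a.2 * contract Y))
    (fun X X' Y => by simp only [map_add, add_mul])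
    (fun c X Y => by simp only [map_smul, smul_mul_assoc])
    (fun X Y Y' => by simp only [map_add, mul_add])
    (fun c X Y => by simp only [map_smul, mul_smul_comm])
  refine Finset.sum_comm.trans ((Finset.sum_congr rfl fun b _ => h1 b).trans ?_)
  rw [Finset.sum_neg_distrib, Finset.sum_comm, Finset.sum_congr rfl fun a _ => h2 a,
    Finset.sum_neg_distrib, neg_neg]

/-- The term i_Y arises twice: from the commutator of ψ(π, ·)∧ with i_π, and from the multiplication
part ψ(π, a₁) of the commutator of (i_{a₁}ψ)∧, summed against i_{a₂}. The section Y is thus forced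
by the conjugation. -/
theorem adPi_adPi_wedge_three (π : ⋀[R]^2 L) (ψ : AltForm R L 3) :
    adPi π (adPi π (wedge (ofDeg 3 ψ)))
      = (2 : R) • (intProdDual (psiTwo π ψ) + contract (sectionY π ψ)) := by
  obtain ⟨S, hS⟩ := exists_toTensor_eq π
  rw [adPi_wedge_three hS, adPi_add, adPi_sum, adPi_wedge_ofDual, smul_add,
    two_smul_intProdDual_psiTwo hS]
  have h1 : ∀ a : L × L, adPi π (wedge (contract a.1 (ofDeg 3 ψ)) * contract a.2)
      = contract (pairBivector π ψ a.1 • a.2)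
        + ∑ b ∈ S, wedge (ofDual (form3 ψ a.1 b.1)) * (contract a.2 * contract b.2) := fun a => by
    rw [adPi_mul_contract, adPi_wedge_contract_three hS, sub_mul, wedge_ofFun_mul, map_smul,
      sub_eq_add_neg, Finset.sum_mul, ← Finset.sum_neg_distrib]
    congr 1
    refine Finset.sum_congr rfl fun b _ => ?_
    rw [mul_assoc, contract_mul_anticomm a.2, mul_neg]
  rw [Finset.sum_congr rfl fun a _ => h1 a, Finset.sum_add_distrib, ← map_sum, ← sharp_eq_sum hS,
    sectionY, two_smul]
  abel

theorem six_smul_intProd_sharpThree (hS : toTensor π = ∑ a ∈ S, a.1 ⊗ₜ[R] a.2)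
    (ψ : AltForm R L 3) :
    algebraMap ℝ R 6 • intProd (sharpThree π ψ) = ∑ a ∈ S, ∑ b ∈ S, ∑ c ∈ S,
      form3 ψ a.1 b.1 c.1 • (contract a.2 * (contract b.2 * contract c.2)) := by
  rw [sharpThree, map_smul, smul_smul, ← map_mul, show (6 : ℝ) * (1 / 6) = 1 by norm_num, map_one,
    one_smul, hS]
  simp only [TensorProduct.sum_tmul]
  simp only [TensorProduct.tmul_sum, map_sum, TensorProduct.tensorTensorTensorComm_tmul, TensorProduct.map_tmul, 
    LinearMap.comp_apply, LinearMap.mul'_apply, TensorProduct.lift.tmul,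
    map_mul, intProd_ι, TensorProduct.lid_tmul, map_smul]
  rfl

/-- The third commutator turns the last factor ψ(a₁, b₁, ·)∧ into the insertion of its image under
π♯, so all three slots of ψ now go through π♯. Moving that insertion to the right passes two others,
without a net sign. -/
theorem adPi_adPi_adPi_wedge_three (π : ⋀[R]^2 L) (ψ : AltForm R L 3) :
    adPi π (adPi π (adPi π (wedge (ofDeg 3 ψ))))
      = algebraMap ℝ R 6 • intProd (sharpThree π ψ) := by
  obtain ⟨S, hS⟩ := exists_toTensor_eq π
  rw [six_smul_intProd_sharpThree hS, adPi_adPi_wedge_three, smul_add,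
    two_smul_intProdDual_psiTwo hS, adPi_add, ← map_smul contract, adPi_contract, add_zero,
    adPi_sum]
  refine Finset.sum_congr rfl fun a _ => ?_
  rw [adPi_sum]
  refine Finset.sum_congr rfl fun b _ => ?_
  rw [← mul_assoc, adPi_mul_contract, adPi_mul_contract, adPi_wedge_ofDual, sharp_eq_sum hS,
    map_sum, Finset.sum_mul, Finset.sum_mul]
  refine Finset.sum_congr rfl fun c _ => ?_
  rw [map_smul, smul_mul_assoc, smul_mul_assoc, contract_mul_anticomm c.2, neg_mul, mul_assoc,
    contract_mul_anticomm c.2, mul_neg, neg_neg]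

/-- Only insertions are left, and they commute with i_π; the expansion of the conjugate of ψ∧ stops
here. -/
theorem adPi_intProd_sharpThree (π : ⋀[R]^2 L) (ψ : AltForm R L 3) :
    adPi π (algebraMap ℝ R 6 • intProd (sharpThree π ψ)) = 0 := by
  obtain ⟨S, hS⟩ := exists_toTensor_eq π
  rw [six_smul_intProd_sharpThree hS]
  simp only [adPi_sum]
  refine Finset.sum_eq_zero fun a _ => Finset.sum_eq_zero fun b _ => Finset.sum_eq_zero fun c _ => ?_
  rw [← smul_mul_assoc, ← mul_assoc, adPi_mul_contract, adPi_mul_contract, ← map_smul,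
    adPi_contract, zero_mul, zero_mul]

end Bivector

/-! ### The square of the generator -/

/-- If `D + e` is a differential and `p` is such that the component of order three of
`exp (-p) (D + e) exp p` vanishes, then the component of order one plus two has square zero. -/
theorem sq_eq_zero_of_commutators {E : Type*} [Ring E] [Algebra ℝ E] {D e p d₁ d₂ e₁ e₂ e₃ : E}
    (hD : D * D = 0) (hDe : D * e + e * D = 0) (he : e * e = 0)
    (hd₁ : d₁ = D * p - p * D) (hd₂ : d₂ = d₁ * p - p * d₁)
    (he₁ : e₁ = e * p - p * e) (he₂ : e₂ = e₁ * p - p * e₁) (he₃ : e₃ = e₂ * p - p * e₂)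
    (he₄ : e₃ * p - p * e₃ = 0) (h : e₃ = -(3 : ℝ) • d₂) :
    (d₁ + (1 / 2 : ℝ) • e₂) * (d₁ + (1 / 2 : ℝ) • e₂) = 0 := by
  -- e₃ commutes with p and is a nonzero multiple of d₂.
  have hd₃ : d₂ * p - p * d₂ = 0 := by
    have : -(3 : ℝ) • (d₂ * p - p * d₂) = 0 := by
      rw [smul_sub, ← smul_mul_assoc, ← mul_smul_comm, ← h, he₄]
    exact (smul_eq_zero.mp this).resolve_left (by norm_num)
  -- Commutation with p is a derivation. It is applied twice to D² = 0, three times to De + eD = 0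
  -- and four times to e² = 0: with D, e, p of degrees 1, 3, -2, these are the consequences in
  -- degree -2, the degree of the square to be computed.
  have ad : ∀ x y : E, x * y * p - p * (x * y) = (x * p - p * x) * y + x * (y * p - p * y) :=
    fun x y => by noncomm_ring
  have ad0 : ∀ x : E, x = 0 → x * p - p * x = 0 := fun x hx => by rw [hx]; simp
  have ad_add : ∀ x y : E, (x + y) * p - p * (x + y) = (x * p - p * x) + (y * p - p * y) :=
    fun x y => by noncomm_ring
  have a1 := ad0 _ hD
  rw [ad, ← hd₁] at a1
  have a2 := ad0 _ a1
  rw [ad_add, ad, ad, ← hd₁, ← hd₂] at a2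
  have b1 := ad0 _ hDe
  rw [ad_add, ad, ad, ← hd₁, ← he₁] at b1
  have b2 := ad0 _ b1
  simp only [ad_add, ad, ← hd₁, ← he₁, ← hd₂, ← he₂] at b2
  have b3 := ad0 _ b2
  simp only [ad_add, ad, ← hd₁, ← he₁, ← hd₂, ← he₂, ← he₃, hd₃, zero_mul, mul_zero] at b3
  have c1 := ad0 _ he
  rw [ad, ← he₁] at c1
  have c2 := ad0 _ c1
  simp only [ad_add, ad, ← he₁, ← he₂] at c2
  have c3 := ad0 _ c2
  simp only [ad_add, ad, ← he₁, ← he₂, ← he₃] at c3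
  have c4 := ad0 _ c3
  simp only [ad_add, ad, ← he₁, ← he₂, ← he₃, he₄, zero_mul, mul_zero] at c4
  have q1 : d₁ * d₁ = -(1 / 2 : ℝ) • (d₂ * D + D * d₂) := by
    have : (2 : ℝ) • (d₁ * d₁) + (d₂ * D + D * d₂) = 0 := by
      rw [← a2, two_smul]; abel
    rw [eq_neg_of_add_eq_zero_right this, smul_neg, neg_smul, neg_neg, smul_smul]; norm_num
  have q2 : d₁ * e₂ + e₂ * d₁ = (d₂ * D + D * d₂) - (d₂ * e₁ + e₁ * d₂) := by
    have : (3 : ℝ) • ((d₁ * e₂ + e₂ * d₁) - (d₂ * D + D * d₂) + (d₂ * e₁ + e₁ * d₂)) = 0 := by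
      rw [← b3, h]
      simp only [smul_mul_assoc, mul_smul_comm]
      module
    have h0 := (smul_eq_zero.mp this).resolve_left (by norm_num)
    rw [← sub_eq_zero, ← h0]; abel
  have q3 : e₂ * e₂ = (2 : ℝ) • (d₂ * e₁ + e₁ * d₂) := by
    have : (6 : ℝ) • (e₂ * e₂ - (2 : ℝ) • (d₂ * e₁ + e₁ * d₂)) = 0 := by
      rw [← c4, h]
      simp only [smul_mul_assoc, mul_smul_comm]
      module
    exact sub_eq_zero.mp ((smul_eq_zero.mp this).resolve_left (by norm_num))
  -- With weights 1, 1/2 and 1/4, the terms d₂D + Dd₂ of q1 and q2 cancel, and so do the terms d₂e₁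
  -- + e₁d₂ of q2 and q3.
  have : (d₁ + (1 / 2 : ℝ) • e₂) * (d₁ + (1 / 2 : ℝ) • e₂)
      = d₁ * d₁ + (1 / 2 : ℝ) • (d₁ * e₂ + e₂ * d₁) + (1 / 4 : ℝ) • (e₂ * e₂) := by
    simp only [add_mul, mul_add, smul_mul_assoc, mul_smul_comm]
    module
  rw [this, q1, q2, q3]
  module

/-! ### Interior products by multivectors and their Cartan relations -/

section

variable {R L : Type*} [CommRing R] [Algebra ℝ R] [AddCommGroup L] [Module R L]

theorem intProdReal_apply (P : ExteriorAlgebra R L) (η : Form R L) :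
    intProdReal P η = intProd P η := rfl

theorem intProdReal_ι_apply (X : L) (η : Form R L) :
    intProdReal (ExteriorAlgebra.ι R X) η = contract X η := by
  rw [intProdReal_apply, intProd_ι]

theorem intProd_algebraMap_apply (f : R) (η : Form R L) :
    intProd (algebraMap R _ f) η = f • η := by
  rw [AlgHom.commutes]; rfl

/-- The commutator of the exterior product by a linear form with an interior product. -/
theorem wedge_intProd_sub (ξ : Module.Dual R L) (P : ExteriorAlgebra R L) (η : Form R L) :
    wedge (ofDual ξ) (intProd P η) - intProd (CliffordAlgebra.involute P) (wedge (ofDual ξ) η)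
      = intProd (CliffordAlgebra.contractLeft ξ P) η := by
  induction P using CliffordAlgebra.left_induction generalizing η with
  | algebraMap r =>
    rw [CliffordAlgebra.contractLeft_algebraMap]
    refine (congrArg₂ (· - ·) (congrArg _ (intProd_algebraMap_apply r η))
      ((congrArg (fun z => intProd z _) (AlgHom.commutes _ r)).trans
        (intProd_algebraMap_apply r _))).trans ?_
    simp
  | add x y hx hy =>
    simp only [map_add, LinearMap.add_apply, ← hx, ← hy]
    abel
  | ι_mul x v hx =>
    have h1 : ∀ P : ExteriorAlgebra R L, intProd (ExteriorAlgebra.ι R v * P) η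
        = contract v (intProd P η) := fun P => by rw [map_mul, intProd_ι]; rfl
    have h2 : CliffordAlgebra.involute (CliffordAlgebra.ι (0 : QuadraticForm R L) v * x)
        = -(ExteriorAlgebra.ι R v * CliffordAlgebra.involute x) := by
      rw [map_mul, CliffordAlgebra.involute_ι, neg_mul]
    have h3 : CliffordAlgebra.contractLeft ξ (CliffordAlgebra.ι (0 : QuadraticForm R L) v * x)
        = ξ v • x - ExteriorAlgebra.ι R v * CliffordAlgebra.contractLeft ξ x :=
      CliffordAlgebra.contractLeft_ι_mul _ _ _
    have h4 : intProd (ExteriorAlgebra.ι R v * CliffordAlgebra.involute x) (wedge (ofDual ξ) η)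
        = contract v (intProd (CliffordAlgebra.involute x) (wedge (ofDual ξ) η)) := by
      rw [map_mul, intProd_ι]; rfl
    have h5 := contract_wedge v (ofDual ξ) (intProd x η)
    rw [contract_ofDual, wedge_ofFun, formSign_ofDual, map_neg, LinearMap.neg_apply] at h5
    rw [h2, h3, map_sub, LinearMap.sub_apply, map_smul, LinearMap.smul_apply, map_neg,
      LinearMap.neg_apply, h4, h1 (CliffordAlgebra.contractLeft ξ x), ← hx, map_sub, h5]
    refine Eq.trans (congrArg (fun z => wedge (ofDual ξ) z - _) (h1 x)) ?_
    abel

theorem contractLeft_bivector (ξ : Module.Dual R L) (π : ⋀[R]^2 L) :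
    CliffordAlgebra.contractLeft ξ (π : ExteriorAlgebra R L)
      = ExteriorAlgebra.ι R (sharp π ξ) := by
  obtain ⟨S, hS⟩ := exists_toTensor_eq π
  refine two_smul_cancel (R := R) ?_
  have h : ∀ X Y : L, CliffordAlgebra.contractLeft ξ
      (ExteriorAlgebra.ι R X * ExteriorAlgebra.ι R Y : ExteriorAlgebra R L)
      = ξ X • ExteriorAlgebra.ι R Y - ξ Y • ExteriorAlgebra.ι R X := fun X Y => by
    refine (CliffordAlgebra.contractLeft_ι_mul _ _ _).trans ?_
    congr 1
    refine (congrArg (_ * ·) (CliffordAlgebra.contractLeft_ι (0 : QuadraticForm R L) ξ Y)).trans ?_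
    exact (Algebra.commutes _ _).symm.trans (Algebra.smul_def _ _).symm
  have hs := sum_skew_of_bilinear hS (fun X Y => ξ X • ExteriorAlgebra.ι R Y)
    (fun X X' Y => by simp [add_smul]) (fun c X Y => by simp [mul_smul])
    (fun X Y Y' => by simp) (fun c X Y => by simp [smul_comm c])
  rw [← map_smul, two_smul_bivector hS, map_sum]
  simp only [h, Finset.sum_sub_distrib, hs]
  rw [sharp_eq_sum hS, map_sum, two_smul]
  simp

end

namespace LieRinehart

variable {R L : Type*} [CommRing R] [Algebra ℝ R] [AddCommGroup L] [Module ℝ L]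
    [Module R L] [IsScalarTower ℝ R L] (A : LieRinehart R L)

theorem d_ofFun (f : R) : A.d (ofFun f) = ofDual (A.df f) := by
  refine form_ext_contract ?_ fun X => ?_
  · rw [formEval_zero_d, formEval_zero_ofDual]
  · rw [contract_d, contract_ofFun, map_zero, sub_zero, contract_ofDual]
    refine form_ext_contract ?_ fun Y => ?_
    · rw [formEval_zero_lieForm, formEval_ofFun, formEval_ofFun]; rfl
    · simp only [contract_lieForm, contract_ofFun, map_zero, sub_zero]

theorem lieForm_ofFun (X : L) (f : R) : A.lieForm X (ofFun f) = ofFun (A.anchor X f) := by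
  rw [lieForm_apply, contract_ofFun, map_zero, add_zero, d_ofFun, contract_ofDual]; rfl

theorem lieForm_smul (X : L) (f : R) (η : Form R L) :
    A.lieForm X (f • η) = f • A.lieForm X η + A.anchor X f • η := by
  rw [← wedge_ofFun, lieForm_wedge, lieForm_ofFun, wedge_ofFun, wedge_ofFun, add_comm]

theorem d_smul (f : R) (η : Form R L) :
    A.d (f • η) = f • A.d η + wedge (ofDual (A.df f)) η := by
  rw [← wedge_ofFun, d_wedge, d_ofFun, formSign_ofFun, wedge_ofFun, add_comm]

/-- As functions of P, the commutator [ℒ_v, i_P] and i_{[v,P]} obey the same Leibniz rule, so it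
suffices to compare them on functions and sections. -/
theorem lieForm_intProd (v : L) (P : ExteriorAlgebra R L) (η : Form R L) :
    A.lieForm v (intProd P η) = intProd P (A.lieForm v η) + intProd (A.lieDer v P) η := by
  induction P using ExteriorAlgebra.induction generalizing η with
  | algebraMap r =>
    rw [lieDer_algebraMap, intProd_algebraMap_apply, intProd_algebraMap_apply,
      intProd_algebraMap_apply, lieForm_smul]
  | ι x =>
    rw [lieDer_ι, intProd_ι, intProd_ι, contract_lieForm]
    abel
  | mul a b ha hb =>
    have h : ∀ (P Q : ExteriorAlgebra R L) (ζ : Form R L), intProd (P * Q) ζ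
        = intProd P (intProd Q ζ) := fun P Q ζ => by rw [map_mul]; rfl
    rw [lieDer_mul, map_add, LinearMap.add_apply, h, h, h, h, ha, hb, map_add]
    abel
  | add a b ha hb => simp only [map_add, LinearMap.add_apply, ha, hb]; abel

theorem partialPi_apply (π : ⋀[R]^2 L) (η : Form R L) :
    A.partialPi π η = A.d (intProd (π : ExteriorAlgebra R L) η)
      - intProd (π : ExteriorAlgebra R L) (A.d η) := rfl

/-- The failure of ∂_π to be linear over functions is [df∧, i_π] = i_{π♯ df}. -/
theorem partialPi_smul (π : ⋀[R]^2 L) (f : R) (η : Form R L) :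
    A.partialPi π (f • η) = f • A.partialPi π η + contract (sharp π (A.df f)) η := by
  have h := wedge_intProd_sub (A.df f) (π : ExteriorAlgebra R L) η
  rw [involute_bivector, contractLeft_bivector, intProd_ι] at h
  rw [← h, partialPi_apply, partialPi_apply, map_smul, d_smul, d_smul, map_add, map_smul, smul_sub]
  abel

theorem intProd_contract (π : ⋀[R]^2 L) (v : L) (η : Form R L) :
    intProd (π : ExteriorAlgebra R L) (contract v η)
      = contract v (intProd (π : ExteriorAlgebra R L) η) :=
  LinearMap.congr_fun (intProd_mul_contract π v) η

/-- Because i_v and i_π commute, the anticommutator of ∂_π with i_v reduces to the commutator of ℒ_v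
with i_π. -/
theorem partialPi_contract (π : ⋀[R]^2 L) (v : L) (η : Form R L) :
    A.partialPi π (contract v η) = -contract v (A.partialPi π η)
      + intProd (A.lieDer v (π : ExteriorAlgebra R L)) η := by
  have h := A.lieForm_intProd v (π : ExteriorAlgebra R L) η
  rw [lieForm_apply, lieForm_apply, map_add, ← intProd_contract] at h
  rw [partialPi_apply, partialPi_apply, map_sub, ← intProd_contract, ← sub_eq_iff_eq_add'.mpr h]
  abel

theorem signHom_three (a : ExteriorAlgebra R L) :
    signHom R L (2 + 1) a = CliffordAlgebra.involute a := by
  rw [show 2 + 1 = 1 + 2 from rfl, signHom_add_two]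
  simp [signHom]

/-- The interior product by a Gerstenhaber bracket `[π, Q]` is a double commutator. -/
theorem intProd_schouten (π : ⋀[R]^2 L) (Q : ExteriorAlgebra R L) (η : Form R L) :
    intProd (A.schouten π Q) η
      = intProd (CliffordAlgebra.involute Q) (A.partialPi π η) - A.partialPi π (intProd Q η) := by
  -- Both sides satisfy the Leibniz rule twisted by the grade involution in Q, so functions and
  -- sections decide; there the claim is `partialPi_smul` and `partialPi_contract`.
  induction Q using ExteriorAlgebra.induction generalizing η with
  | algebraMap r =>
    rw [schouten_algebraMap, contr, contractLeft_bivector, AlgHom.commutes,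
      intProd_algebraMap_apply, intProd_algebraMap_apply, partialPi_smul]
    have : ((-1 : R)) ^ (2 + 1) = -1 := by norm_num
    rw [this, neg_one_smul, map_neg, LinearMap.neg_apply, intProd_ι]
    abel
  | ι v =>
    have h : CliffordAlgebra.involute (ExteriorAlgebra.ι R v) = -ExteriorAlgebra.ι R v :=
      CliffordAlgebra.involute_ι v
    rw [schouten_ι, h, map_neg, map_neg, LinearMap.neg_apply, LinearMap.neg_apply, intProd_ι,
      partialPi_contract]
    abel
  | mul a b ha hb =>
    have h : ∀ (P Q : ExteriorAlgebra R L) (ζ : Form R L), intProd (P * Q) ζ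
        = intProd P (intProd Q ζ) := fun P Q ζ => by rw [map_mul]; rfl
    have hi : CliffordAlgebra.involute (a * b)
        = CliffordAlgebra.involute a * CliffordAlgebra.involute b := map_mul _ a b
    rw [schouten_mul, signHom_three, map_add, LinearMap.add_apply, hi, h, h, h, h, ha, hb, map_sub]
    abel
  | add a b ha hb => simp only [map_add, LinearMap.add_apply, ha, hb]; abel

/-- The generator in the form of the degree -1 component of exp(-i_π) (d + ψ∧) exp(i_π); the
coefficient 1/2 of the exponential series cancels the 2 in the double commutator. -/
theorem generator_eq (π : ⋀[R]^2 L) (ψ : AltForm R L 3) :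
    A.generator π ψ = A.partialPi π + (1 / 2 : ℝ) •
      (adPi π (adPi π (wedge (ofDeg 3 ψ)))).restrictScalars ℝ := by
  rw [adPi_adPi_wedge_three, generator, add_assoc]
  congr 1
  refine LinearMap.ext fun η => ?_
  have h : ∀ z : Form R L, (1 / 2 : ℝ) • (2 : R) • z = z := fun z => by
    rw [← algebraMap_smul R, smul_smul, half_add_half, one_smul]
  refine Eq.trans ?_ (h _).symm
  rw [← intProd_ι]
  rfl

theorem wedge_three_self (ψ : AltForm R L 3) : wedge (ofDeg 3 ψ) (ofDeg 3 ψ) = 0 := by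
  have h := wedge_comm 3 3 ψ ψ
  rw [Odd.neg_one_pow (by decide), neg_one_smul] at h
  refine two_smul_cancel (R := R) ?_
  rw [two_smul, smul_zero]
  nth_rewrite 1 [h]
  simp

theorem generator_mul_self {π : ⋀[R]^2 L} {ψ : AltForm R L 3} (h : A.IsTwistedPoisson π ψ) :
    A.generator π ψ * A.generator π ψ = 0 := by
  rw [generator_eq]
  refine sq_eq_zero_of_commutators (D := A.d) (e := (wedge (ofDeg 3 ψ)).restrictScalars ℝ)
    (p := intProdReal (π : ExteriorAlgebra R L))
    (e₁ := (adPi π (wedge (ofDeg 3 ψ))).restrictScalars ℝ)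
    (e₃ := (adPi π (adPi π (adPi π (wedge (ofDeg 3 ψ))))).restrictScalars ℝ)
    (LinearMap.ext fun η => A.d_d η) (LinearMap.ext fun η => ?_) (LinearMap.ext fun η => ?_)
    rfl rfl rfl rfl rfl ?_ (LinearMap.ext fun η => ?_)
  · change A.d (wedge (ofDeg 3 ψ) η) + wedge (ofDeg 3 ψ) (A.d η) = 0
    rw [d_wedge, h.closed, formSign_ofDeg]
    simp [Odd.neg_one_pow (by decide : Odd 3)]
  · change wedge (ofDeg 3 ψ) (wedge (ofDeg 3 ψ) η) = 0
    rw [← wedge_assoc, wedge_three_self]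
    simp
  · have h4 := adPi_intProd_sharpThree π ψ
    rw [← adPi_adPi_adPi_wedge_three] at h4
    refine LinearMap.ext fun η => ?_
    exact LinearMap.congr_fun h4 η
  -- The twisted Poisson condition enters here: the double commutator of d is -i_{[π,π]}, and the
  -- triple commutator of ψ∧ is 6 i_{(∧³π♯)ψ} = 3 i_{[π,π]}.
  · change adPi π (adPi π (adPi π (wedge (ofDeg 3 ψ)))) η = -(3 : ℝ) •
      (A.partialPi π (intProd (π : ExteriorAlgebra R L) η)
        - intProd (π : ExteriorAlgebra R L) (A.partialPi π η))
    have hs := A.intProd_schouten π (π : ExteriorAlgebra R L) η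
    rw [involute_bivector] at hs
    rw [adPi_adPi_adPi_wedge_three, ← h.half_schouten, ← neg_sub, ← hs, map_smul, smul_smul,
      ← map_mul, LinearMap.smul_apply, smul_neg, neg_smul, neg_neg, algebraMap_smul]
    norm_num

end LieRinehart

/-! ### The bracket generated by an operator of order two -/

section Generated

variable {W : Type*} [AddCommGroup W] [Module ℝ W]

/-- The bracket generated by an odd operator `u`, where `s` is the sign involution. -/
def generatedBracket (mul : W →ₗ[ℝ] W →ₗ[ℝ] W) (s u : Module.End ℝ W) :
    W →ₗ[ℝ] W →ₗ[ℝ] W :=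
  (mul ∘ₗ s).compr₂ u - mul ∘ₗ (u ∘ₗ s) - mul.compl₂ u

variable {mul : W →ₗ[ℝ] W →ₗ[ℝ] W} {s u : Module.End ℝ W}

theorem generatedBracket_apply (a b : W) :
    generatedBracket mul s u a b = u (mul (s a) b) - mul (u (s a)) b - mul a (u b) := rfl

theorem generatedBracket_even {a : W} (ha : s a = a) (b : W) :
    generatedBracket mul s u a b = u (mul a b) - mul (u a) b - mul a (u b) := by
  rw [generatedBracket_apply, ha]

theorem generatedBracket_odd {a : W} (ha : s a = -a) (b : W) :
    generatedBracket mul s u a b = -u (mul a b) + mul (u a) b - mul a (u b) := by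
  rw [generatedBracket_apply, ha]
  simp only [map_neg, LinearMap.neg_apply]
  abel

/-- A bracket `br` is a biderivation in its second argument. -/
structure IsSignedDerivation (mul : W →ₗ[ℝ] W →ₗ[ℝ] W) (s : Module.End ℝ W)
    (br : W →ₗ[ℝ] W →ₗ[ℝ] W) : Prop where
  even : ∀ a, s a = a → ∀ x y, br a (mul x y) = mul (br a x) y + mul (s x) (br a y)
  odd : ∀ a, s a = -a → ∀ x y, br a (mul x y) = mul (br a x) y + mul x (br a y)

/-- An associative product, graded commutative with respect to a sign involution. -/
structure IsSignedCommutative (mul : W →ₗ[ℝ] W →ₗ[ℝ] W) (s : Module.End ℝ W) : Prop where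
  assoc : ∀ a b c, mul (mul a b) c = mul a (mul b c)
  sign_sign : ∀ a, s (s a) = a
  sign_mul : ∀ a b, s (mul a b) = mul (s a) (s b)
  comm_even : ∀ a, s a = a → ∀ b, mul a b = mul b a
  comm_odd : ∀ a, s a = -a → ∀ b, mul a b = mul (s b) a

/-! ### Jacobi identity and skew-symmetry of the generated bracket, by parity -/

theorem generatedBracket_sign (h : IsSignedCommutative mul s) (hs : ∀ a, u (s a) = -s (u a))
    (a b : W) :
    s (generatedBracket mul s u a b) = -generatedBracket mul s u (s a) (s b) := by
  simp only [generatedBracket_apply, map_sub, h.sign_mul, hs, h.sign_sign, map_neg,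
    LinearMap.neg_apply]
  rw [show mul a (s b) = s (mul (s a) b) by rw [h.sign_mul, h.sign_sign], hs]
  abel

/-- Once u² = 0, applying u to the definition of the bracket leaves only terms of the brackets of
u(a) with x and of a with u(x): u is a derivation of its own bracket, up to signs. -/
theorem generatedBracket_apply_apply_even (hs : ∀ a, u (s a) = -s (u a)) (hu : ∀ a, u (u a) = 0)
    {a : W} (ha : s a = a) (x : W) :
    generatedBracket mul s u a (u x)
      = -u (generatedBracket mul s u a x) + generatedBracket mul s u (u a) x := by
  have hua : s (u a) = -u a := by rw [← neg_eq_iff_eq_neg, ← hs, ha]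
  rw [generatedBracket_even ha, generatedBracket_even ha, generatedBracket_odd hua]
  simp only [map_sub, hu, map_zero, LinearMap.zero_apply]
  abel

theorem generatedBracket_apply_apply_odd (hs : ∀ a, u (s a) = -s (u a)) (hu : ∀ a, u (u a) = 0)
    {a : W} (ha : s a = -a) (x : W) :
    generatedBracket mul s u a (u x)
      = u (generatedBracket mul s u a x) - generatedBracket mul s u (u a) x := by
  have hua : s (u a) = u a := by rw [← neg_inj, ← hs, ha, map_neg]
  rw [generatedBracket_odd ha, generatedBracket_odd ha, generatedBracket_even hua]
  simp only [map_sub, map_add, map_neg, hu, map_zero, LinearMap.zero_apply]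
  abel

/-- Only the brackets with b, and the outer bracket of [a, b] with c, are expanded through u. Then
[a, ·] passes the products by the Leibniz rule and passes u at the price of [u(a), ·]; these extra
terms cancel because [u(a), ·] is a derivation as well. The other parities differ in signs alone. -/
theorem generatedBracket_jacobi_even_even (h : IsSignedCommutative mul s)
    (hs : ∀ a, u (s a) = -s (u a)) (hu : ∀ a, u (u a) = 0)
    (hd : IsSignedDerivation mul s (generatedBracket mul s u)) {a b : W} (ha : s a = a)
    (hb : s b = b) (c : W) :
    generatedBracket mul s u a (generatedBracket mul s u b c)
      = generatedBracket mul s u (generatedBracket mul s u a b) c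
        - generatedBracket mul s u b (generatedBracket mul s u a c) := by
  have hua : s (u a) = -u a := by rw [← neg_eq_iff_eq_neg, ← hs, ha]
  have hub : s (u b) = -u b := by rw [← neg_eq_iff_eq_neg, ← hs, hb]
  have hab : s (generatedBracket mul s u a b) = -generatedBracket mul s u a b := by
    rw [generatedBracket_sign h hs, ha, hb]
  rw [generatedBracket_odd hab, generatedBracket_even hb c,
    generatedBracket_even hb (generatedBracket mul s u a c)]
  simp only [map_sub, generatedBracket_apply_apply_even hs hu ha, hd.even a ha, hd.odd _ hua,
    hub, hb, map_add, map_neg, LinearMap.add_apply, LinearMap.neg_apply]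
  abel

theorem generatedBracket_jacobi_even_odd (h : IsSignedCommutative mul s)
    (hs : ∀ a, u (s a) = -s (u a)) (hu : ∀ a, u (u a) = 0)
    (hd : IsSignedDerivation mul s (generatedBracket mul s u)) {a b : W} (ha : s a = a)
    (hb : s b = -b) (c : W) :
    generatedBracket mul s u a (generatedBracket mul s u b c)
      = generatedBracket mul s u (generatedBracket mul s u a b) c
        + generatedBracket mul s u b (generatedBracket mul s u a c) := by
  have hua : s (u a) = -u a := by rw [← neg_eq_iff_eq_neg, ← hs, ha]
  have hub : s (u b) = u b := by rw [← neg_inj, ← hs, hb, map_neg]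
  have hab : s (generatedBracket mul s u a b) = generatedBracket mul s u a b := by
    rw [generatedBracket_sign h hs, ha, hb, map_neg, neg_neg]
  rw [generatedBracket_even hab, generatedBracket_odd hb c,
    generatedBracket_odd hb (generatedBracket mul s u a c)]
  simp only [map_sub, generatedBracket_apply_apply_even hs hu ha, hd.even a ha, hd.odd _ hua,
    hub, hb, map_add, map_neg, LinearMap.add_apply, LinearMap.neg_apply]
  abel

theorem generatedBracket_jacobi_odd_even (h : IsSignedCommutative mul s)
    (hs : ∀ a, u (s a) = -s (u a)) (hu : ∀ a, u (u a) = 0)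
    (hd : IsSignedDerivation mul s (generatedBracket mul s u)) {a b : W} (ha : s a = -a)
    (hb : s b = b) (c : W) :
    generatedBracket mul s u a (generatedBracket mul s u b c)
      = generatedBracket mul s u (generatedBracket mul s u a b) c
        + generatedBracket mul s u b (generatedBracket mul s u a c) := by
  have hua : s (u a) = u a := by rw [← neg_inj, ← hs, ha, map_neg]
  have hab : s (generatedBracket mul s u a b) = generatedBracket mul s u a b := by
    rw [generatedBracket_sign h hs, ha, hb, map_neg, LinearMap.neg_apply, neg_neg]
  rw [generatedBracket_even hab, generatedBracket_even hb c,
    generatedBracket_even hb (generatedBracket mul s u a c)]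
  simp only [map_sub, generatedBracket_apply_apply_odd hs hu ha, hd.odd a ha, hd.even _ hua,
    hb, map_add, LinearMap.sub_apply]
  abel

theorem generatedBracket_jacobi_odd_odd (h : IsSignedCommutative mul s)
    (hs : ∀ a, u (s a) = -s (u a)) (hu : ∀ a, u (u a) = 0)
    (hd : IsSignedDerivation mul s (generatedBracket mul s u)) {a b : W} (ha : s a = -a)
    (hb : s b = -b) (c : W) :
    generatedBracket mul s u a (generatedBracket mul s u b c)
      = generatedBracket mul s u (generatedBracket mul s u a b) c
        + generatedBracket mul s u b (generatedBracket mul s u a c) := by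
  have hua : s (u a) = u a := by rw [← neg_inj, ← hs, ha, map_neg]
  have hab : s (generatedBracket mul s u a b) = -generatedBracket mul s u a b := by
    rw [generatedBracket_sign h hs, ha, hb, map_neg, map_neg, LinearMap.neg_apply, neg_neg]
  rw [generatedBracket_odd hab, generatedBracket_odd hb c,
    generatedBracket_odd hb (generatedBracket mul s u a c)]
  simp only [map_sub, generatedBracket_apply_apply_odd hs hu ha, hd.odd a ha, hd.even _ hua,
    hb, map_add, map_neg, LinearMap.neg_apply, LinearMap.sub_apply]
  abel

/-- Only graded commutativity and the oddness of u matter, not u² = 0 or the order of u. The case of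
a even and b odd is obtained from `generatedBracket_skew_odd` by exchanging the arguments. -/
theorem generatedBracket_skew_even (h : IsSignedCommutative mul s)
    (hs : ∀ a, u (s a) = -s (u a)) {a b : W} (ha : s a = a) (hb : s b = b) :
    generatedBracket mul s u a b = generatedBracket mul s u b a := by
  have hua : s (u a) = -u a := by rw [← neg_eq_iff_eq_neg, ← hs, ha]
  rw [generatedBracket_even ha, generatedBracket_even hb, h.comm_even a ha, h.comm_odd _ hua,
    h.comm_even a ha, hb]
  abel

theorem generatedBracket_skew_odd (h : IsSignedCommutative mul s)
    (hs : ∀ a, u (s a) = -s (u a)) {a b : W} (ha : s a = -a) (hb : s b = b) :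
    generatedBracket mul s u a b = -generatedBracket mul s u b a := by
  have hua : s (u a) = u a := by rw [← neg_inj, ← hs, ha, map_neg]
  have hub : s (u b) = -u b := by rw [← neg_eq_iff_eq_neg, ← hs, hb]
  rw [generatedBracket_odd ha, generatedBracket_even hb, h.comm_odd a ha, h.comm_even _ hua,
    h.comm_odd a ha, hb, hub, map_neg, LinearMap.neg_apply]
  abel

theorem generatedBracket_skew_odd_odd (h : IsSignedCommutative mul s)
    (hs : ∀ a, u (s a) = -s (u a)) {a b : W} (ha : s a = -a) (hb : s b = -b) :
    generatedBracket mul s u a b = -generatedBracket mul s u b a := by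
  have hua : s (u a) = u a := by rw [← neg_inj, ← hs, ha, map_neg]
  have hub : s (u b) = u b := by rw [← neg_inj, ← hs, hb, map_neg]
  rw [generatedBracket_odd ha, generatedBracket_odd hb, h.comm_odd a ha, h.comm_even _ hua,
    h.comm_odd a ha, hb, hub, map_neg, LinearMap.neg_apply, map_neg]
  abel

/-- Operators of order at most two generate biderivations. -/
def IsSecondOrder (mul : W →ₗ[ℝ] W →ₗ[ℝ] W) (s u : Module.End ℝ W) : Prop :=
  IsSignedDerivation mul s (generatedBracket mul s u)

theorem IsSecondOrder.add {v : Module.End ℝ W} (hu : IsSecondOrder mul s u)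
    (hv : IsSecondOrder mul s v) : IsSecondOrder mul s (u + v) := by
  have h : ∀ a b, generatedBracket mul s (u + v) a b
      = generatedBracket mul s u a b + generatedBracket mul s v a b := fun a b => by
    simp only [generatedBracket_apply, LinearMap.add_apply, map_add]; abel
  refine ⟨fun a ha x y => ?_, fun a ha x y => ?_⟩
  · simp only [h, hu.even a ha, hv.even a ha, map_add, LinearMap.add_apply]; abel
  · simp only [h, hu.odd a ha, hv.odd a ha, map_add, LinearMap.add_apply]; abel

theorem IsSecondOrder.smul (c : ℝ) (hu : IsSecondOrder mul s u) :
    IsSecondOrder mul s (c • u) := by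
  have h : ∀ a b, generatedBracket mul s (c • u) a b = c • generatedBracket mul s u a b :=
    fun a b => by
      simp only [generatedBracket_apply, LinearMap.smul_apply, map_smul, smul_sub]
  refine ⟨fun a ha x y => ?_, fun a ha x y => ?_⟩
  · simp only [h, hu.even a ha, map_smul, LinearMap.smul_apply, smul_add]
  · simp only [h, hu.odd a ha, map_smul, LinearMap.smul_apply, smul_add]

theorem IsSecondOrder.sum {ι : Type*} {t : Finset ι} {v : ι → Module.End ℝ W}
    (hv : ∀ i ∈ t, IsSecondOrder mul s (v i)) : IsSecondOrder mul s (∑ i ∈ t, v i) := by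
  classical
  induction t using Finset.induction_on with
  | empty =>
    refine ⟨fun a ha x y => ?_, fun a ha x y => ?_⟩ <;> simp [generatedBracket_apply]
  | insert i t hi ih =>
    rw [Finset.sum_insert hi]
    exact (hv i (Finset.mem_insert_self i t)).add
      (ih fun j hj => hv j (Finset.mem_insert_of_mem hj))

/-- An odd derivation. -/
structure IsOddDerivation (mul : W →ₗ[ℝ] W →ₗ[ℝ] W) (s D : Module.End ℝ W) : Prop where
  sign : ∀ a, D (s a) = -s (D a)
  leibniz : ∀ a b, D (mul a b) = mul (D a) b + mul (s a) (D b)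

/-- An even derivation. -/
structure IsEvenDerivation (mul : W →ₗ[ℝ] W →ₗ[ℝ] W) (s D : Module.End ℝ W) : Prop where
  sign : ∀ a, D (s a) = s (D a)
  leibniz : ∀ a b, D (mul a b) = mul (D a) b + mul a (D b)

theorem IsOddDerivation.generatedBracket (h : IsSignedCommutative mul s) {D : Module.End ℝ W}
    (hD : IsOddDerivation mul s D) (a b : W) : generatedBracket mul s D a b = 0 := by
  rw [generatedBracket_apply, hD.leibniz, h.sign_sign]
  abel

theorem IsOddDerivation.isSecondOrder (h : IsSignedCommutative mul s) {D : Module.End ℝ W}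
    (hD : IsOddDerivation mul s D) : IsSecondOrder mul s D := by
  refine ⟨fun a ha x y => ?_, fun a ha x y => ?_⟩ <;> simp [hD.generatedBracket h]

/-- The generated bracket is D(a) O(b) - s(O(a)) D(b), visibly a derivation in b. All parts of the
generator that are not themselves derivations are combinations of such products. -/
theorem IsEvenDerivation.isSecondOrder_mul (h : IsSignedCommutative mul s) {D O : Module.End ℝ W}
    (hD : IsEvenDerivation mul s D) (hO : IsOddDerivation mul s O) :
    IsSecondOrder mul s (D * O) := by
  have hb : ∀ a b, generatedBracket mul s (D * O) a b
      = mul (D a) (O b) - mul (s (O a)) (D b) := fun a b => by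
    simp only [generatedBracket_apply, Module.End.mul_apply, hO.leibniz, hD.leibniz, map_add,
      h.sign_sign, hO.sign, map_neg, LinearMap.neg_apply]
    abel
  refine ⟨fun a ha x y => ?_, fun a ha x y => ?_⟩
  · have hDa : s (D a) = D a := by rw [← hD.sign, ha]
    have hOa : s (O a) = -O a := by rw [← neg_eq_iff_eq_neg, ← hO.sign, ha]
    have h1 : ∀ z, mul (D a) (mul (s x) z) = mul (s x) (mul (D a) z) := fun z => by
      rw [← h.assoc, h.comm_even _ hDa, h.assoc]
    have h2 : ∀ z, mul (O a) (mul x z) = mul (s x) (mul (O a) z) := fun z => by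
      rw [← h.assoc, h.comm_odd _ hOa, h.assoc]
    simp only [hb, hO.leibniz, hD.leibniz, map_add, hOa, map_neg, LinearMap.neg_apply,
      LinearMap.sub_apply, map_sub, h.assoc, h1, h2]
    abel
  · have hDa : s (D a) = -D a := by rw [← hD.sign, ha, map_neg]
    have hOa : s (O a) = O a := by rw [← neg_inj, ← hO.sign, ha, map_neg]
    have h1 : ∀ z, mul (D a) (mul (s x) z) = mul x (mul (D a) z) := fun z => by
      rw [← h.assoc, h.comm_odd _ hDa, h.sign_sign, h.assoc]
    have h2 : ∀ z, mul (O a) (mul x z) = mul x (mul (O a) z) := fun z => by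
      rw [← h.assoc, h.comm_even _ hOa, h.assoc]
    simp only [hb, hO.leibniz, hD.leibniz, map_add, hOa,
      LinearMap.sub_apply, map_sub, h.assoc, h1, h2]
    abel

/-! ### From parities to degrees -/

theorem pow_parity (p : ℕ) : ((-1 : ℝ) ^ p = 1 ∧ Even p) ∨ ((-1 : ℝ) ^ p = -1 ∧ Odd p) := by
  rcases Nat.even_or_odd p with h | h
  · exact Or.inl ⟨h.neg_one_pow, h⟩
  · exact Or.inr ⟨h.neg_one_pow, h⟩

variable {𝒲 : ℕ → Submodule ℝ W} {one : W}

theorem sign_cases (hsign : ∀ p, ∀ a ∈ 𝒲 p, s a = (-1 : ℝ) ^ p • a) (p : ℕ) {a : W}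
    (ha : a ∈ 𝒲 p) : (Even p ∧ s a = a) ∨ (Odd p ∧ s a = -a) := by
  rcases pow_parity p with ⟨h1, h2⟩ | ⟨h1, h2⟩
  · exact Or.inl ⟨h2, by rw [hsign p a ha, h1, one_smul]⟩
  · exact Or.inr ⟨h2, by rw [hsign p a ha, h1, neg_one_smul]⟩

/-- An operator of degree `-1`, order two and square zero makes a graded commutative algebra a
Batalin-Vilkovisky algebra. -/
theorem isBVAlgebra_generatedBracket (h : IsSignedCommutative mul s)
    (hint : DirectSum.IsInternal 𝒲) (hone : one ∈ 𝒲 0) (hone_mul : ∀ a, mul one a = a)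
    (hmul : ∀ p q, ∀ a ∈ 𝒲 p, ∀ b ∈ 𝒲 q, mul a b ∈ 𝒲 (p + q))
    (hcomm : ∀ p q, ∀ a ∈ 𝒲 p, ∀ b ∈ 𝒲 q, mul a b = (-1 : ℝ) ^ (p * q) • mul b a)
    (hsign : ∀ p, ∀ a ∈ 𝒲 p, s a = (-1 : ℝ) ^ p • a)
    (hs : ∀ a, u (s a) = -s (u a)) (hu : ∀ a, u (u a) = 0)
    (hu_zero : ∀ a ∈ 𝒲 0, u a = 0) (hu_mem : ∀ p, ∀ a ∈ 𝒲 (p + 1), u a ∈ 𝒲 p)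
    (hd : IsSecondOrder mul s u) :
    IsBVAlgebra 𝒲 mul one (generatedBracket mul s u) u where
  square_zero := LinearMap.ext hu
  generator p a ha b := by
    rw [generatedBracket_apply, hsign p a ha]
    rcases pow_parity p with ⟨h1, -⟩ | ⟨h1, -⟩
    · simp [h1]
    · rw [h1]
      simp only [neg_one_smul, map_neg, LinearMap.neg_apply]
      abel
  gerstenhaber :=
    { isInternal := hint
      one_mem := hone
      one_mul := hone_mul
      mul_mem := hmul
      mul_assoc := h.assoc
      mul_comm := hcomm
      br_mem := fun p q m hpq a ha b hb => by
        have h1 : u (mul a b) ∈ 𝒲 m := hu_mem m _ (hpq ▸ hmul p q a ha b hb)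
        have h2 : mul (u a) b ∈ 𝒲 m := by
          rcases p with _ | p
          · rw [hu_zero a ha, map_zero]; exact Submodule.zero_mem _
          · rw [show m = p + q by omega]
            exact hmul _ _ _ (hu_mem p a ha) _ hb
        have h3 : mul a (u b) ∈ 𝒲 m := by
          rcases q with _ | q
          · rw [hu_zero b hb, map_zero]; exact Submodule.zero_mem _
          · rw [show m = p + q by omega]
            exact hmul _ _ _ ha _ (hu_mem q b hb)
        rw [generatedBracket_apply, hsign p a ha]
        simp only [map_smul, LinearMap.smul_apply]
        exact Submodule.sub_mem _ (Submodule.sub_mem _ (Submodule.smul_mem _ _ h1)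
          (Submodule.smul_mem _ _ h2)) h3
      br_zero := fun a ha b hb => by
        rw [generatedBracket_apply, hsign 0 a ha, pow_zero, one_smul, hu_zero a ha, hu_zero b hb,
          hu_zero _ (hmul 0 0 a ha b hb)]
        simp
      br_skew := fun p q a ha b hb => by
        rcases sign_cases hsign p ha with ⟨hp, ha⟩ | ⟨hp, ha⟩ <;>
          rcases sign_cases hsign q hb with ⟨hq, hb⟩ | ⟨hq, hb⟩
        · rw [(hp.add_one.mul hq.add_one).neg_one_pow, neg_one_smul, neg_neg]
          exact generatedBracket_skew_even h hs ha hb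
        · rw [(hq.add_one.mul_left _).neg_one_pow, one_smul, generatedBracket_skew_odd h hs hb ha,
            neg_neg]
        · rw [(hp.add_one.mul_right _).neg_one_pow, one_smul]
          exact generatedBracket_skew_odd h hs ha hb
        · rw [(hp.add_one.mul_right _).neg_one_pow, one_smul]
          exact generatedBracket_skew_odd_odd h hs ha hb
      br_mul := fun p q a ha b hb c => by
        rcases sign_cases hsign p ha with ⟨hp, ha⟩ | ⟨hp, ha⟩
        · rw [hd.even a ha, hsign q b hb, pow_mul, hp.add_one.neg_one_pow, map_smul,
            LinearMap.smul_apply]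
        · rw [hd.odd a ha, (hp.add_one.mul_right _).neg_one_pow, one_smul]
      br_jacobi := fun p q a ha b hb c => by
        rcases sign_cases hsign p ha with ⟨hp, ha⟩ | ⟨hp, ha⟩ <;>
          rcases sign_cases hsign q hb with ⟨hq, hb⟩ | ⟨hq, hb⟩
        -- The sign (-1)^((p+1)(q+1)) is -1 only when p and q are both even.
        · rw [(hp.add_one.mul hq.add_one).neg_one_pow, neg_one_smul, ← sub_eq_add_neg]
          exact generatedBracket_jacobi_even_even h hs hu hd ha hb c
        · rw [(hq.add_one.mul_left _).neg_one_pow, one_smul]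
          exact generatedBracket_jacobi_even_odd h hs hu hd ha hb c
        · rw [(hp.add_one.mul_right _).neg_one_pow, one_smul]
          exact generatedBracket_jacobi_odd_even h hs hu hd ha hb c
        · rw [(hp.add_one.mul_right _).neg_one_pow, one_smul]
          exact generatedBracket_jacobi_odd_odd h hs hu hd ha hb c }

end Generated

/-! ### The Batalin-Vilkovisky algebra of a twisted Poisson structure -/

section

variable {R L : Type*} [CommRing R] [Algebra ℝ R] [AddCommGroup L] [Module R L]

/-- The sign involution of forms as an `ℝ`-linear operator. -/
def formSignReal : Module.End ℝ (Form R L) := formSign.restrictScalars ℝ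

theorem neg_one_pow_real_smul (p : ℕ) (η : Form R L) : (-1 : R) ^ p • η = (-1 : ℝ) ^ p • η := by
  rw [← algebraMap_smul R ((-1 : ℝ) ^ p) η, map_pow, map_neg, map_one]

/-- a + s(a) is twice the even part of a. This makes commutation with an even, possibly
inhomogeneous, form a claim that can be checked degree by degree. -/
theorem wedge_add_formSign (a b : Form R L) :
    wedge (a + formSign a) b = wedge b (a + formSign a) := by
  induction a using form_induction with
  | h0 => simp
  | h2 a a' ha ha' =>
    rw [map_add formSign, add_add_add_comm, map_add wedge, LinearMap.add_apply, ha, ha',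
      map_add (wedge b) (a + _)]
  | h1 p a =>
    rw [formSign_ofDeg]
    rcases Nat.even_or_odd p with hp | hp
    · induction b using form_induction with
      | h0 => simp
      | h2 b b' hb hb' => rw [map_add (wedge _), hb, hb', map_add wedge, LinearMap.add_apply]
      | h1 q b =>
        simp only [hp.neg_one_pow, one_smul, map_add, LinearMap.add_apply]
        rw [wedge_comm p q, (hp.mul_right q).neg_one_pow, one_smul]
    · simp [hp.neg_one_pow]

/-- The same device for a - s(a), twice the odd part of a. -/
theorem wedge_sub_formSign (a b : Form R L) :
    wedge (a - formSign a) b = wedge (formSign b) (a - formSign a) := by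
  induction a using form_induction with
  | h0 => simp
  | h2 a a' ha ha' =>
    rw [map_add formSign, add_sub_add_comm, map_add wedge, LinearMap.add_apply, ha, ha', map_add]
  | h1 p a =>
    rw [formSign_ofDeg]
    rcases Nat.even_or_odd p with hp | hp
    · simp [hp.neg_one_pow]
    · induction b using form_induction with
      | h0 => simp
      | h2 b b' hb hb' => rw [map_add (wedge _), hb, hb', map_add formSign, map_add wedge, LinearMap.add_apply]
      | h1 q b =>
        simp only [hp.neg_one_pow, neg_one_smul, sub_neg_eq_add, map_add, LinearMap.add_apply]
        rw [wedge_comm p q, formSign_ofDeg, map_smul, LinearMap.smul_apply, pow_mul,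
          hp.neg_one_pow]

theorem isSignedCommutative_form :
    IsSignedCommutative (wedgeReal R L) (formSignReal (R := R) (L := L)) where
  assoc := wedge_assoc
  sign_sign := formSign_formSign
  sign_mul := formSign_wedge
  comm_even a ha b := by
    have h := wedge_add_formSign a b
    rw [show formSign a = a from ha, ← two_smul R, map_smul, LinearMap.smul_apply, map_smul] at h
    exact two_smul_cancel (R := R) h
  comm_odd a ha b := by
    have h := wedge_sub_formSign a b
    rw [show formSign a = -a from ha, sub_neg_eq_add, ← two_smul R, map_smul,
      LinearMap.smul_apply, map_smul] at h
    exact two_smul_cancel (R := R) h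

theorem wedge_ofFun_right (f : R) (η : Form R L) : wedge η (ofFun f) = f • η := by
  have h : wedge (ofFun f) η = wedge η (ofFun f) :=
    isSignedCommutative_form.comm_even (ofFun f) (formSign_ofFun f) η
  rw [← h, wedge_ofFun]

theorem isInternal_formDeg : DirectSum.IsInternal (formDeg R L) := by
  constructor
  · intro x y h
    -- Each summand is recovered from the total as its component of the same degree, which gives
    -- injectivity.
    have key : ∀ z : ⨁ q, formDeg R L q, ∀ q,
        (z q : Form R L) = ofDeg q ((DirectSum.coeAddMonoidHom (formDeg R L) z) q) := fun z q => by
      induction z using DirectSum.induction_on with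
      | zero => simp
      | of p z =>
        obtain ⟨z, θ, rfl⟩ := z
        rw [DirectSum.coeAddMonoidHom_of]
        by_cases hpq : p = q
        · subst hpq
          rw [DirectSum.of_eq_same]
          change ofDeg p θ = ofDeg p ((ofDeg p θ) p)
          congr 1
          exact (DirectSum.of_eq_same p θ).symm
        · rw [DirectSum.of_eq_of_ne _ _ _ (Ne.symm hpq)]
          change 0 = ofDeg q ((ofDeg p θ) q)
          have : (ofDeg p θ : Form R L) q = 0 := DirectSum.of_eq_of_ne _ _ _ (Ne.symm hpq)
          rw [this, map_zero]
      | add x y hx hy =>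
        rw [map_add, DirectSum.add_apply, Submodule.coe_add, hx, hy, ← map_add]
        rfl
    refine DFinsupp.ext fun q => Subtype.ext ?_
    rw [key x q, key y q, h]
  · intro η
    induction η using form_induction with
    | h0 => exact ⟨0, map_zero _⟩
    | h1 q η => exact ⟨DirectSum.of (fun q => formDeg R L q) q ⟨ofDeg q η, η, rfl⟩,
        DirectSum.coeAddMonoidHom_of _ _ _⟩
    | h2 η θ hη hθ =>
      obtain ⟨x, rfl⟩ := hη
      obtain ⟨y, rfl⟩ := hθ
      exact ⟨x + y, map_add _ _ _⟩

/-! ### The derivations of forms that compose the generator -/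

theorem isOddDerivation_contract (X : L) :
    IsOddDerivation (wedgeReal R L) formSignReal (intProdReal (ExteriorAlgebra.ι R X)) where
  sign a := by simp only [intProdReal_ι_apply]; exact contract_formSign X a
  leibniz a b := by simp only [intProdReal_ι_apply]; exact contract_wedge X a b

theorem isEvenDerivation_wedge_contract (ξ : Module.Dual R L) (X : L) :
    IsEvenDerivation (wedgeReal R L) formSignReal
      ((wedge (ofDual ξ) * contract X).restrictScalars ℝ) where
  sign a := by
    change wedge (ofDual ξ) (contract X (formSign a)) = formSign (wedge (ofDual ξ) (contract X a))
    rw [formSign_wedge, contract_formSign, formSign_ofDual, map_neg, map_neg, LinearMap.neg_apply]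
  leibniz a b := by
    change wedge (ofDual ξ) (contract X (wedge a b)) = wedge (wedge (ofDual ξ) (contract X a)) b
      + wedge a (wedge (ofDual ξ) (contract X b))
    rw [contract_wedge, map_add, wedge_assoc, ← wedge_assoc (ofDual ξ) (formSign a),
      ← wedge_assoc a]
    have h : wedge (ofDual ξ) (formSign a) = wedge (formSign (formSign a)) (ofDual ξ) :=
      isSignedCommutative_form.comm_odd (ofDual ξ) (formSign_ofDual ξ) (formSign a)
    rw [h, formSign_formSign]

theorem contract_mem_formDeg (X : L) {q : ℕ} {η : Form R L} (h : η ∈ formDeg R L (q + 1)) :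
    contract X η ∈ formDeg R L q := by
  obtain ⟨θ, rfl⟩ := h
  exact ⟨_, (contract_succ_deg X q θ).symm⟩

theorem contract_eq_zero (X : L) {η : Form R L} (h : η ∈ formDeg R L 0) : contract X η = 0 := by
  obtain ⟨θ, rfl⟩ := h
  exact contract_zero_deg X θ

theorem wedge_mem_formDeg {p q : ℕ} {a b : Form R L} (ha : a ∈ formDeg R L p)
    (hb : b ∈ formDeg R L q) : wedge a b ∈ formDeg R L (p + q) := by
  obtain ⟨a, rfl⟩ := ha
  obtain ⟨b, rfl⟩ := hb
  exact ⟨_, (wedge_ofDeg p q a b).symm⟩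

theorem ofFun_mem_formDeg (f : R) : ofFun f ∈ formDeg R L 0 := ⟨_, rfl⟩

theorem ofDual_mem_formDeg (α : Module.Dual R L) : ofDual α ∈ formDeg R L 1 := ⟨_, rfl⟩

theorem formSignReal_of_mem {p : ℕ} {a : Form R L} (ha : a ∈ formDeg R L p) :
    formSignReal a = (-1 : ℝ) ^ p • a := by
  obtain ⟨a, rfl⟩ := ha
  exact (formSign_ofDeg p a).trans (neg_one_pow_real_smul p _)

theorem wedgeReal_comm (p q : ℕ) (a : Form R L) (ha : a ∈ formDeg R L p) (b : Form R L)
    (hb : b ∈ formDeg R L q) :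
    wedgeReal R L a b = (-1 : ℝ) ^ (p * q) • wedgeReal R L b a := by
  obtain ⟨a, rfl⟩ := ha
  obtain ⟨b, rfl⟩ := hb
  exact (wedge_comm p q a b).trans (neg_one_pow_real_smul _ _)

/-- Each term is grouped as the even derivation ξ∧i_X after the odd derivation i_Y, ready for
`IsEvenDerivation.isSecondOrder_mul`. -/
theorem two_smul_underlinePartial {π : ⋀[R]^2 L} {S : Finset (L × L)}
    (hS : toTensor π = ∑ a ∈ S, a.1 ⊗ₜ[R] a.2) (ψ : AltForm R L 3) :
    (2 : ℝ) • underlinePartial π ψ = ∑ a ∈ S, ∑ b ∈ S,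
      (wedge (ofDual (form3 ψ a.1 b.1)) * contract a.2).restrictScalars ℝ
        * intProdReal (ExteriorAlgebra.ι R b.2) := by
  refine LinearMap.ext fun η => ?_
  have h := LinearMap.congr_fun (two_smul_intProdDual_psiTwo hS ψ) η
  simp only [LinearMap.sum_apply, LinearMap.smul_apply] at h ⊢
  rw [← algebraMap_smul R (2 : ℝ), map_ofNat]
  refine Eq.trans h ?_
  refine Finset.sum_congr rfl fun a _ => Finset.sum_congr rfl fun b _ => ?_
  change wedge (ofDual (form3 ψ a.1 b.1)) (contract a.2 (contract b.2 η))
    = wedge (ofDual (form3 ψ a.1 b.1)) (contract a.2 (intProdReal (ExteriorAlgebra.ι R b.2) η))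
  rw [intProdReal_ι_apply]

theorem underlinePartial_ofDual (π : ⋀[R]^2 L) (ψ : AltForm R L 3) (α : Module.Dual R L) :
    underlinePartial π ψ (ofDual α) = 0 := by
  obtain ⟨S, hS⟩ := exists_toTensor_eq π
  have h := LinearMap.congr_fun (two_smul_intProdDual_psiTwo hS ψ) (ofDual α)
  refine two_smul_cancel (R := R) ?_
  refine Eq.trans h ?_
  simp [LinearMap.sum_apply, contract_ofDual, contract_ofFun]

theorem sharp_skew (π : ⋀[R]^2 L) (α β : Module.Dual R L) :
    α (sharp π β) = -β (sharp π α) := by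
  obtain ⟨S, hS⟩ := exists_toTensor_eq π
  have h := sum_skew_of_bilinear hS (fun X Y => α X * β Y)
    (fun X X' Y => by simp [add_mul]) (fun c X Y => by simp [mul_assoc])
    (fun X Y Y' => by simp [mul_add]) (fun c X Y => by simp [mul_left_comm])
  rw [sharp_eq_sum hS, sharp_eq_sum hS]
  simp only [map_sum, map_smul, smul_eq_mul]
  rw [← h]
  exact Finset.sum_congr rfl fun a _ => mul_comm _ _

theorem form3_skew (ψ : AltForm R L 3) (X Y : L) : form3 ψ X Y = -form3 ψ Y X := by
  ext Z
  rw [LinearMap.neg_apply, form3_apply, form3_apply]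
  exact map_vecCons_swap ψ X Y ![Z]

/-- i_X i_Y evaluates α∧β on (Y, X), hence the minus sign. The bracket of two 1-forms contains
-u(α∧β), so ψ⁽²⁾(α, β) enters it with a plus. -/
theorem underlinePartial_ofDual_wedge (π : ⋀[R]^2 L) (ψ : AltForm R L 3) (α β : Module.Dual R L) :
    underlinePartial π ψ (wedge (ofDual α) (ofDual β)) = -ofDual (psiTwoEval π ψ α β) := by
  obtain ⟨S, hS⟩ := exists_toTensor_eq π
  have h := LinearMap.congr_fun (two_smul_intProdDual_psiTwo hS ψ) (wedge (ofDual α) (ofDual β))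
  have h1 : ∀ ξ : Module.Dual R L, ∑ a ∈ S, ξ a.2 • a.1 = -sharp π ξ := fun ξ => by
    rw [sharp_eq_sum hS]
    exact sum_skew_of_bilinear hS (fun X Y => ξ X • Y) (fun X X' Y => by simp [add_smul])
      (fun c X Y => by simp [mul_smul]) (fun X Y Y' => by simp) (fun c X Y => by simp [smul_comm c])
  have h2 : ∀ ξ ζ : Module.Dual R L, ∑ a ∈ S, ∑ b ∈ S, (ξ a.2 * ζ b.2) • form3 ψ a.1 b.1
      = form3 ψ (sharp π ξ) (sharp π ζ) := fun ξ ζ => by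
    -- Pairing with the second leg of π gives -π♯; it happens in both arguments, so the signs
    -- cancel.
    have h3 : form3 ψ (sharp π ξ) (sharp π ζ) = form3 ψ (-sharp π ξ) (-sharp π ζ) := by simp
    rw [h3, ← h1, ← h1]
    simp only [map_sum, map_smul, LinearMap.sum_apply, LinearMap.smul_apply, Finset.smul_sum,
      mul_smul]
    rw [Finset.sum_comm]
    refine Finset.sum_congr rfl fun a _ => Finset.sum_congr rfl fun b _ => ?_
    rw [smul_comm]
  have h4 : ∀ a b : L × L, (wedge (ofDual (form3 ψ a.1 b.1)) * (contract a.2 * contract b.2) :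
      Module.End R (Form R L)) (wedge (ofDual α) (ofDual β))
      = ofDual ((β a.2 * α b.2) • form3 ψ a.1 b.1) - ofDual ((α a.2 * β b.2) • form3 ψ a.1 b.1) :=
    fun a b => by
      have h5 : contract a.2 (contract b.2 (wedge (ofDual α) (ofDual β)))
          = ofFun (β a.2 * α b.2 - α a.2 * β b.2) := by
        rw [contract_wedge, contract_ofDual, contract_ofDual, wedge_ofFun, formSign_ofDual,
          map_neg, LinearMap.neg_apply, wedge_ofFun_right, map_add, map_neg, map_smul, map_smul, contract_ofDual, contract_ofDual,
          map_sub, sub_eq_add_neg, mul_comm (β a.2), mul_comm (α a.2), ← smul_eq_mul,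
          ← smul_eq_mul, map_smul, map_smul]
      rw [Module.End.mul_apply, Module.End.mul_apply, h5, wedge_ofFun_right, map_smul, map_smul]
      exact sub_smul _ _ (ofDual (form3 ψ a.1 b.1))
  refine two_smul_cancel (R := R) ?_
  refine Eq.trans h ?_
  simp only [LinearMap.sum_apply, h4, Finset.sum_sub_distrib, ← map_sum]
  rw [h2, h2, ← map_sub, psiTwoEval, form3_skew ψ (sharp π β), two_smul, ← neg_add', map_neg,
    map_add]
  abel

end

namespace LieRinehart

variable {R L : Type*} [CommRing R] [Algebra ℝ R] [AddCommGroup L] [Module ℝ L]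
    [Module R L] [IsScalarTower ℝ R L] (A : LieRinehart R L)

theorem isEvenDerivation_lieForm (X : L) :
    IsEvenDerivation (wedgeReal R L) formSignReal (A.lieForm X) where
  sign := A.lieForm_formSign X
  leibniz := A.lieForm_wedge X

/-- From [d, i_X i_Y] = ℒ_X i_Y - i_X ℒ_Y, with the last product reordered at the cost of an
insertion of [Y, X]. Every term is then an insertion, or a Lie derivative after an insertion. -/
theorem two_smul_partialPi {π : ⋀[R]^2 L} {S : Finset (L × L)}
    (hS : toTensor π = ∑ a ∈ S, a.1 ⊗ₜ[R] a.2) :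
    (2 : ℝ) • A.partialPi π = ∑ a ∈ S,
      (A.lieForm a.1 * intProdReal (ExteriorAlgebra.ι R a.2)
        + (-1 : ℝ) • (A.lieForm a.2 * intProdReal (ExteriorAlgebra.ι R a.1))
        + intProdReal (ExteriorAlgebra.ι R (A.bracket a.2 a.1))) := by
  refine LinearMap.ext fun η => ?_
  have h : ∀ ζ : Form R L, (2 : ℝ) • intProd (π : ExteriorAlgebra R L) ζ
      = ∑ a ∈ S, contract a.1 (contract a.2 ζ) := fun ζ => by
    rw [← algebraMap_smul R (2 : ℝ), map_ofNat, ← LinearMap.smul_apply, two_smul_intProd hS,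
      LinearMap.sum_apply]
    rfl
  rw [LinearMap.smul_apply, partialPi_apply, smul_sub, ← map_smul, h, h, map_sum,
    ← Finset.sum_sub_distrib, LinearMap.sum_apply]
  refine Finset.sum_congr rfl fun a _ => ?_
  simp only [LinearMap.add_apply, LinearMap.smul_apply, Module.End.mul_apply, neg_one_smul,
    intProdReal_ι_apply]
  have h1 := A.contract_lieForm a.2 a.1 η
  rw [lieForm_apply, map_add] at h1
  rw [lieForm_apply A a.1, ← sub_eq_iff_eq_add'.mpr h1.symm]
  abel

theorem isSecondOrder_generator (π : ⋀[R]^2 L) (ψ : AltForm R L 3) :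
    IsSecondOrder (wedgeReal R L) formSignReal (A.generator π ψ) := by
  obtain ⟨S, hS⟩ := exists_toTensor_eq π
  have hc := isSignedCommutative_form (R := R) (L := L)
  have half : ∀ T : Module.End ℝ (Form R L), IsSecondOrder (wedgeReal R L) formSignReal ((2 : ℝ) • T)
      → IsSecondOrder (wedgeReal R L) formSignReal T := fun T hT => by
    have := hT.smul (1 / 2)
    rwa [smul_smul, show (1 / 2 : ℝ) * 2 = 1 by norm_num, one_smul] at this
  refine ((half _ ?_).add (half _ ?_)).add ((isOddDerivation_contract _).isSecondOrder hc)
  · rw [two_smul_partialPi A hS]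
    exact IsSecondOrder.sum fun a _ =>
      (((A.isEvenDerivation_lieForm _).isSecondOrder_mul hc (isOddDerivation_contract _)).add
      (((A.isEvenDerivation_lieForm _).isSecondOrder_mul hc (isOddDerivation_contract _)).smul _)).add
      ((isOddDerivation_contract _).isSecondOrder hc)
  · rw [two_smul_underlinePartial hS]
    exact IsSecondOrder.sum fun a _ => IsSecondOrder.sum fun b _ =>
      (isEvenDerivation_wedge_contract _ _).isSecondOrder_mul hc (isOddDerivation_contract _)

/-! ### Degree and parity of the generator -/

theorem generator_apply (π : ⋀[R]^2 L) (ψ : AltForm R L 3) (η : Form R L) :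
    A.generator π ψ η = A.partialPi π η + underlinePartial π ψ η
      + contract (sectionY π ψ) η := by
  rw [generator, LinearMap.add_apply, LinearMap.add_apply, intProdReal_ι_apply]

theorem d_mem_formDeg {q : ℕ} {η : Form R L} (h : η ∈ formDeg R L q) :
    A.d η ∈ formDeg R L (q + 1) := by
  obtain ⟨θ, rfl⟩ := h
  exact ⟨_, (A.d_ofDeg q θ).symm⟩

theorem lieForm_mem_formDeg (X : L) {q : ℕ} {η : Form R L} (h : η ∈ formDeg R L q) :
    A.lieForm X η ∈ formDeg R L q := by
  rw [lieForm_apply]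
  refine Submodule.add_mem _ (contract_mem_formDeg X (A.d_mem_formDeg h)) ?_
  cases q with
  | zero => rw [contract_eq_zero X h, map_zero]; exact Submodule.zero_mem _
  | succ q => exact A.d_mem_formDeg (contract_mem_formDeg X h)

theorem generator_mem_formDeg (π : ⋀[R]^2 L) (ψ : AltForm R L 3) (p : ℕ) (η : Form R L)
    (h : η ∈ formDeg R L (p + 1)) : A.generator π ψ η ∈ formDeg R L p := by
  obtain ⟨S, hS⟩ := exists_toTensor_eq π
  have half : ∀ z : Form R L, (2 : ℝ) • z ∈ formDeg R L p → z ∈ formDeg R L p := fun z hz => by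
    have := Submodule.smul_mem _ (1 / 2 : ℝ) hz
    rwa [smul_smul, show (1 / 2 : ℝ) * 2 = 1 by norm_num, one_smul] at this
  rw [generator_apply]
  refine Submodule.add_mem _ (Submodule.add_mem _ (half _ ?_) (half _ ?_))
    (contract_mem_formDeg _ h)
  · rw [← LinearMap.smul_apply, two_smul_partialPi A hS, LinearMap.sum_apply]
    refine Submodule.sum_mem _ fun a _ => ?_
    simp only [LinearMap.add_apply, LinearMap.smul_apply, Module.End.mul_apply,
      intProdReal_ι_apply]
    exact Submodule.add_mem _ (Submodule.add_mem _
      (A.lieForm_mem_formDeg _ (contract_mem_formDeg _ h))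
      (Submodule.smul_mem _ _ (A.lieForm_mem_formDeg _ (contract_mem_formDeg _ h))))
      (contract_mem_formDeg _ h)
  · rw [← LinearMap.smul_apply, two_smul_underlinePartial hS, LinearMap.sum_apply]
    refine Submodule.sum_mem _ fun a _ => ?_
    rw [LinearMap.sum_apply]
    refine Submodule.sum_mem _ fun b _ => ?_
    rw [Module.End.mul_apply, intProdReal_ι_apply]
    change wedge (ofDual (form3 ψ a.1 b.1)) (contract a.2 (contract b.2 η)) ∈ _
    -- In degree 1 two insertions already give zero; this is the case in which p - 1 is not a
    -- degree.
    cases p with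
    | zero =>
      rw [contract_eq_zero a.2 (contract_mem_formDeg _ h), map_zero]
      exact Submodule.zero_mem _
    | succ p =>
      rw [add_comm]
      exact wedge_mem_formDeg (ofDual_mem_formDeg _)
        (contract_mem_formDeg _ (contract_mem_formDeg _ h))

/-- In the decompositions of ∂_π and of the interior product by ψ⁽²⁾, an insertion acts first in
every term, and insertions kill functions. -/
theorem generator_eq_zero (π : ⋀[R]^2 L) (ψ : AltForm R L 3) (η : Form R L)
    (h : η ∈ formDeg R L 0) : A.generator π ψ η = 0 := by
  obtain ⟨S, hS⟩ := exists_toTensor_eq π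
  have half : ∀ z : Form R L, (2 : ℝ) • z = 0 → z = 0 := fun z hz => by
    have := congrArg ((1 / 2 : ℝ) • ·) hz
    simpa [smul_smul] using this
  have h1 : A.partialPi π η = 0 := half _ <| by
    rw [← LinearMap.smul_apply, two_smul_partialPi A hS, LinearMap.sum_apply]
    refine Finset.sum_eq_zero fun a _ => ?_
    simp only [LinearMap.add_apply, LinearMap.smul_apply, Module.End.mul_apply,
      intProdReal_ι_apply, contract_eq_zero _ h, map_zero, smul_zero, add_zero]
  have h2 : underlinePartial π ψ η = 0 := half _ <| by
    rw [← LinearMap.smul_apply, two_smul_underlinePartial hS, LinearMap.sum_apply]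
    refine Finset.sum_eq_zero fun a _ => ?_
    rw [LinearMap.sum_apply]
    refine Finset.sum_eq_zero fun b _ => ?_
    rw [Module.End.mul_apply, intProdReal_ι_apply, contract_eq_zero _ h, map_zero]
  rw [generator_apply, h1, h2, contract_eq_zero _ h, add_zero, add_zero]

theorem generator_formSign (π : ⋀[R]^2 L) (ψ : AltForm R L 3) (η : Form R L) :
    A.generator π ψ (formSign η) = -formSign (A.generator π ψ η) := by
  induction η using form_induction with
  | h0 => simp
  | h2 η θ hη hθ => simp only [map_add, hη, hθ, neg_add]
  | h1 q η =>
    rw [formSign_ofDeg, neg_one_pow_real_smul, map_smul]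
    cases q with
    | zero => rw [A.generator_eq_zero π ψ (ofDeg 0 η) ⟨η, rfl⟩]; simp
    | succ q =>
      have h := formSignReal_of_mem (A.generator_mem_formDeg π ψ q (ofDeg (q + 1) η) ⟨η, rfl⟩)
      rw [show formSign (A.generator π ψ (ofDeg (q + 1) η)) = _ from h, pow_succ, mul_neg_one,
        neg_smul]

/-- The Gerstenhaber bracket of a twisted Poisson structure. -/
noncomputable def dualGerstenhaberBracket (π : ⋀[R]^2 L) (ψ : AltForm R L 3) :
    Form R L →ₗ[ℝ] Form R L →ₗ[ℝ] Form R L :=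
  generatedBracket (wedgeReal R L) formSignReal (A.generator π ψ)

theorem isBVAlgebra {π : ⋀[R]^2 L} {ψ : AltForm R L 3} (h : A.IsTwistedPoisson π ψ) :
    IsBVAlgebra (formDeg R L) (wedgeReal R L) (ofFun (1 : R)) (A.dualGerstenhaberBracket π ψ)
      (A.generator π ψ) :=
  isBVAlgebra_generatedBracket isSignedCommutative_form isInternal_formDeg (ofFun_mem_formDeg 1)
    (fun a => (wedge_ofFun 1 a).trans (one_smul R a))
    (fun _ _ _ ha _ hb => wedge_mem_formDeg ha hb) wedgeReal_comm
    (fun _ _ ha => formSignReal_of_mem ha) (A.generator_formSign π ψ)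
    (fun η => LinearMap.congr_fun (A.generator_mul_self h) η) (A.generator_eq_zero π ψ)
    (A.generator_mem_formDeg π ψ) (A.isSecondOrder_generator π ψ)

/-! ### Values of the generated bracket on functions and 1-forms -/

theorem generator_smul (π : ⋀[R]^2 L) (ψ : AltForm R L 3) (f : R) (η : Form R L) :
    A.generator π ψ (f • η) = f • A.generator π ψ η + contract (sharp π (A.df f)) η := by
  have h : underlinePartial π ψ (f • η) = f • underlinePartial π ψ η :=
    map_smul (intProdDual (psiTwo π ψ)) f η
  rw [generator_apply, generator_apply, partialPi_smul, h, map_smul (contract _), smul_add, smul_add]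
  abel

/-- The bracket reduces to f u(α) - u(f α) = -⟨α, π♯ df⟩, and skew-symmetry of π turns this into
⟨df, π♯ α⟩. -/
theorem dualGerstenhaberBracket_ofFun (π : ⋀[R]^2 L) (ψ : AltForm R L 3) (α : Module.Dual R L)
    (f : R) :
    A.dualGerstenhaberBracket π ψ (ofDual α) (ofFun f) = ofFun (A.anchor (sharp π α) f) := by
  have h1 : formSignReal (ofDual α) = -ofDual α := formSign_ofDual α
  rw [dualGerstenhaberBracket, generatedBracket_odd h1]
  change -A.generator π ψ (wedge (ofDual α) (ofFun f))
    + wedge (A.generator π ψ (ofDual α)) (ofFun f)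
    - wedge (ofDual α) (A.generator π ψ (ofFun f)) = _
  rw [wedge_ofFun_right, wedge_ofFun_right, generator_smul, A.generator_eq_zero π ψ _ (ofFun_mem_formDeg f), map_zero,
    contract_ofDual, sharp_skew, map_neg, df_apply]
  abel

/-- The derivation i_Y drops out of the bracket, the interior product by ψ⁽²⁾ gives ψ⁽²⁾(α, β), and
∂_π gives the terms without ψ once i_π is moved past the 1-forms. -/
theorem dualGerstenhaberBracket_ofDual (π : ⋀[R]^2 L) (ψ : AltForm R L 3)
    (α β : Module.Dual R L) :
    A.dualGerstenhaberBracket π ψ (ofDual α) (ofDual β) = A.dualBracket π ψ α β := by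
  have h1 : formSignReal (ofDual α) = -ofDual α := formSign_ofDual α
  have hi : ∀ (ξ : Module.Dual R L) (η : Form R L),
      intProd (π : ExteriorAlgebra R L) (wedge (ofDual ξ) η)
        = wedge (ofDual ξ) (intProd (π : ExteriorAlgebra R L) η) - contract (sharp π ξ) η :=
    fun ξ η => by
      have h := wedge_intProd_sub ξ (π : ExteriorAlgebra R L) η
      rw [involute_bivector, contractLeft_bivector, intProd_ι] at h
      rw [← h]; abel
  have hsd : ∀ ξ : Module.Dual R L, formSign (A.d (ofDual ξ)) = A.d (ofDual ξ) := fun ξ => by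
    have h := A.d_formSign (ofDual ξ)
    rw [formSign_ofDual, map_neg] at h
    exact (neg_injective h).symm
  -- dα and i_π dα are even, so they commute with β and the rule `hi` for moving i_π past a linear
  -- form on the left applies to every product.
  have hcd : wedge (A.d (ofDual α)) (ofDual β) = wedge (ofDual β) (A.d (ofDual α)) :=
    isSignedCommutative_form.comm_even _ (hsd α) _
  have hsi : formSign (intProd (π : ExteriorAlgebra R L) (A.d (ofDual α)))
      = intProd (π : ExteriorAlgebra R L) (A.d (ofDual α)) := by
    obtain ⟨S, hS⟩ := exists_toTensor_eq π
    refine two_smul_cancel (R := R) ?_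
    rw [← map_smul, ← LinearMap.smul_apply, two_smul_intProd hS, LinearMap.sum_apply, map_sum]
    refine Finset.sum_congr rfl fun a _ => ?_
    have hs : ∀ (X : L) (η : Form R L), formSign (contract X η) = -contract X (formSign η) :=
      fun X η => by rw [contract_formSign, neg_neg]
    rw [Module.End.mul_apply, hs, hs, hsd, map_neg, neg_neg]
  have hci : wedge (intProd (π : ExteriorAlgebra R L) (A.d (ofDual α))) (ofDual β)
      = wedge (ofDual β) (intProd (π : ExteriorAlgebra R L) (A.d (ofDual α))) :=
    isSignedCommutative_form.comm_even _ hsi _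
  have hY := contract_wedge (sectionY π ψ) (ofDual α) (ofDual β)
  rw [formSign_ofDual] at hY
  rw [dualGerstenhaberBracket, generatedBracket_odd h1]
  change -A.generator π ψ (wedge (ofDual α) (ofDual β))
    + wedge (A.generator π ψ (ofDual α)) (ofDual β)
    - wedge (ofDual α) (A.generator π ψ (ofDual β)) = _
  rw [generator_apply, generator_apply, generator_apply, underlinePartial_ofDual,
    underlinePartial_ofDual, underlinePartial_ofDual_wedge, hY, partialPi_apply, partialPi_apply,
    partialPi_apply, d_wedge, formSign_ofDual, hcd, hi, intProd_ofDual, intProd_ofDual,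
    dualBracket, lieForm_apply, lieForm_apply]
  simp only [map_add, map_sub, map_neg, map_zero, LinearMap.add_apply, LinearMap.sub_apply,
    LinearMap.neg_apply, hi, hci, contract_ofDual, LinearMap.zero_apply]
  rw [sharp_skew π α β, map_neg, map_neg]
  abel

theorem isDualGerstenhaberBracket {π : ⋀[R]^2 L} {ψ : AltForm R L 3}
    (h : A.IsTwistedPoisson π ψ) :
    A.IsDualGerstenhaberBracket π ψ (A.dualGerstenhaberBracket π ψ) where
  gerstenhaber := (A.isBVAlgebra h).gerstenhaber
  br_ofFun := A.dualGerstenhaberBracket_ofFun π ψ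
  br_ofDual := A.dualGerstenhaberBracket_ofDual π ψ

end LieRinehart

/-! ### Uniqueness of the bracket -/

section

variable {R L : Type*} [CommRing R] [AddCommGroup L] [Module R L]

/-- The condition that a function `r` vanishes if `h * r = 0` for every function `h` such that
multiplication by `h` on `L` factors through a free module of finite rank. For sections of a vector
bundle it expresses the existence of local frames. -/
def HasLocalFrames (R L : Type*) [CommRing R] [AddCommGroup L] [Module R L] : Prop :=
  ∀ r : R, (∀ (m : ℕ) (ε : Fin m → Module.Dual R L) (e : Fin m → L) (h : R),
    (∀ v, ∑ i, ε i v • e i = h • v) → h * r = 0) → r = 0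

theorem HasLocalFrames.form_eq_zero (hL : HasLocalFrames R L) (η : Form R L)
    (h : ∀ (m : ℕ) (ε : Fin m → Module.Dual R L) (e : Fin m → L) (h : R),
      (∀ v, ∑ i, ε i v • e i = h • v) → h • η = 0) : η = 0 := by
  refine form_ext_eval fun n v => hL _ fun m ε e f hf => ?_
  have := congrArg (fun θ => formEval n θ v) (h m ε e f hf)
  exact this

end

section

variable {R L : Type*} [CommRing R] [Algebra ℝ R] [AddCommGroup L] [Module R L]

/-- A graded derivation of the algebra of forms that vanishes in degrees `0` and `1` vanishes. -/
theorem eq_zero_of_derivation (hL : HasLocalFrames R L) (T : Form R L →ₗ[ℝ] Form R L) (s : ℝ)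
    (hT : ∀ q, ∀ b ∈ formDeg R L q, ∀ c,
      T (wedge b c) = wedge (T b) c + s ^ q • wedge b (T c))
    (h0 : ∀ f, T (ofFun f) = 0) (h1 : ∀ α, T (ofDual α) = 0) (η : Form R L) : T η = 0 := by
  induction η using form_induction with
  | h0 => exact map_zero _
  | h2 η θ hη hθ => rw [map_add, hη, hθ, add_zero]
  | h1 q η =>
    induction q with
    | zero => rw [exists_ofFun_of_deg_zero, h0]
    | succ q ih =>
      refine hL.form_eq_zero _ fun m ε e f hf => ?_
      -- A derivation that vanishes on functions is linear over them.
      have hfun : ∀ g (ζ : Form R L), T (g • ζ) = g • T ζ := fun g ζ => by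
        have h := hT 0 (ofFun g) (ofFun_mem_formDeg g) ζ
        rwa [h0, map_zero, LinearMap.zero_apply, zero_add, pow_zero, one_smul, wedge_ofFun,
          wedge_ofFun] at h
      -- A multiple (q + 1) f η, with f the factor realized by the frame, is a sum of products of
      -- linear forms with forms of degree q. T vanishes on both kinds of factors, and q + 1 is
      -- invertible.
      have key := congrArg T (sum_wedge_contract Finset.univ ε e f hf (q + 1) η)
      rw [map_sum, hfun, Finset.sum_eq_zero fun i _ => ?_] at key
      · have hq : (((q + 1 : ℕ) : R) * f) • T (ofDeg (q + 1) η)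
            = ((q + 1 : ℕ) : ℝ) • f • T (ofDeg (q + 1) η) := by
          rw [mul_smul, ← algebraMap_smul R ((q + 1 : ℕ) : ℝ), map_natCast]
        rw [hq] at key
        exact (smul_eq_zero_iff_right (Nat.cast_ne_zero.mpr (Nat.succ_ne_zero q))).mp key.symm
      · rw [hT 1 _ (ofDual_mem_formDeg _), h1, contract_succ_deg, ih, map_zero, map_zero,
          LinearMap.zero_apply, smul_zero, add_zero]

end

namespace LieRinehart

variable {R L : Type*} [CommRing R] [Algebra ℝ R] [AddCommGroup L] [Module ℝ L]
    [Module R L] [IsScalarTower ℝ R L] (A : LieRinehart R L)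

/-- With the first argument fixed, the difference of two brackets is a graded derivation in the
second, so functions and 1-forms suffice there. Skew-symmetry then transfers the result: first
arguments that are functions or 1-forms come first, arbitrary ones last. -/
theorem isDualGerstenhaberBracket_unique (hL : HasLocalFrames R L) {π : ⋀[R]^2 L}
    {ψ : AltForm R L 3} {br br' : Form R L →ₗ[ℝ] Form R L →ₗ[ℝ] Form R L}
    (h : A.IsDualGerstenhaberBracket π ψ br) (h' : A.IsDualGerstenhaberBracket π ψ br') :
    br' = br := by
  have hder : ∀ p, ∀ a ∈ formDeg R L p, (∀ f, br' a (ofFun f) = br a (ofFun f)) →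
      (∀ α, br' a (ofDual α) = br a (ofDual α)) → ∀ b, br' a b = br a b := by
    intro p a ha h0 h1 b
    refine sub_eq_zero.mp (eq_zero_of_derivation hL (br' a - br a) ((-1) ^ (p + 1)) ?_
      (fun f => sub_eq_zero.mpr (h0 f)) (fun α => sub_eq_zero.mpr (h1 α)) b)
    intro q b hb c
    have e := h.gerstenhaber.br_mul p q a ha b hb c
    have e' := h'.gerstenhaber.br_mul p q a ha b hb c
    change br' a (wedge b c) - br a (wedge b c) = wedge (br' a b - br a b) c
      + ((-1 : ℝ) ^ (p + 1)) ^ q • wedge b (br' a c - br a c)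
    change br a (wedge b c) = wedge (br a b) c + (-1 : ℝ) ^ ((p + 1) * q) • wedge b (br a c) at e
    change br' a (wedge b c) = wedge (br' a b) c + (-1 : ℝ) ^ ((p + 1) * q) • wedge b (br' a c)
      at e'
    rw [e, e', map_sub, map_sub, LinearMap.sub_apply, smul_sub, pow_mul]
    abel
  have hskew : ∀ p q, ∀ a ∈ formDeg R L p, ∀ b ∈ formDeg R L q, br' b a = br b a →
      br' a b = br a b := by
    intro p q a ha b hb e
    rw [h.gerstenhaber.br_skew p q a ha b hb, h'.gerstenhaber.br_skew p q a ha b hb, e]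
  have hfun : ∀ f b, br' (ofFun f) b = br (ofFun f) b := fun f =>
    hder 0 _ (ofFun_mem_formDeg f)
      (fun g => by
        rw [h.gerstenhaber.br_zero _ (ofFun_mem_formDeg f) _ (ofFun_mem_formDeg g),
          h'.gerstenhaber.br_zero _ (ofFun_mem_formDeg f) _ (ofFun_mem_formDeg g)])
      fun α => hskew 0 1 _ (ofFun_mem_formDeg f) _ (ofDual_mem_formDeg α)
        ((h'.br_ofFun α f).trans (h.br_ofFun α f).symm)
  have hdual : ∀ α b, br' (ofDual α) b = br (ofDual α) b := fun α =>
    hder 1 _ (ofDual_mem_formDeg α) (fun f => (h'.br_ofFun α f).trans (h.br_ofFun α f).symm)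
      fun β => (h'.br_ofDual α β).trans (h.br_ofDual α β).symm
  refine LinearMap.ext fun a => LinearMap.ext fun b => ?_
  induction a using form_induction with
  | h0 => rw [map_zero, map_zero]
  | h2 a a' ha ha' => rw [map_add, map_add, LinearMap.add_apply, LinearMap.add_apply, ha, ha']
  | h1 p a =>
    exact hder p _ ⟨a, rfl⟩
      (fun f => hskew p 0 _ ⟨a, rfl⟩ _ (ofFun_mem_formDeg f) (hfun f _))
      (fun α => hskew p 1 _ ⟨a, rfl⟩ _ (ofDual_mem_formDeg α) (hdual α _)) b

end LieRinehart

/-! ### Local frames of vector bundles -/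

section

variable {n : ℕ} {M : Type*} [TopologicalSpace M]
    [ChartedSpace (EuclideanSpace ℝ (Fin n)) M]
    {F : Type*} [NormedAddCommGroup F] [NormedSpace ℝ F]
    {V : M → Type*} [TopologicalSpace (Bundle.TotalSpace F V)] [∀ x, AddCommGroup (V x)]
    [∀ x, Module ℝ (V x)] [∀ x, TopologicalSpace (V x)] [FiberBundle F V] [VectorBundle ℝ F V]

theorem sum_section_apply {ι : Type*} (s : Finset ι) (t : ι → Cₛ^∞⟮𝓡 n; F, V⟯) (x : M) :
    (∑ i ∈ s, t i) x = ∑ i ∈ s, t i x := by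
  classical
  induction s using Finset.induction_on with
  | empty => rfl
  | insert i s hi ih => rw [Finset.sum_insert hi, Finset.sum_insert hi, ← ih]; rfl

variable [IsManifold (𝓡 n) ∞ M] [T2Space M] [FiniteDimensional ℝ F]
  [ContMDiffVectorBundle ∞ F V (𝓡 n)]

/-- A bump function χ supported where the bundle is trivial extends a local frame and its
coefficient functionals by zero to the whole of M. Both are multiplied by χ, so the frame identity
holds with factor χ², which is 1 at x. -/
theorem exists_frame_at (x : M) :
    ∃ (m : ℕ) (ε : Fin m → Module.Dual C^∞⟮𝓡 n, M; ℝ⟯ Cₛ^∞⟮𝓡 n; F, V⟯)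
      (e : Fin m → Cₛ^∞⟮𝓡 n; F, V⟯) (h : C^∞⟮𝓡 n, M; ℝ⟯),
      (∀ v, ∑ i, ε i v • e i = h • v) ∧ h x ≠ 0 := by
  let t := trivializationAt F V x
  let b := Module.finBasis ℝ F
  have : ContMDiffVectorBundle 1 F V (𝓡 n) := ContMDiffVectorBundle.of_le (n := ∞) (by simp)
  -- The closed support of χ must lie in the trivializing set, so that the extensions by zero are
  -- smooth at its boundary.
  obtain ⟨χ, hχ⟩ := (SmoothBumpFunction.nhds_basis_tsupport (I := 𝓡 n) x).mem_iff.mp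
    (t.open_baseSet.mem_nhds (FiberBundle.mem_baseSet_trivializationAt' x))
  have hχ' : tsupport χ ⊆ t.baseSet := hχ.2
  have hsupp : ∀ y, y ∉ t.baseSet → χ y = 0 := fun y hy =>
    image_eq_zero_of_notMem_tsupport fun h => hy (hχ' h)
  let e : Fin (Module.finrank ℝ F) → Cₛ^∞⟮𝓡 n; F, V⟯ := fun i =>
    ⟨fun y => χ y • t.localFrame b i y,
      ContMDiffOn.smul_section_of_tsupport χ.contMDiff.contMDiffOn t.open_baseSet hχ'
        (t.contMDiffOn_localFrame_baseSet ∞ b i)⟩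
  let ε : Fin (Module.finrank ℝ F) → Module.Dual C^∞⟮𝓡 n, M; ℝ⟯ Cₛ^∞⟮𝓡 n; F, V⟯ := fun i =>
    { toFun := fun v => ⟨fun y => χ y • t.localFrameCoeff (𝓡 n) b i y (v y),
        contMDiff_of_tsupport fun y hy => by
          have hy' : y ∈ t.baseSet := hχ' (closure_mono (fun z hz => by
            contrapose! hz
            simp only [Function.mem_support, ne_eq, not_not] at hz ⊢
            rw [hz, zero_smul]) hy)
          exact χ.contMDiff.contMDiffAt.smul
            (contMDiffAt_localFrameCoeff b hy' v.contMDiff.contMDiffAt i)⟩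
      map_add' := fun v w => by
        ext y
        change χ y • t.localFrameCoeff (𝓡 n) b i y (v y + w y) = _
        rw [map_add, smul_add]
        rfl
      map_smul' := fun f v => by
        ext y
        change χ y • t.localFrameCoeff (𝓡 n) b i y (f y • v y) = _
        rw [map_smul, smul_comm]
        rfl }
  refine ⟨_, ε, e, ⟨χ, χ.contMDiff⟩ * ⟨χ, χ.contMDiff⟩, fun v => ?_, ?_⟩
  · ext y
    rw [sum_section_apply]
    change ∑ i, (χ y • t.localFrameCoeff (𝓡 n) b i y (v y)) • (χ y • t.localFrame b i y)
      = (χ y * χ y) • v y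
    by_cases hy : y ∈ t.baseSet
    · have hv := Bundle.Trivialization.eq_sum_localFrameCoeff_smul (e := t) (b := b) (I := 𝓡 n)
        (s := fun z => v z) hy
      refine Eq.trans ?_ (congrArg ((χ y * χ y) • ·) hv.symm)
      simp only [Finset.smul_sum]
      refine Finset.sum_congr rfl fun i _ => ?_
      rw [smul_smul, smul_smul, smul_eq_mul, mul_right_comm]
    · simp [hsupp y hy]
  · change χ x * χ x ≠ 0
    rw [χ.eq_one]
    norm_num

theorem hasLocalFrames_section : HasLocalFrames C^∞⟮𝓡 n, M; ℝ⟯ Cₛ^∞⟮𝓡 n; F, V⟯ := by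
  intro r hr
  ext x
  obtain ⟨m, ε, e, h, hh, hx⟩ := exists_frame_at (n := n) (F := F) (V := V) x
  have := congrArg (fun f : C^∞⟮𝓡 n, M; ℝ⟯ => f x) (hr m ε e h hh)
  exact (mul_eq_zero.mp this).resolve_left hx

end

end TwistedPoisson

/-! ### The theorem for Lie algebroids -/

theorem mainTheorem1 {n : ℕ} {M : Type*} [TopologicalSpace M]
    [ChartedSpace (EuclideanSpace ℝ (Fin n)) M] [IsManifold (𝓡 n) ∞ M]
    [T2Space M] [SecondCountableTopology M]
    {F : Type*} [NormedAddCommGroup F] [NormedSpace ℝ F] [FiniteDimensional ℝ F]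
    {V : M → Type*} [TopologicalSpace (Bundle.TotalSpace F V)] [∀ x, AddCommGroup (V x)]
    [∀ x, Module ℝ (V x)] [∀ x, TopologicalSpace (V x)] [FiberBundle F V] [VectorBundle ℝ F V]
    [ContMDiffVectorBundle ∞ F V (𝓡 n)]
    (A : LieAlgebroid (𝓡 n) M F V)
    (π : ⋀[C^∞⟮𝓡 n, M; ℝ⟯]^2 Cₛ^∞⟮𝓡 n; F, V⟯)
    (ψ : AltForm C^∞⟮𝓡 n, M; ℝ⟯ Cₛ^∞⟮𝓡 n; F, V⟯ 3)
    (h : A.toLieRinehart.IsTwistedPoisson π ψ) :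
    ∃ br : Form C^∞⟮𝓡 n, M; ℝ⟯ Cₛ^∞⟮𝓡 n; F, V⟯ →ₗ[ℝ]
        Form C^∞⟮𝓡 n, M; ℝ⟯ Cₛ^∞⟮𝓡 n; F, V⟯ →ₗ[ℝ] Form C^∞⟮𝓡 n, M; ℝ⟯ Cₛ^∞⟮𝓡 n; F, V⟯,
      A.toLieRinehart.IsDualGerstenhaberBracket π ψ br ∧
      (∀ br', A.toLieRinehart.IsDualGerstenhaberBracket π ψ br' → br' = br) ∧
      IsBVAlgebra (formDeg C^∞⟮𝓡 n, M; ℝ⟯ Cₛ^∞⟮𝓡 n; F, V⟯)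
        (wedgeReal C^∞⟮𝓡 n, M; ℝ⟯ Cₛ^∞⟮𝓡 n; F, V⟯)
        (ofFun (1 : C^∞⟮𝓡 n, M; ℝ⟯)) br (A.toLieRinehart.generator π ψ) :=
  ⟨A.toLieRinehart.dualGerstenhaberBracket π ψ, A.toLieRinehart.isDualGerstenhaberBracket h,
    fun _ h' => A.toLieRinehart.isDualGerstenhaberBracket_unique hasLocalFrames_section
      (A.toLieRinehart.isDualGerstenhaberBracket h) h',
    A.toLieRinehart.isBVAlgebra h⟩
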